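/- **Setting.** Let $Q$ be a smooth $n$-manifold without boundary (Hausdorff, $\sigma$-compact; in particular any closed manifold $Q\subseteq\mathbb R^3$) with a volume form $dq$. Local coordinates $(q^\ell)$ on $Q$ induce coordinates $(q^\ell,p_\ell)$ on $T^*Q$; $\{h,g\}=\frac{\partial h}{\partial q^\ell}\frac{\partial g}{\partial p_\ell}-\frac{\partial g}{\partial q^\ell}\frac{\partial h}{\partial p_\ell}$ is the canonical Poisson bracket, and the fibre volume $dp$ is normalised so that $dq\,dp$ is the symplectic volume. Repeated indices $\ell,i,j,i_1,\dots$ of coordinates are summed. *The Lie algebra.* $\mathcal F_0(T^*Q)$ is the space of formal power series $h=\sum_{k\ge0}h_k$, $h_k=X^{i_1\dots i_k}(q)\,p_{i_1}\cdots p_{i_k}$ with smooth coefficients, with Lie bracket $[h,g]=-\{h,g\}$. It is the direct sum of the subalgebras $\hat{\mathfrak s}=\{h: h_k=0\ \forall k\ge2\}$ and $\hat{\mathfrak n}=\{h: h_0=h_1=0\}$; we write $h^{\hat{\mathfrak s}},h^{\hat{\mathfrak n}}$ for the components of $h$. For $X\in\hat{\mathfrak n}$, $\sigma\in\hat{\mathfrak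 s}$ put $X\triangleright\sigma=[X,\sigma]^{\hat{\mathfrak s}}$ and $X\triangleleft\sigma=[X,\sigma]^{\hat{\mathfrak n}}$. *The dual space.* $\mathcal F_0^*(T^*Q)$ consists of the smooth $f:T^*Q\to\mathbb R$, supported over a compact subset of $Q$ and rapidly decreasing along the fibres together with all derivatives (locally uniformly in $q$), whose fibre moments $\int p_{i_1}\cdots p_{i_k}f\,dp$ vanish for all sufficiently large $k$. It is paired with $\mathcal F_0(T^*Q)$ by $\langle f,h\rangle=\sum_k\int_{T^*Q}f\,h_k\,dq\,dp$ (a finite sum). Equations in $\mathcal F_0^*(T^*Q)$ are equations between functionals on $\mathcal F_0(T^*Q)$; in particular $\frac{df}{dt}=A$ means $\frac{d}{dt}\langle f,g\rangle=A(g)$ for all $g\in\mathcal F_0(T^*Q)$, and $\{h,f\}$ denotes the functional $g\mapsto\sum_j\langle\{h_j,f\},g\rangle$ for $h\in\mathcal F_0(T^*Q)$, $f\in\mathcal F_0^*(T^*Q)$ (a finite sum for each $g$). The coadjoint action is $\langle\mathrm{ad}^*_hf,g\rangle=\langle f,[g,h]\rangle$. Let $\hat{\mathfrak s}^*$ (resp.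 $\hat{\mathfrak n}^*$) be the set of $f\in\mathcal F_0^*(T^*Q)$ whose moments of order $\ge2$ (resp. of order $0$ and $1$) vanish. *Moment parts.* For $f\in\mathcal F_0^*(T^*Q)$ let $m$ be the least number such that all moments of order $>m$ vanish. For $g$ without moments of order $>r$ put $g_0=g$, $g_{k+1}=-\frac{\partial (p_\ell g_k)}{\partial p_\ell}-k\,g_k$, $T_r g=\frac1{r!}g_r$. Then $f_{(m)}=T_mf$, $f_{(m-1)}=T_{m-1}(f-f_{(m)})$, …, $f_{(0)}=T_0(f-f_{(m)}-\dots-f_{(1)})$, and $f_{(k)}=0$ for $k>m$; $f_{\mathfrak s}=f_{(0)}+f_{(1)}$, $f_{\mathfrak n}=\sum_{k\ge2}f_{(k)}$. *Functional derivatives.* For $\mathcal H:\mathcal F_0^*(T^*Q)\to\mathbb R$, the derivative $\frac{\partial\mathcal H}{\partial f}\in\mathcal F_0(T^*Q)$ at $f$ is characterised by $\frac{d}{d\varepsilon}\big|_{0}\mathcal H(f+\varepsilon u)=\langle u,\frac{\partial\mathcal H}{\partial f}\rangle$ for all $u\in\mathcal F_0^*(T^*Q)$. Likewise $\frac{\partial\mathcal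 H}{\partial f_{\mathfrak s}}\in\hat{\mathfrak s}$, $\frac{\partial\mathcal H}{\partial f_{\mathfrak n}}\in\hat{\mathfrak n}$, and $\frac{\partial\mathcal H}{\partial f_{(k)}}$ (homogeneous of degree $k$ in $p$) are characterised by the same identity for $u\in\hat{\mathfrak s}^*$, for $u\in\hat{\mathfrak n}^*$, and for the $u$ that have moments of order $k$ only. **Corollary 4.7.** 1. For every $f\in\mathcal F_0^*(T^*Q)$ the function $f_{(k)}$ has the same moments of order $k$ as $f$ and no moments of other orders, $f_{\mathfrak s}\in\hat{\mathfrak s}^*$, $f_{\mathfrak n}\in\hat{\mathfrak n}^*$ and $f=f_{\mathfrak s}+f_{\mathfrak n}$; in $\mathcal F_0^*(T^*Q)$ this decomposition is unique. So $\mathcal F_0^*(T^*Q)=\hat{\mathfrak s}^*\oplus\hat{\mathfrak n}^*$. 2. If $\frac{\partial\mathcal H}{\partial f}=h$ exists at $f$, it is unique, and $\frac{\partial\mathcal H}{\partial f_{\mathfrak s}},\frac{\partial\mathcal H}{\partial f_{\mathfrak n}},\frac{\partial\mathcal H}{\partial f_{(k)}}$ exist, are unique, and equal $h^{\hat{\mathfrak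 s}},h^{\hat{\mathfrak n}},h_k$. 3. Let $J\subseteq\mathbb R$ be open, let $t\mapsto f_{\mathfrak s}(t)\in\hat{\mathfrak s}^*$, $t\mapsto f_{\mathfrak n}(t)\in\hat{\mathfrak n}^*$ ($t\in J$) be curves, $f=f_{\mathfrak s}+f_{\mathfrak n}$, and let $\mathcal H=\mathcal H(f_{\mathfrak s},f_{\mathfrak n})=\mathcal H(f)$ have a functional derivative at $f(t)$ for every $t\in J$. Then $f$ satisfies the Lie–Poisson equation $\frac{df}{dt}=-\mathrm{ad}^*_{\partial\mathcal H/\partial f}f$ on $J$ if and only if $(f_{\mathfrak s},f_{\mathfrak n})$ satisfies on $J$ $$\frac{df_{\mathfrak s}}{dt}=\Big\{\frac{\partial\mathcal H}{\partial f_{\mathfrak s}},f_{(0)}\Big\}+\Big\{\frac{\partial\mathcal H}{\partial f_{(1)}},f_{(1)}\Big\}+\Big\{\frac{\partial\mathcal H}{\partial f_{\mathfrak n}},f_{\mathfrak s}\Big\}+\sum_{k\ge2}\Big(\Big\{\frac{\partial\mathcal H}{\partial f_{(k)}},f_{(k)}\Big\}+\Big\{\frac{\partial\mathcal H}{\partial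 f_{(k+1)}},f_{(k)}\Big\}\Big),$$ $$\frac{df_{\mathfrak n}}{dt}=\sum_{k\ge2}\sum_{\ell\ge1}\Big\{\frac{\partial\mathcal H}{\partial f_{(k)}},f_{(\ell+k)}\Big\}+\Big\{\frac{\partial\mathcal H}{\partial f_{\mathfrak s}},f_{\mathfrak n}\Big\}+\Big\{\frac{\partial\mathcal H}{\partial f_{(0)}},f_{(1)}\Big\}.$$ 4. These are the matched Lie–Poisson equations of the pair $(\hat{\mathfrak s},\hat{\mathfrak n})$: for $\sigma\in\hat{\mathfrak s}$, $X\in\hat{\mathfrak n}$, $f_{\mathfrak s}\in\hat{\mathfrak s}^*$, $f_{\mathfrak n}\in\hat{\mathfrak n}^*$, $f=f_{\mathfrak s}+f_{\mathfrak n}$, $$-\mathrm{ad}^*_\sigma f_{\mathfrak s}=\{\sigma,f_{(0)}\}+\{\sigma_1,f_{(1)}\},\quad f_{\mathfrak s}\overset{*}{\triangleleft}X=\{X,f_{\mathfrak s}\},\quad \mathfrak a^*_Xf_{\mathfrak n}=\sum_{k\ge2}\big(\{X_k,f_{(k)}\}+\{X_{k+1},f_{(k)}\}\big),$$ $$-\mathrm{ad}^*_Xf_{\mathfrak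 n}=\sum_{k\ge2}\sum_{\ell\ge1}\{X_k,f_{(\ell+k)}\},\quad -\sigma\overset{*}{\triangleright}f_{\mathfrak n}=\{\sigma,f_{\mathfrak n}\},\quad -\mathfrak b^*_\sigma f_{\mathfrak s}=\{\sigma_0,f_{(1)}\},$$ where $\mathrm{ad}^*_\sigma$, $\mathrm{ad}^*_X$ are the coadjoint actions of $\hat{\mathfrak s}$ and of $\hat{\mathfrak n}$, $\overset{*}{\triangleleft}X$ and $\mathfrak b^*_\sigma$ are the transposes of $\sigma'\mapsto X\triangleright\sigma'$ and of $X'\mapsto X'\triangleright\sigma$, and $\sigma\overset{*}{\triangleright}$ and $\mathfrak a^*_X$ are the transposes of $X'\mapsto X'\triangleleft\sigma$ and of $\sigma'\mapsto X\triangleleft\sigma'$ (functionals on $\hat{\mathfrak s}$ and $\hat{\mathfrak n}$ being extended to $\mathcal F_0(T^*Q)$ by zero on the other summand). 5. Let $m>0$, $e\in\mathbb R$, $\phi$ a smooth function on $Q$, $p^2=g^{ij}(q)p_ip_j$ for a Riemannian metric on $Q$, $h=\frac{p^2}{2m}+e\phi$ and $\mathcal H(f)=\int_{T^*Q}f\,h\,dq\,dp$.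 Then at every $f$ $$\frac{\partial\mathcal H}{\partial f}=h,\quad\frac{\partial\mathcal H}{\partial f_{\mathfrak s}}=\frac{\partial\mathcal H}{\partial f_{(0)}}=e\phi,\quad\frac{\partial\mathcal H}{\partial f_{\mathfrak n}}=\frac{\partial\mathcal H}{\partial f_{(2)}}=\frac{p^2}{2m},\quad\frac{\partial\mathcal H}{\partial f_{(k)}}=0\ (k\ne0,2).$$ On open $J\subseteq\mathbb R$, the Lie–Poisson equation of $\mathcal H$ is equivalent to the Vlasov equation $\frac{df}{dt}=\{h,f\}$, whose right-hand side is $e\frac{\partial\phi}{\partial q^\ell}\frac{\partial f}{\partial p_\ell}-\frac1m\delta^{ij}p_i\frac{\partial f}{\partial q^j}$ in coordinates with $p^2=\delta^{ij}p_ip_j$; and for curves $f=f_{\mathfrak s}+f_{\mathfrak n}$ as in 3 it is equivalent to $$\frac{df_{\mathfrak s}}{dt}=\{e\phi,f_{(0)}\}+\Big\{\frac{p^2}{2m},f_{\mathfrak s}\Big\}+\Big\{\frac{p^2}{2m},f_{(2)}\Big\},\qquad\frac{df_{\mathfrak n}}{dt}=\sum_{\ell\ge1}\Big\{\frac{p^2}{2m},f_{(\ell+2)}\Big\}+\{e\phi,f_{\mathfrak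 n}\}+\{e\phi,f_{(1)}\}.$$ -/

import Mathlib

open scoped Manifold ContDiff InnerProductSpace
open MeasureTheory

noncomputable section

namespace VlasovMatched

/-- The coordinate space `ℝⁿ`, used for chart coordinates `q = (q^ℓ)` and for the
components `p = (p_ℓ)` of a covector. -/
abbrev E (n : ℕ) := EuclideanSpace ℝ (Fin n)

/-- The `ℓ`-th coordinate vector of `ℝⁿ`. -/
def ev {n : ℕ} (l : Fin n) : E n := EuclideanSpace.single l (1 : ℝ)

/-- Real functions on `T*Q`. The covector `∑ p_ℓ dq^ℓ` at `q`, written in the coordinates `(q^ℓ)`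
of the preferred chart at `q`, is recorded as the pair `(q, p)`. -/
abbrev PhaseFn (n : ℕ) (Q : Type*) := Q → E n → ℝ

/-- Formal series `∑ₖ h k` of functions on `T*Q`; `h k` is to be the term of degree `k` in the
momenta. -/
abbrev FormalFn (n : ℕ) (Q : Type*) := ℕ → PhaseFn n Q

/-! ### Functions on the cotangent bundle in charts -/

section Charts

variable {n : ℕ} {Q : Type*} [TopologicalSpace Q] [ChartedSpace (E n) Q] [IsManifold (𝓡 n) ∞ Q]

/-- The expression of `F : T*Q → ℝ` in the coordinates `(q^ℓ, p_ℓ)` that the preferred chart at `c`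
induces on `T*Q`. If `A` is the derivative at `q` of the change of coordinates from the chart at `q`
to the chart at `c`, a covector with components `p` for the chart at `c` has components `Aᵀ p` for
the chart at `q`. -/
def inChart (c : Q) (F : PhaseFn n Q) (z : E n × E n) : ℝ :=
  F ((extChartAt (𝓡 n) c).symm z.1)
    ((tangentCoordChange (𝓡 n) ((extChartAt (𝓡 n) c).symm z.1) c
      ((extChartAt (𝓡 n) c).symm z.1)).adjoint z.2)

/-- Smooth functions on `T*Q`. -/
def IsSmooth (F : PhaseFn n Q) : Prop :=
  ∀ c : Q, ContDiffOn ℝ ∞ (inChart c F) ((extChartAt (𝓡 n) c).target ×ˢ Set.univ)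

/-- `∂F/∂q^ℓ` at `(q, p)`, in the coordinates of the chart at `q`. -/
def dq (l : Fin n) (F : PhaseFn n Q) : PhaseFn n Q := fun q p =>
  fderiv ℝ (inChart q F) (extChartAt (𝓡 n) q q, p) (ev l, 0)

/-- `∂F/∂p_ℓ` at `(q, p)`, in the coordinates of the chart at `q`. -/
def dp (l : Fin n) (F : PhaseFn n Q) : PhaseFn n Q := fun q p =>
  fderiv ℝ (inChart q F) (extChartAt (𝓡 n) q q, p) (0, ev l)

/-- The canonical Poisson bracket
`{h, g} = ∂h/∂q^ℓ ∂g/∂p_ℓ - ∂g/∂q^ℓ ∂h/∂p_ℓ` on `T*Q`. -/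
def poisson (h g : PhaseFn n Q) : PhaseFn n Q := fun q p =>
  ∑ l : Fin n, (dq l h q p * dp l g q p - dq l g q p * dp l h q p)

/-! ### The Lie algebra `F₀(T*Q)` -/

/-- `F(q, p) = X^{i₁…i_k}(q) p_{i₁} ⋯ p_{i_k}` with smooth coefficients. -/
def IsHomogeneous (k : ℕ) (F : PhaseFn n Q) : Prop :=
  IsSmooth F ∧ ∀ q : Q, ∃ X : (Fin k → Fin n) → ℝ,
    ∀ p : E n, F q p = ∑ i : Fin k → Fin n, X i * ∏ a : Fin k, p (i a)

variable (n Q) in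
/-- `F₀(T*Q)`: formal power series in the momenta with coefficients smooth on `Q`. -/
def F₀ : Set (FormalFn n Q) := {h | ∀ k, IsHomogeneous k (h k)}

variable (n Q) in
/-- `ŝ`: the series `σ(q) + Y^ℓ(q) p_ℓ`. -/
def sHat : Set (FormalFn n Q) := {h | h ∈ F₀ n Q ∧ ∀ k, 2 ≤ k → h k = 0}

variable (n Q) in
/-- `n̂`: the series with terms of degree at least two only. -/
def nHat : Set (FormalFn n Q) := {h | h ∈ F₀ n Q ∧ ∀ k, k < 2 → h k = 0}

variable (n Q) in
/-- The series that consist of a term of degree `k` only. -/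
def degHat (k : ℕ) : Set (FormalFn n Q) := {h | h ∈ F₀ n Q ∧ ∀ j, j ≠ k → h j = 0}

/-- The `ŝ`-part of a series. -/
def sPart (h : FormalFn n Q) : FormalFn n Q := fun k => if k < 2 then h k else 0

/-- The `n̂`-part of a series. -/
def nPart (h : FormalFn n Q) : FormalFn n Q := fun k => if k < 2 then 0 else h k

/-- The series whose only term is `F`, in degree `k`. -/
def ofDegree (k : ℕ) (F : PhaseFn n Q) : FormalFn n Q := fun j => if j = k then F else 0

/-- The term of degree `k` of a series. -/
def degPart (k : ℕ) (h : FormalFn n Q) : FormalFn n Q := ofDegree k (h k)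

/-- The Lie bracket of `F₀(T*Q)`: the opposite `[h, g] = -{h, g}` of the Poisson bracket, collected
by degree (`{h i, g j}` has degree `i + j - 1`, and vanishes for `i = j = 0`). -/
def lie (h g : FormalFn n Q) : FormalFn n Q := fun k =>
  -∑ i ∈ Finset.range (k + 2), poisson (h i) (g (k + 1 - i))

/-! ### The dual space: functions with finite moments -/

/-- Smooth functions on `T*Q` with support over a compact subset of `Q` (no condition if `Q` is
compact) that are rapidly decreasing along the fibres, together with all their derivatives, locally
uniformly in `q`. All integrals below converge for these functions. -/
def IsAdmissible (f : PhaseFn n Q) : Prop :=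
  IsSmooth f ∧
  (∃ K : Set Q, IsCompact K ∧ ∀ q, q ∉ K → ∀ p, f q p = 0) ∧
  ∀ (c : Q) (K : Set (E n)), IsCompact K → K ⊆ (extChartAt (𝓡 n) c).target →
    ∀ j N : ℕ, ∃ C : ℝ, ∀ x ∈ K, ∀ p : E n,
      ‖p‖ ^ N * ‖iteratedFDeriv ℝ j (inChart c f) (x, p)‖ ≤ C

/-- The moment `∫ p_{i₁} ⋯ p_{i_k} f(q, p) dp` over the fibre at `q`. (The normalisation of `dp` is
immaterial for the vanishing of moments, which is all that this is used for.) -/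
def moment (f : PhaseFn n Q) {k : ℕ} (i : Fin k → Fin n) (q : Q) : ℝ :=
  ∫ p : E n, (∏ a : Fin k, p (i a)) * f q p

/-- All the moments of order `k` vanish. -/
def MomentVanishes (k : ℕ) (f : PhaseFn n Q) : Prop :=
  ∀ (i : Fin k → Fin n) (q : Q), moment f i q = 0

variable (n Q) in
/-- `F₀*(T*Q)`: the functions with finite moments. -/
def F₀Dual : Set (PhaseFn n Q) :=
  {f | IsAdmissible f ∧ ∃ N : ℕ, ∀ k, N ≤ k → MomentVanishes k f}

variable (n Q) in
/-- `ŝ*`: the moments of order at least two vanish. -/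
def sDual : Set (PhaseFn n Q) := {f | IsAdmissible f ∧ ∀ k, 2 ≤ k → MomentVanishes k f}

variable (n Q) in
/-- `n̂*`: finite moments, those of order zero and one vanish. -/
def nDual : Set (PhaseFn n Q) := {f | f ∈ F₀Dual n Q ∧ ∀ k, k < 2 → MomentVanishes k f}

variable (n Q) in
/-- The functions that have moments of order `k` only. -/
def degDual (k : ℕ) : Set (PhaseFn n Q) :=
  {f | IsAdmissible f ∧ ∀ j, j ≠ k → MomentVanishes j f}

/-! ### The moment decomposition `f = ∑ₖ f_(k)` -/

/-- `f ↦ -∂(p_ℓ f)/∂p_ℓ` (sum over `ℓ`). It multiplies the moments of order `k` by `k`. -/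
def euler (f : PhaseFn n Q) : PhaseFn n Q := fun q p =>
  -∑ l : Fin n, fderiv ℝ (fun p' : E n => p' l * f q p') p (ev l)

/-- `f_0 = f`, `f_{k+1} = euler f_k - k f_k`. -/
def eulerIter (f : PhaseFn n Q) : ℕ → PhaseFn n Q
  | 0 => f
  | k + 1 => euler (eulerIter f k) - (k : ℝ) • eulerIter f k

/-- For `f` without moments of order above `m`: a function with the moments of order `m` of `f` and
no others. -/
def topPart (m : ℕ) (f : PhaseFn n Q) : PhaseFn n Q := ((m.factorial : ℝ)⁻¹) • eulerIter f m

/-- What is left of `f` after its parts of order `m`, `m - 1`, …, `m - j + 1` were split off one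
after the other. -/
def residual (m : ℕ) (f : PhaseFn n Q) : ℕ → PhaseFn n Q
  | 0 => f
  | j + 1 => residual m f j - topPart (m - j) (residual m f j)

/-- The least `m` such that all the moments of order above `m` vanish. -/
def momentOrder (f : PhaseFn n Q) : ℕ := sInf {m : ℕ | ∀ k, m < k → MomentVanishes k f}

/-- The part `f_(k)` of a function with finite moments. -/
def momentPart (f : PhaseFn n Q) (k : ℕ) : PhaseFn n Q :=
  if k ≤ momentOrder f then topPart k (residual (momentOrder f) f (momentOrder f - k)) else 0

/-- `f_𝔰 = f_(0) + f_(1)`. -/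
def sComp (f : PhaseFn n Q) : PhaseFn n Q := momentPart f 0 + momentPart f 1

/-- `f_𝔫 = ∑_{k ≥ 2} f_(k)`. -/
def nComp (f : PhaseFn n Q) : PhaseFn n Q :=
  ∑ k ∈ Finset.Icc 2 (momentOrder f), momentPart f k

/-! ### Integration and the pairing -/

variable (n Q) in
/-- A top form `dq` on `Q`, given by its density with respect to Lebesgue measure in charts
(only the density matters for integration, so no orientation is needed).
`density q` is the density at `q` in the coordinates of the chart at `q`. -/
structure TopForm [MeasurableSpace Q] where
  /-- The measure `dq`. -/
  measure : Measure Q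
  /-- The density at each point, in the coordinates of the preferred chart at that point. -/
  density : Q → ℝ
  density_pos : ∀ q, 0 < density q
  /-- The density in the coordinates of the chart at `c` is smooth. -/
  smooth : ∀ c : Q, ContDiffOn ℝ ∞
    (fun x => density ((extChartAt (𝓡 n) c).symm x) *
      |(tangentCoordChange (𝓡 n) c ((extChartAt (𝓡 n) c).symm x)
        ((extChartAt (𝓡 n) c).symm x)).det|) (extChartAt (𝓡 n) c).target
  /-- In the chart at `c`, the measure has this density. -/
  measure_eq : ∀ (c : Q) (s : Set Q), MeasurableSet s → s ⊆ (extChartAt (𝓡 n) c).source →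
    measure s = ∫⁻ x in extChartAt (𝓡 n) c '' s,
      ENNReal.ofReal (density ((extChartAt (𝓡 n) c).symm x) *
        |(tangentCoordChange (𝓡 n) c ((extChartAt (𝓡 n) c).symm x)
          ((extChartAt (𝓡 n) c).symm x)).det|)

variable [MeasurableSpace Q]

/-- `∫_{T*Q} F dq dp`. The fibre measure `dp` is Lebesgue measure in the components of the covector
divided by the density of `dq`, so that `dq dp` is the symplectic volume. -/
def liouvilleIntegral (ν : TopForm n Q) (F : PhaseFn n Q) : ℝ :=
  ∫ q, ((ν.density q)⁻¹ * ∫ p : E n, F q p) ∂ν.measure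

/-- The pairing `⟨f, h⟩ = ∑ₖ ∫_{T*Q} f h_k dq dp` of `F₀*(T*Q)` with `F₀(T*Q)`; all but finitely many
of the terms vanish. -/
def pair (ν : TopForm n Q) (f : PhaseFn n Q) (h : FormalFn n Q) : ℝ :=
  ∑ᶠ k : ℕ, liouvilleIntegral ν (f * h k)

/-- The coadjoint action `⟨ad*_h f, g⟩ = ⟨f, [g, h]⟩`, as a functional of `g ∈ F₀(T*Q)`. -/
def coad (ν : TopForm n Q) (h : FormalFn n Q) (f : PhaseFn n Q) (g : FormalFn n Q) : ℝ :=
  pair ν f (lie g h)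

/-- The bracket `{h, f} = ∑ⱼ {h_j, f}` of `h ∈ F₀(T*Q)` and `f ∈ F₀*(T*Q)`, as an element of the dual
of `F₀(T*Q)`: the value at `g ∈ F₀(T*Q)` is `∑ⱼ ⟨{h_j, f}, g⟩`, with finitely many non-zero terms. -/
def br (ν : TopForm n Q) (h : FormalFn n Q) (f : PhaseFn n Q) (g : FormalFn n Q) : ℝ :=
  ∑ᶠ j : ℕ, pair ν (poisson (h j) f) g

/-! ### The operators of the matched pair `(ŝ, n̂)` and their transposes

For `X ∈ n̂` and `σ ∈ ŝ`, `X ▷ σ` and `X ◁ σ` are the `ŝ`-part and the `n̂`-part of `[X, σ]`. A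
functional on `ŝ` (on `n̂`) is read as a functional of `g ∈ F₀(T*Q)` through the `ŝ`-part (the
`n̂`-part) of `g`. -/

/-- `X ▷ σ`. -/
def actL (X σ : FormalFn n Q) : FormalFn n Q := sPart (lie X σ)

/-- `X ◁ σ`. -/
def actR (X σ : FormalFn n Q) : FormalFn n Q := nPart (lie X σ)

/-- `ad*_σ f_𝔰`, for the Lie algebra `ŝ`. -/
def coadS (ν : TopForm n Q) (σ : FormalFn n Q) (fs : PhaseFn n Q) (g : FormalFn n Q) : ℝ :=
  pair ν fs (lie (sPart g) σ)

/-- `ad*_X f_𝔫`, for the Lie algebra `n̂`. -/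
def coadN (ν : TopForm n Q) (X : FormalFn n Q) (fn : PhaseFn n Q) (g : FormalFn n Q) : ℝ :=
  pair ν fn (lie (nPart g) X)

/-- The transpose `f_𝔰 ◁* X` of the left action `▷` of `n̂` on `ŝ`. -/
def dualActR (ν : TopForm n Q) (fs : PhaseFn n Q) (X : FormalFn n Q) (g : FormalFn n Q) : ℝ :=
  pair ν fs (actL X (sPart g))

/-- The transpose `σ ▷* f_𝔫` of the right action `◁` of `ŝ` on `n̂`. -/
def dualActL (ν : TopForm n Q) (σ : FormalFn n Q) (fn : PhaseFn n Q) (g : FormalFn n Q) : ℝ :=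
  pair ν fn (actR (nPart g) σ)

/-- The transpose `𝔞*_X f_𝔫` of `σ ↦ X ◁ σ`. -/
def crossA (ν : TopForm n Q) (X : FormalFn n Q) (fn : PhaseFn n Q) (g : FormalFn n Q) : ℝ :=
  pair ν fn (actR X (sPart g))

/-- The transpose `𝔟*_σ f_𝔰` of `X ↦ X ▷ σ`. -/
def crossB (ν : TopForm n Q) (σ : FormalFn n Q) (fs : PhaseFn n Q) (g : FormalFn n Q) : ℝ :=
  pair ν fs (actL (nPart g) σ)

/-! ### Functional derivatives and the equations of motion -/

/-- `D ∈ V` is the functional derivative of `H` at `f` in the directions `u ∈ S`: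
`d/dε H(f + ε u) = ⟨u, D⟩` at `ε = 0`. For `(S, V)` equal to `(F₀*, F₀)`, `(ŝ*, ŝ)`, `(n̂*, n̂)`, or to
the functions with moments of order `k` only and the terms of degree `k`, this says `D = ∂H/∂f`,
`∂H/∂f_𝔰`, `∂H/∂f_𝔫`, `∂H/∂f_(k)`. -/
def HasVariation (ν : TopForm n Q) (S : Set (PhaseFn n Q)) (V : Set (FormalFn n Q))
    (H : PhaseFn n Q → ℝ) (f : PhaseFn n Q) (D : FormalFn n Q) : Prop :=
  D ∈ V ∧ ∀ u ∈ S, HasDerivAt (fun ε : ℝ => H (f + ε • u)) (pair ν u D) 0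

/-- `df/dt = A` at time `t` in `F₀*(T*Q)`, tested with all `g ∈ F₀(T*Q)`. -/
def HasDualDeriv (ν : TopForm n Q) (f : ℝ → PhaseFn n Q) (A : FormalFn n Q → ℝ) (t : ℝ) : Prop :=
  ∀ g ∈ F₀ n Q, HasDerivAt (fun τ => pair ν (f τ) g) (A g) t

/-- The Lie-Poisson equation `df/dt = -ad*_{∂H/∂f} f` for times in `J`. -/
def IsLiePoisson (ν : TopForm n Q) (J : Set ℝ) (H : PhaseFn n Q → ℝ) (f : ℝ → PhaseFn n Q) : Prop :=
  ∀ t ∈ J, ∃ h, HasVariation ν (F₀Dual n Q) (F₀ n Q) H (f t) h ∧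
    HasDualDeriv ν f (fun g => -coad ν h (f t) g) t

/-- The right-hand side of the equation for `f_𝔰`:
`{Ds, f_(0)} + {D 1, f_(1)} + {Dn, f_𝔰} + ∑_{k ≥ 2} ({D k, f_(k)} + {D (k+1), f_(k)})`,
where `f = f_𝔰 + f_𝔫`. -/
def matchedS (ν : TopForm n Q) (Ds Dn : FormalFn n Q) (D : ℕ → FormalFn n Q)
    (fs fn : PhaseFn n Q) (g : FormalFn n Q) : ℝ :=
  br ν Ds (momentPart (fs + fn) 0) g + br ν (D 1) (momentPart (fs + fn) 1) g + br ν Dn fs g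
    + ∑ᶠ (k : ℕ) (_ : 2 ≤ k),
        (br ν (D k) (momentPart (fs + fn) k) g + br ν (D (k + 1)) (momentPart (fs + fn) k) g)

/-- The right-hand side of the equation for `f_𝔫`:
`∑_{k ≥ 2} ∑_{ℓ ≥ 1} {D k, f_(ℓ+k)} + {Ds, f_𝔫} + {D 0, f_(1)}`, where `f = f_𝔰 + f_𝔫`. -/
def matchedN (ν : TopForm n Q) (Ds : FormalFn n Q) (D : ℕ → FormalFn n Q)
    (fs fn : PhaseFn n Q) (g : FormalFn n Q) : ℝ :=
  (∑ᶠ (k : ℕ) (_ : 2 ≤ k) (l : ℕ) (_ : 1 ≤ l), br ν (D k) (momentPart (fs + fn) (l + k)) g)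
    + br ν Ds fn g + br ν (D 0) (momentPart (fs + fn) 1) g

/-- The matched Lie-Poisson equations for the pair `(f_𝔰, f_𝔫)` and times in `J`. -/
def IsMatchedLiePoisson (ν : TopForm n Q) (J : Set ℝ) (H : PhaseFn n Q → ℝ)
    (fs fn : ℝ → PhaseFn n Q) : Prop :=
  ∀ t ∈ J, ∃ (Ds Dn : FormalFn n Q) (D : ℕ → FormalFn n Q),
    HasVariation ν (sDual n Q) (sHat n Q) H (fs t + fn t) Ds ∧
    HasVariation ν (nDual n Q) (nHat n Q) H (fs t + fn t) Dn ∧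
    (∀ k, HasVariation ν (degDual n Q k) (degHat n Q k) H (fs t + fn t) (D k)) ∧
    HasDualDeriv ν fs (matchedS ν Ds Dn D (fs t) (fn t)) t ∧
    HasDualDeriv ν fn (matchedN ν Ds D (fs t) (fn t)) t

/-! ### The Vlasov equation -/

/-- `P(q, p) = p²`, the squared length of covectors for a Riemannian metric on `Q`. -/
def IsMomentumSquare (P : PhaseFn n Q) : Prop :=
  IsSmooth P ∧ ∀ q : Q, ∃ G : Matrix (Fin n) (Fin n) ℝ, G.PosDef ∧
    ∀ p : E n, P q p = ∑ i, ∑ j, G i j * p i * p j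

/-- The function `e φ(q)`. -/
def potential (e : ℝ) (φ : Q → ℝ) : PhaseFn n Q := fun q _ => e * φ q

/-- The function `p²/2m`. -/
def kinetic (m : ℝ) (P : PhaseFn n Q) : PhaseFn n Q := fun q p => P q p / (2 * m)

/-- `h = p²/2m + e φ`, as an element of `F₀(T*Q)`. -/
def energy (m e : ℝ) (P : PhaseFn n Q) (φ : Q → ℝ) : FormalFn n Q :=
  ofDegree 2 (kinetic m P) + ofDegree 0 (potential e φ)

/-- The Vlasov equation `df/dt = {h, f}`, `h = p²/2m + e φ`, in `F₀*(T*Q)`. -/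
def IsVlasov (ν : TopForm n Q) (J : Set ℝ) (m e : ℝ) (P : PhaseFn n Q) (φ : Q → ℝ)
    (f : ℝ → PhaseFn n Q) : Prop :=
  ∀ t ∈ J, HasDualDeriv ν f (pair ν (poisson (kinetic m P + potential e φ) (f t))) t

end Charts

end VlasovMatched

end

open VlasovMatched

/-!
The dual space consists of honest functions on `T*Q`, so everything rests on three analytic facts,
after which the equations follow by counting degrees.

*Integration by parts.* For `h`, `g` homogeneous in the momenta and `f` rapidly decreasing along the
fibres, `∫ {h, f} g = ∫ f {g, h}` (`liouvilleIntegral_poisson_mul`). A Poisson bracket is a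
divergence in canonical coordinates, and rapidly decreasing functions with compact support over a
chart extend to Schwartz functions, so brackets with them have integral zero there
(`integral_coordPoisson`). The bracket has the canonical form in every chart
(`inChart_poisson`, from the invariance under cotangent lifts), the Liouville measure is Lebesgue
measure in every chart (`liouvilleIntegral_eq_chart`), and a partition of unity on `Q` does the rest.
Hence `{h, f}` is the functional `-ad*_h f` (`br_eq_neg_coad`).

*The moment parts.* The operator `f ↦ -∂(p_ℓ f)/∂p_ℓ` multiplies the moments of order `k` by `k`.
Therefore `T_m` multiplies them by the binomial coefficient `k.choose m` (`moment_topPart`), and the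
recursion splits off one order of moments after the other (`moment_momentPart`). A homogeneous
function of degree `k` is integrated over the fibres against the moments of order `k` only
(`MomentVanishes.integral_mul_eq_zero`), so the pairing decouples by degree.

*Separation.* The functions with moments of order `k` only separate the homogeneous functions of
degree `k` (`IsHomogeneous.eq_zero_of_liouvilleIntegral_eq_zero`), which makes functional derivatives
unique. A Schwartz function whose moments of order `k` are those of a given covector `v`, and whose
other moments vanish, is the inverse Fourier transform of `⟪v, ξ⟫ᵏ χ(ξ)` with a bump function `χ`
that is constant near the origin (`exists_schwartz_moments`); multiplied by a bump function on `Q` it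
tests the value at `v`.

By the first two facts each bracket in the matched equations is a sum of integrals `∫ f {g_i, h_j}`.
Comparing degrees identifies them with the transposes of the operators of the matched pair
(`neg_coadS_eq`, `dualActR_eq`, `crossA_eq`, `neg_coadN_eq`, `neg_dualActL_eq`, `neg_crossB_eq`), and
the right-hand sides for `f_𝔰` and `f_𝔫` with `-ad*_h f` tested with the `ŝ`-part and with the
`n̂`-part of `g` (`matchedS_eq`, `matchedN_eq`). Testing `f = f_𝔰 + f_𝔫` with these parts gives `f_𝔰`
and `f_𝔫` back, so the Lie-Poisson equation is equivalent to the pair of matched equations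
(`hasDualDeriv_iff_matched`). The Vlasov equation is the case of a linear Hamiltonian.
-/

namespace VlasovMatched

open Set Filter Topology
open scoped SchwartzMap

/-! ### Rapid decrease and polynomial growth along the fibres -/

section Decay

variable {X Y W : Type*} [NormedAddCommGroup X] [NormedSpace ℝ X] [NormedAddCommGroup Y]
  [NormedSpace ℝ Y] [NormedAddCommGroup W] [NormedSpace ℝ W]

/-- Smooth functions on `U × Y` that are rapidly decreasing in the second variable together with
all their derivatives, locally uniformly in the first variable. -/
def RapidOn (U : Set X) (G : X × Y → W) : Prop :=
  ContDiffOn ℝ ∞ G (U ×ˢ univ) ∧ ∀ K : Set X, IsCompact K → K ⊆ U → ∀ j N : ℕ, ∃ C : ℝ,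
    ∀ x ∈ K, ∀ p : Y, ‖p‖ ^ N * ‖iteratedFDeriv ℝ j G (x, p)‖ ≤ C

/-- Smooth functions on `U × Y` all of whose derivatives grow at most polynomially in the second
variable, locally uniformly in the first variable. -/
def TemperedOn (U : Set X) (G : X × Y → W) : Prop :=
  ContDiffOn ℝ ∞ G (U ×ˢ univ) ∧ ∀ K : Set X, IsCompact K → K ⊆ U → ∀ j : ℕ, ∃ (C : ℝ) (N : ℕ),
    ∀ x ∈ K, ∀ p : Y, ‖iteratedFDeriv ℝ j G (x, p)‖ ≤ C * (1 + ‖p‖) ^ N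

variable {U : Set X} {G H : X × Y → W}

theorem contDiffAt_of_mem (hU : IsOpen U) (hG : ContDiffOn ℝ ∞ G (U ×ˢ univ)) {x : X} (hx : x ∈ U)
    (p : Y) : ContDiffAt ℝ ∞ G (x, p) :=
  hG.contDiffAt ((hU.prod isOpen_univ).mem_nhds ⟨hx, mem_univ _⟩)

/-- The decay estimate with the weight `1 + ‖p‖`, which does not vanish at `p = 0`, instead of
`‖p‖`. -/
theorem RapidOn.one_add_bound (hG : RapidOn U G) {K : Set X} (hK : IsCompact K) (hKU : K ⊆ U)
    (j N : ℕ) : ∃ C : ℝ, 0 ≤ C ∧ ∀ x ∈ K, ∀ p : Y,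
      (1 + ‖p‖) ^ N * ‖iteratedFDeriv ℝ j G (x, p)‖ ≤ C := by
  obtain ⟨C₀, h₀⟩ := hG.2 K hK hKU j 0
  obtain ⟨C₁, h₁⟩ := hG.2 K hK hKU j N
  refine ⟨2 ^ (N - 1) * (|C₀| + |C₁|), by positivity, fun x hx p => ?_⟩
  have h := add_pow_le zero_le_one (norm_nonneg p) N
  have h₀ := (h₀ x hx p).trans (le_abs_self _)
  have h₁ := (h₁ x hx p).trans (le_abs_self _)
  calc (1 + ‖p‖) ^ N * ‖iteratedFDeriv ℝ j G (x, p)‖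
      ≤ (2 ^ (N - 1) * (1 ^ N + ‖p‖ ^ N)) * ‖iteratedFDeriv ℝ j G (x, p)‖ := by gcongr
    _ = 2 ^ (N - 1) * (‖p‖ ^ 0 * ‖iteratedFDeriv ℝ j G (x, p)‖
          + ‖p‖ ^ N * ‖iteratedFDeriv ℝ j G (x, p)‖) := by ring
    _ ≤ _ := by gcongr

theorem RapidOn.congr (hU : IsOpen U) (hG : RapidOn U G) (h : ∀ x ∈ U, ∀ p, H (x, p) = G (x, p)) :
    RapidOn U H := by
  refine ⟨hG.1.congr fun z hz => h z.1 hz.1 z.2, fun K hK hKU j N => ?_⟩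
  obtain ⟨C, hC⟩ := hG.2 K hK hKU j N
  refine ⟨C, fun x hx p => ?_⟩
  have : H =ᶠ[𝓝 (x, p)] G := by
    filter_upwards [(hU.prod isOpen_univ).mem_nhds (⟨hKU hx, mem_univ p⟩ : (x, p) ∈ U ×ˢ univ)]
      with z hz using h z.1 hz.1 z.2
  rw [(this.iteratedFDeriv ℝ j).eq_of_nhds]
  exact hC x hx p

theorem RapidOn.add (hU : IsOpen U) (hG : RapidOn U G) (hH : RapidOn U H) :
    RapidOn U (G + H) := by
  refine ⟨hG.1.add hH.1, fun K hK hKU j N => ?_⟩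
  obtain ⟨C, hC⟩ := hG.2 K hK hKU j N
  obtain ⟨D, hD⟩ := hH.2 K hK hKU j N
  refine ⟨C + D, fun x hx p => ?_⟩
  rw [iteratedFDeriv_add_apply
    ((contDiffAt_of_mem hU hG.1 (hKU hx) p).of_le (mod_cast le_top))
    ((contDiffAt_of_mem hU hH.1 (hKU hx) p).of_le (mod_cast le_top))]
  refine le_trans ?_ (add_le_add (hC x hx p) (hD x hx p))
  rw [← mul_add]
  gcongr
  exact norm_add_le _ _

theorem RapidOn.const_smul (hU : IsOpen U) (hG : RapidOn U G) (a : ℝ) : RapidOn U (a • G) := by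
  refine ⟨hG.1.const_smul a, fun K hK hKU j N => ?_⟩
  obtain ⟨C, hC⟩ := hG.2 K hK hKU j N
  refine ⟨|a| * C, fun x hx p => ?_⟩
  rw [iteratedFDeriv_const_smul_apply
    ((contDiffAt_of_mem hU hG.1 (hKU hx) p).of_le (mod_cast le_top)), norm_smul, Real.norm_eq_abs]
  calc _ = |a| * (‖p‖ ^ N * ‖iteratedFDeriv ℝ j G (x, p)‖) := by ring
    _ ≤ _ := by gcongr; exact hC x hx p

theorem RapidOn.neg (hU : IsOpen U) (hG : RapidOn U G) : RapidOn U (-G) := by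
  simpa using hG.const_smul hU (-1)

theorem RapidOn.zero : RapidOn U (0 : X × Y → W) :=
  ⟨contDiffOn_const, fun _ _ _ j N => ⟨0, fun x _ p => by simp⟩⟩

theorem RapidOn.sum (hU : IsOpen U) {ι : Type*} (s : Finset ι) {G : ι → X × Y → W}
    (hG : ∀ i ∈ s, RapidOn U (G i)) : RapidOn U (∑ i ∈ s, G i) :=
  Finset.sum_induction G (RapidOn U) (fun _ _ ha hb => ha.add hU hb) RapidOn.zero hG

theorem contDiffOn_fderiv_apply (hU : IsOpen U) (hG : ContDiffOn ℝ ∞ G (U ×ˢ univ)) (v : X × Y) :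
    ContDiffOn ℝ ∞ (fun z => fderiv ℝ G z v) (U ×ˢ univ) :=
  (hG.fderiv_of_isOpen (hU.prod isOpen_univ) (m := ∞) (by simp)).clm_apply contDiffOn_const

theorem norm_iteratedFDeriv_fderiv_apply_le (hU : IsOpen U) (hG : ContDiffOn ℝ ∞ G (U ×ˢ univ))
    (v : X × Y) (j : ℕ) {x : X} (hx : x ∈ U) (p : Y) :
    ‖iteratedFDeriv ℝ j (fun z => fderiv ℝ G z v) (x, p)‖
      ≤ ‖v‖ * ‖iteratedFDeriv ℝ (j + 1) G (x, p)‖ := by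
  have h : ContDiffAt ℝ ∞ (fderiv ℝ G) (x, p) :=
    (contDiffAt_of_mem hU hG hx p).fderiv_right (by simp)
  rw [← norm_iteratedFDeriv_fderiv]
  exact norm_iteratedFDeriv_clm_apply_const h (mod_cast le_top)

theorem RapidOn.fderiv_apply (hU : IsOpen U) (hG : RapidOn U G) (v : X × Y) :
    RapidOn U (fun z => fderiv ℝ G z v) := by
  refine ⟨contDiffOn_fderiv_apply hU hG.1 v, fun K hK hKU j N => ?_⟩
  obtain ⟨C, hC⟩ := hG.2 K hK hKU (j + 1) N
  refine ⟨‖v‖ * C, fun x hx p => ?_⟩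
  calc _ ≤ ‖p‖ ^ N * (‖v‖ * ‖iteratedFDeriv ℝ (j + 1) G (x, p)‖) := by
        gcongr; exact norm_iteratedFDeriv_fderiv_apply_le hU hG.1 v j (hKU hx) p
    _ = ‖v‖ * (‖p‖ ^ N * ‖iteratedFDeriv ℝ (j + 1) G (x, p)‖) := by ring
    _ ≤ _ := by gcongr; exact hC x hx p

theorem TemperedOn.fderiv_apply (hU : IsOpen U) (hG : TemperedOn U G) (v : X × Y) :
    TemperedOn U (fun z => fderiv ℝ G z v) := by
  refine ⟨contDiffOn_fderiv_apply hU hG.1 v, fun K hK hKU j => ?_⟩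
  obtain ⟨C, N, hC⟩ := hG.2 K hK hKU (j + 1)
  refine ⟨‖v‖ * C, N, fun x hx p => ?_⟩
  calc _ ≤ ‖v‖ * ‖iteratedFDeriv ℝ (j + 1) G (x, p)‖ :=
        norm_iteratedFDeriv_fderiv_apply_le hU hG.1 v j (hKU hx) p
    _ ≤ ‖v‖ * (C * (1 + ‖p‖) ^ N) := by gcongr; exact hC x hx p
    _ = _ := by ring

theorem TemperedOn.mul_rapidOn {a b : X × Y → ℝ} (hU : IsOpen U) (ha : TemperedOn U a)
    (hb : RapidOn U b) : RapidOn U (a * b) := by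
  refine ⟨ha.1.mul hb.1, fun K hK hKU j N => ?_⟩
  choose A M hA using ha.2 K hK hKU
  choose B hB0 hB using fun i L => hb.one_add_bound hK hKU i L
  refine ⟨∑ i ∈ Finset.range (j + 1), (j.choose i : ℝ) * |A i| * B (j - i) (N + M i),
    fun x hx p => ?_⟩
  have ho := hU.prod (isOpen_univ (X := Y))
  have hz : (x, p) ∈ U ×ˢ (univ : Set Y) := ⟨hKU hx, mem_univ _⟩
  have h := norm_iteratedFDerivWithin_mul_le ha.1 hb.1 ho.uniqueDiffOn hz (n := j)
    (mod_cast le_top)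
  simp only [iteratedFDerivWithin_of_isOpen _ ho hz] at h
  calc _ ≤ ‖p‖ ^ N * _ := mul_le_mul_of_nonneg_left h (by positivity)
    _ ≤ _ := by
      rw [Finset.mul_sum]
      refine Finset.sum_le_sum fun i _ => ?_
      have h1 : ‖iteratedFDeriv ℝ i a (x, p)‖ ≤ |A i| * (1 + ‖p‖) ^ M i :=
        (hA i x hx p).trans (by gcongr; exact le_abs_self _)
      have h2 := hB (j - i) (N + M i) x hx p
      have h3 : ‖p‖ ^ N ≤ (1 + ‖p‖) ^ N := by gcongr; linarith
      calc ‖p‖ ^ N * ((j.choose i : ℝ) * ‖iteratedFDeriv ℝ i a (x, p)‖ *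
              ‖iteratedFDeriv ℝ (j - i) b (x, p)‖)
          ≤ (1 + ‖p‖) ^ N * ((j.choose i : ℝ) * (|A i| * (1 + ‖p‖) ^ M i) *
              ‖iteratedFDeriv ℝ (j - i) b (x, p)‖) := by gcongr
        _ = (j.choose i : ℝ) * |A i| *
              ((1 + ‖p‖) ^ (N + M i) * ‖iteratedFDeriv ℝ (j - i) b (x, p)‖) := by ring
        _ ≤ _ := by gcongr

/-- Functions homogeneous in the second variable grow polynomially: rescaling the second variable
reduces the bound to the compact set `K × closedBall 0 1`. -/
theorem TemperedOn.of_homogeneous [ProperSpace Y] (hU : IsOpen U)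
    (hG : ContDiffOn ℝ ∞ G (U ×ˢ univ)) (k : ℕ)
    (hh : ∀ x ∈ U, ∀ (t : ℝ) (p : Y), G (x, t • p) = t ^ k • G (x, p)) : TemperedOn U G := by
  refine ⟨hG, fun K hK hKU j => ?_⟩
  have ho := hU.prod (isOpen_univ (X := Y))
  have hc := hG.continuousOn_iteratedFDerivWithin (m := j) (mod_cast le_top) ho.uniqueDiffOn
  obtain ⟨C, hC⟩ := (hK.prod (isCompact_closedBall (0 : Y) 1)).exists_bound_of_continuousOn
    (hc.mono (prod_mono hKU (subset_univ _)))
  refine ⟨C, k, fun x hx p => ?_⟩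
  have hz : (x, p) ∈ U ×ˢ (univ : Set Y) := ⟨hKU hx, mem_univ _⟩
  set t : ℝ := 1 + ‖p‖ with ht
  have ht1 : 1 ≤ t := by have := norm_nonneg p; linarith
  have ht0 : 0 < t := by linarith
  -- `G = t ^ k • G ∘ δ`, where `δ` maps `(x, p)` into `K × closedBall 0 1` and has norm at most one
  set δ : X × Y →L[ℝ] X × Y :=
    (ContinuousLinearMap.fst ℝ X Y).prod (t⁻¹ • ContinuousLinearMap.snd ℝ X Y) with hδ
  have hδn : ‖δ‖ ≤ 1 := by
    refine ContinuousLinearMap.opNorm_le_bound _ zero_le_one fun z => ?_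
    simp only [hδ, ContinuousLinearMap.prod_apply, ContinuousLinearMap.coe_fst', one_mul,
      smul_apply, ContinuousLinearMap.coe_snd', Prod.norm_def]
    refine max_le_max le_rfl ?_
    rw [norm_smul, norm_inv, Real.norm_of_nonneg ht0.le]
    exact mul_le_of_le_one_left (norm_nonneg _) (inv_le_one_of_one_le₀ ht1)
  have hpre : δ ⁻¹' (U ×ˢ univ) = U ×ˢ univ := by ext z; simp [hδ]
  have heq : EqOn G (t ^ k • (G ∘ δ)) (U ×ˢ univ) := by
    rintro ⟨y, q⟩ hy
    simp only [Pi.smul_apply, Function.comp_apply, hδ, ContinuousLinearMap.prod_apply,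
      ContinuousLinearMap.coe_fst', smul_apply, ContinuousLinearMap.coe_snd']
    rw [hh y hy.1, smul_smul, ← mul_pow, mul_inv_cancel₀ ht0.ne', one_pow, one_smul]
  have hmem : δ (x, p) ∈ K ×ˢ Metric.closedBall (0 : Y) 1 := by
    refine ⟨hx, ?_⟩
    simp only [hδ, ContinuousLinearMap.prod_apply, smul_apply,
      ContinuousLinearMap.coe_snd', mem_closedBall_zero_iff, norm_smul, norm_inv,
      Real.norm_of_nonneg ht0.le]
    rw [inv_mul_le_one₀ ht0]
    linarith
  have hmem' : δ (x, p) ∈ U ×ˢ (univ : Set Y) := ⟨hKU hmem.1, mem_univ _⟩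
  have hcomp : ContDiffOn ℝ ∞ (G ∘ δ) (U ×ˢ univ) := by
    have := hG.comp_continuousLinearMap δ
    rwa [hpre] at this
  have h1 := ContinuousLinearMap.iteratedFDerivWithin_comp_right δ hG ho.uniqueDiffOn
    (by rw [hpre]; exact ho.uniqueDiffOn) hmem' (i := j) (mod_cast le_top)
  rw [hpre] at h1
  rw [← iteratedFDerivWithin_of_isOpen j ho hz, iteratedFDerivWithin_congr heq hz,
    iteratedFDerivWithin_const_smul_apply ((hcomp _ hz).of_le (mod_cast le_top)) ho.uniqueDiffOn hz,
    h1, norm_smul, norm_pow, Real.norm_of_nonneg ht0.le, mul_comm]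
  gcongr
  refine (ContinuousMultilinearMap.norm_compContinuousLinearMap_le _ _).trans ?_
  rw [Finset.prod_const]
  refine le_trans ?_ (hC _ hmem)
  exact mul_le_of_le_one_right (norm_nonneg _) (pow_le_one₀ (norm_nonneg _) hδn)

/-- The fibres of a rapidly decreasing function are Schwartz functions. -/
theorem RapidOn.exists_schwartz_fibre (hU : IsOpen U) (hG : RapidOn U G) {x : X} (hx : x ∈ U) :
    ∃ S : 𝓢(Y, W), ∀ p, S p = G (x, p) := by
  have ho := hU.prod (isOpen_univ (X := Y))
  set s : Set (X × Y) := (fun z => z + (x, 0)) ⁻¹' (U ×ˢ univ) with hs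
  have hso : IsOpen s := ho.preimage (continuous_add_const _)
  have hG' : ContDiffOn ℝ ∞ (fun z => G (z + (x, 0))) s :=
    hG.1.comp (contDiff_id.add contDiff_const).contDiffOn fun z hz => hz
  have hpre : (ContinuousLinearMap.inr ℝ X Y) ⁻¹' s = univ := by
    ext p; simp [hs, hx]
  -- the inclusion of the fibre is linear after a translation
  have heq : (fun p => G (x, p)) = (fun z => G (z + (x, 0))) ∘ (ContinuousLinearMap.inr ℝ X Y) := by
    ext p; simp
  have hsm : ContDiff ℝ ∞ (fun p => G (x, p)) := by
    rw [← contDiffOn_univ, heq, ← hpre]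
    exact hG'.comp_continuousLinearMap _
  refine ⟨⟨fun p => G (x, p), hsm, fun k j => ?_⟩, fun p => rfl⟩
  obtain ⟨C, hC⟩ := hG.2 {x} isCompact_singleton (singleton_subset_iff.2 hx) j k
  refine ⟨C, fun p => ?_⟩
  have hps : (ContinuousLinearMap.inr ℝ X Y) p ∈ s := by
    have : p ∈ (ContinuousLinearMap.inr ℝ X Y) ⁻¹' s := by rw [hpre]; trivial
    exact this
  have h1 := ContinuousLinearMap.iteratedFDerivWithin_comp_right (ContinuousLinearMap.inr ℝ X Y)
    hG' hso.uniqueDiffOn (by rw [hpre]; exact uniqueDiffOn_univ) hps (i := j) (mod_cast le_top)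
  rw [hpre, iteratedFDerivWithin_univ, iteratedFDerivWithin_of_isOpen j hso hps,
    iteratedFDeriv_comp_add_right, ← heq] at h1
  rw [h1]
  refine le_trans ?_ (hC x rfl p)
  gcongr
  refine (ContinuousMultilinearMap.norm_compContinuousLinearMap_le _ _).trans ?_
  rw [Finset.prod_const]
  have : (ContinuousLinearMap.inr ℝ X Y) p + (x, 0) = (x, p) := by simp
  rw [this]
  exact mul_le_of_le_one_right (norm_nonneg _)
    (pow_le_one₀ (norm_nonneg _) (ContinuousLinearMap.norm_inr_le_one ℝ X Y))

/-- A rapidly decreasing function that vanishes over the complement of a compact set extends by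
zero to a Schwartz function. -/
theorem RapidOn.exists_schwartz_extension (hU : IsOpen U) (hG : RapidOn U G) {K : Set X}
    (hK : IsCompact K) (hKU : K ⊆ U) (h0 : ∀ x ∈ U, x ∉ K → ∀ p, G (x, p) = 0) :
    ∃ S : 𝓢(X × Y, W), (∀ x ∈ U, ∀ p, S (x, p) = G (x, p)) ∧ ∀ x, x ∉ K → ∀ p, S (x, p) = 0 := by
  classical
  set F : X × Y → W := fun z => if z.1 ∈ U then G z else 0 with hF
  have hF0 : ∀ x, x ∉ K → ∀ p, F (x, p) = 0 := by
    intro x hx p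
    by_cases hxU : x ∈ U
    · simp [hF, hxU, h0 x hxU hx p]
    · simp [hF, hxU]
  have h1 : ∀ x ∈ U, ∀ p, F =ᶠ[𝓝 (x, p)] G := fun x hx p => by
    filter_upwards [(hU.prod isOpen_univ).mem_nhds (⟨hx, mem_univ p⟩ : (x, p) ∈ U ×ˢ univ)]
      with z hz
    simp [hF, show z.1 ∈ U from hz.1]
  have h2 : ∀ x, x ∉ K → ∀ p, F =ᶠ[𝓝 (x, p)] 0 := fun x hx p => by
    filter_upwards [(hK.isClosed.isOpen_compl.prod isOpen_univ).mem_nhds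
      (⟨hx, mem_univ p⟩ : (x, p) ∈ Kᶜ ×ˢ univ)] with z hz
    exact hF0 z.1 hz.1 z.2
  have hsm : ContDiff ℝ ∞ F := by
    rw [contDiff_iff_contDiffAt]
    rintro ⟨x, p⟩
    by_cases hx : x ∈ K
    · exact (contDiffAt_of_mem hU hG.1 (hKU hx) p).congr_of_eventuallyEq (h1 x (hKU hx) p)
    · exact (contDiffAt_const (c := 0)).congr_of_eventuallyEq (h2 x hx p)
  refine ⟨⟨F, hsm, fun k j => ?_⟩, fun x hx p => if_pos hx, hF0⟩
  obtain ⟨C, hC0, hC⟩ := hG.one_add_bound hK hKU j k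
  obtain ⟨R, hR⟩ := hK.isBounded.exists_norm_le
  refine ⟨(1 + |R|) ^ k * C, ?_⟩
  rintro ⟨x, p⟩
  by_cases hx : x ∈ K
  · rw [((h1 x (hKU hx) p).iteratedFDeriv ℝ j).eq_of_nhds]
    have hn : ‖(x, p)‖ ≤ (1 + |R|) * (1 + ‖p‖) := by
      have := (hR x hx).trans (le_abs_self R)
      have h3 := norm_nonneg p
      have h4 := abs_nonneg R
      have h5 := mul_nonneg h3 h4
      rw [Prod.norm_def]
      refine max_le ?_ ?_ <;> simp only <;> nlinarith
    calc _ ≤ ((1 + |R|) * (1 + ‖p‖)) ^ k * ‖iteratedFDeriv ℝ j G (x, p)‖ := by gcongr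
      _ = (1 + |R|) ^ k * ((1 + ‖p‖) ^ k * ‖iteratedFDeriv ℝ j G (x, p)‖) := by
        rw [mul_pow, mul_assoc]
      _ ≤ _ := by gcongr; exact hC x hx p
  · rw [((h2 x hx p).iteratedFDeriv ℝ j).eq_of_nhds]
    simp only [Pi.zero_def, iteratedFDeriv_fun_zero, Pi.zero_apply, norm_zero, mul_zero]
    positivity

end Decay

/-! ### Monomials in the momenta -/

section Fibre

variable {n : ℕ}

theorem sum_smul_ev (p : E n) : ∑ l, p l • ev l = p := by
  have := (EuclideanSpace.basisFun (Fin n) ℝ).sum_repr p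
  simpa [ev] using this

theorem ev_apply (l i : Fin n) : (ev l : E n) i = if i = l then 1 else 0 := by
  simp [ev]

theorem sum_prod_homogeneous {k : ℕ} (X : (Fin k → Fin n) → ℝ) (t : ℝ) (p : E n) :
    ∑ i : Fin k → Fin n, X i * ∏ a, (t • p) (i a) = t ^ k * ∑ i, X i * ∏ a, p (i a) := by
  rw [Finset.mul_sum]
  refine Finset.sum_congr rfl fun i _ => ?_
  simp only [PiLp.smul_apply, smul_eq_mul, Finset.prod_mul_distrib, Finset.prod_const,
    Finset.card_univ, Fintype.card_fin]
  ring

/-- A smooth function that is homogeneous of degree `k` is a homogeneous polynomial, namely its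
Taylor polynomial of order `k` at the origin. -/
theorem exists_coeff_of_homogeneous {k : ℕ} {f : E n → ℝ} (hf : ContDiff ℝ ∞ f)
    (hh : ∀ (t : ℝ) (p : E n), f (t • p) = t ^ k * f p) :
    ∃ X : (Fin k → Fin n) → ℝ, ∀ p, f p = ∑ i, X i * ∏ a, p (i a) := by
  refine ⟨fun i => (k.factorial : ℝ)⁻¹ * iteratedFDeriv ℝ k f 0 fun a => ev (i a), fun p => ?_⟩
  have h1 : iteratedFDeriv ℝ k f 0 (fun _ => p) = k.factorial * f p := by
    have h2 := ContinuousLinearMap.iteratedFDeriv_comp_right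
      (ContinuousLinearMap.toSpanSingleton ℝ p) hf 0 (i := k) (mod_cast le_top)
    have h3 : f ∘ (ContinuousLinearMap.toSpanSingleton ℝ p) = fun t : ℝ => f p * t ^ k := by
      ext t; simp [hh, mul_comm]
    have h4 : iteratedDeriv k (fun t : ℝ => f p * t ^ k) 0 = k.factorial * f p := by
      rw [iteratedDeriv_const_mul_field]
      simp [Nat.descFactorial_self, mul_comm]
    rw [iteratedDeriv_eq_iteratedFDeriv, ← h3, h2] at h4
    simpa using h4
  have h5 : iteratedFDeriv ℝ k f 0 (fun _ => p)
      = ∑ i : Fin k → Fin n, (∏ a, p (i a)) * iteratedFDeriv ℝ k f 0 fun a => ev (i a) := by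
    conv_lhs => rw [← sum_smul_ev p]
    rw [ContinuousMultilinearMap.map_sum]
    refine Finset.sum_congr rfl fun i _ => ?_
    rw [ContinuousMultilinearMap.map_smul_univ, smul_eq_mul]
  have hk : (k.factorial : ℝ) ≠ 0 := by positivity
  have h6 : f p = (k.factorial : ℝ)⁻¹ * iteratedFDeriv ℝ k f 0 (fun _ => p) := by
    rw [h1]; field_simp
  rw [h6, h5, Finset.mul_sum]
  exact Finset.sum_congr rfl fun i _ => by ring

theorem hasTemperateGrowth_coord (l : Fin n) : (fun p : E n => p l).HasTemperateGrowth :=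
  (EuclideanSpace.proj l : E n →L[ℝ] ℝ).hasTemperateGrowth

theorem hasTemperateGrowth_monomial {k : ℕ} (i : Fin k → Fin n) :
    (fun p : E n => ∏ a, p (i a)).HasTemperateGrowth := by
  induction k with
  | zero => simp [Function.HasTemperateGrowth.const (1 : ℝ)]
  | succ k ih =>
    simp only [Fin.prod_univ_succ]
    exact (hasTemperateGrowth_coord _).mul (ih _)

theorem hasTemperateGrowth_fderiv {f : E n → ℝ} (hf : f.HasTemperateGrowth) :
    (fderiv ℝ f).HasTemperateGrowth :=
  ⟨hf.1.fderiv_right (by simp), fun j => by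
    obtain ⟨k, C, h⟩ := hf.2 (j + 1)
    exact ⟨k, C, fun p => by simpa only [norm_iteratedFDeriv_fderiv] using h p⟩⟩

theorem integrable_monomial_mul {k : ℕ} (i : Fin k → Fin n) (S : 𝓢(E n, ℝ)) :
    Integrable fun p : E n => (∏ a, p (i a)) * S p := by
  have := (SchwartzMap.smulLeftCLM ℝ (fun p : E n => ∏ a, p (i a)) S).integrable (μ := volume)
  rwa [SchwartzMap.smulLeftCLM_apply (hasTemperateGrowth_monomial i)] at this

/-- The Euler identity for the monomials of degree `k`. -/
theorem sum_coord_mul_fderiv_monomial {k : ℕ} (i : Fin k → Fin n) (p : E n) :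
    ∑ l, p l * fderiv ℝ (fun p : E n => ∏ a, p (i a)) p (ev l) = k * ∏ a, p (i a) := by
  have hd : Differentiable ℝ (fun p : E n => ∏ a, p (i a)) :=
    (hasTemperateGrowth_monomial i).1.differentiable (by simp)
  have h1 : ∑ l, p l * fderiv ℝ (fun p : E n => ∏ a, p (i a)) p (ev l)
      = fderiv ℝ (fun p : E n => ∏ a, p (i a)) p p := by
    conv_rhs => rw [← sum_smul_ev p]
    rw [map_sum, sum_smul_ev]
    simp
  have h2 : HasDerivAt (fun t : ℝ => ∏ a, (t • p) (i a))
      (fderiv ℝ (fun p : E n => ∏ a, p (i a)) ((1 : ℝ) • p) ((1 : ℝ) • p)) 1 :=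
    ((hd _).hasFDerivAt).comp_hasDerivAt (1 : ℝ) ((hasDerivAt_id (1 : ℝ)).smul_const p)
  have h3 : HasDerivAt (fun t : ℝ => ∏ a, (t • p) (i a)) (k * ∏ a, p (i a)) 1 := by
    have : (fun t : ℝ => ∏ a, (t • p) (i a)) = fun t => t ^ k * ∏ a, p (i a) := by
      ext t
      simp [Finset.prod_mul_distrib]
    rw [this]
    simpa using (hasDerivAt_pow k (1 : ℝ)).mul_const (∏ a, p (i a))
  rw [h1]
  simpa using h2.unique h3

/-- Integration by parts: `-∂(p_ℓ S)/∂p_ℓ` has `k` times the moments of order `k` of `S`. -/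
theorem integral_monomial_mul_euler {k : ℕ} (i : Fin k → Fin n) (S : 𝓢(E n, ℝ)) :
    ∫ p : E n, (∏ a, p (i a)) * -∑ l, fderiv ℝ (fun p' : E n => p' l * S p') p (ev l)
      = k * ∫ p : E n, (∏ a, p (i a)) * S p := by
  classical
  set m : E n → ℝ := fun p => ∏ a, p (i a) with hm
  have hmt : m.HasTemperateGrowth := hasTemperateGrowth_monomial i
  set T : Fin n → 𝓢(E n, ℝ) := fun l => SchwartzMap.smulLeftCLM ℝ (fun p : E n => p l) S with hT
  have hTc : ∀ l, (T l : E n → ℝ) = fun p => p l * S p := fun l => by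
    rw [hT]; simp only; rw [SchwartzMap.smulLeftCLM_apply (hasTemperateGrowth_coord l)]; rfl
  have hint : ∀ (g : E n → ℝ) (R : 𝓢(E n, ℝ)), g.HasTemperateGrowth →
      Integrable fun p => g p * R p := fun g R hg => by
    have := (SchwartzMap.smulLeftCLM ℝ g R).integrable (μ := volume)
    rwa [SchwartzMap.smulLeftCLM_apply hg] at this
  open scoped LineDeriv in
  have hd1 : ∀ l, Integrable fun p => m p * fderiv ℝ (T l) p (ev l) := fun l => by
    simpa only [SchwartzMap.lineDerivOp_apply_eq_fderiv] using hint m (∂_{(ev l : E n)} (T l)) hmt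
  have hmd : ∀ l, (fun p => fderiv ℝ m p (ev l)).HasTemperateGrowth := fun l =>
    (ContinuousLinearMap.hasTemperateGrowth
      (ContinuousLinearMap.apply ℝ ℝ (ev l : E n))).comp (hasTemperateGrowth_fderiv hmt)
  have hibp : ∀ l, ∫ p, m p * fderiv ℝ (T l) p (ev l) = -∫ p, fderiv ℝ m p (ev l) * T l p :=
    fun l => integral_mul_fderiv_eq_neg_fderiv_mul_of_integrable (hint _ _ (hmd l)) (hd1 l)
      (hint _ _ hmt) (fun p _ => hmt.1.differentiable (by simp) p)
      (fun p _ => (T l).differentiable p)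
  calc _ = ∫ p, -∑ l, m p * fderiv ℝ (T l) p (ev l) := by
        congr 1; ext p; rw [mul_neg, Finset.mul_sum]; simp only [hTc, hm]
    _ = -∑ l, ∫ p, m p * fderiv ℝ (T l) p (ev l) := by
        rw [integral_neg, integral_finsetSum _ fun l _ => hd1 l]
    _ = ∑ l, ∫ p, fderiv ℝ m p (ev l) * T l p := by simp [hibp]
    _ = ∫ p, ∑ l, fderiv ℝ m p (ev l) * T l p :=
        (integral_finsetSum _ fun l _ => hint _ _ (hmd l)).symm
    _ = ∫ p, k * (m p * S p) := by
        congr 1; ext p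
        rw [← mul_assoc, hm, ← sum_coord_mul_fderiv_monomial i p, Finset.sum_mul]
        exact Finset.sum_congr rfl fun l _ => by rw [hTc]; ring
    _ = _ := integral_const_mul _ _

end Fibre

/-! ### The canonical Poisson bracket and changes of coordinates -/

section CotangentLift

variable {n : ℕ}

/-- The canonical Poisson bracket in the coordinate phase space `ℝⁿ × ℝⁿ`. -/
noncomputable def coordPoisson (H G : E n × E n → ℝ) (z : E n × E n) : ℝ :=
  ∑ l : Fin n, (fderiv ℝ H z (ev l, 0) * fderiv ℝ G z (0, ev l)
    - fderiv ℝ G z (ev l, 0) * fderiv ℝ H z (0, ev l))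

theorem inner_ev_left (l : Fin n) (p : E n) : ⟪ev l, p⟫_ℝ = p l := by
  simp [ev, EuclideanSpace.inner_single_left]

theorem adjoint_eq_sum (B : E n →L[ℝ] E n) (p : E n) :
    B.adjoint p = ∑ l, ⟪B (ev l), p⟫_ℝ • ev l := by
  rw [← sum_smul_ev (B.adjoint p)]
  refine Finset.sum_congr rfl fun l _ => ?_
  rw [← inner_ev_left l, ContinuousLinearMap.adjoint_inner_right]

/-- The inner product of the functionals `L` and `b ∘ Bᵀ` is that of `L ∘ B` and `b`. -/
theorem sum_map_mul_adjoint (L b : E n →L[ℝ] ℝ) (B : E n →L[ℝ] E n) :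
    ∑ l, L (ev l) * b (B.adjoint (ev l)) = ∑ m, b (ev m) * L (B (ev m)) := by
  have h : ∀ l, b (B.adjoint (ev l)) = ∑ m, B (ev m) l * b (ev m) := fun l => by
    rw [adjoint_eq_sum, map_sum]
    refine Finset.sum_congr rfl fun m _ => ?_
    rw [map_smul, smul_eq_mul, real_inner_comm, inner_ev_left]
  simp only [h, Finset.mul_sum]
  rw [Finset.sum_comm]
  refine Finset.sum_congr rfl fun m _ => ?_
  conv_rhs => rw [← sum_smul_ev (B (ev m))]
  rw [map_sum, Finset.mul_sum]
  refine Finset.sum_congr rfl fun l _ => ?_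
  rw [map_smul, smul_eq_mul]
  ring

theorem contDiffOn_adjoint_apply {V : Set (E n)} {B : E n → E n →L[ℝ] E n}
    (hB : ContDiffOn ℝ ∞ B V) :
    ContDiffOn ℝ ∞ (fun z : E n × E n => (B z.1).adjoint z.2) (V ×ˢ univ) := by
  simp only [adjoint_eq_sum]
  refine ContDiffOn.sum fun l _ => ContDiffOn.smul (ContDiffOn.inner ℝ ?_ contDiffOn_snd)
    contDiffOn_const
  exact ContDiffOn.clm_apply (hB.comp contDiffOn_fst fun z hz => hz.1) contDiffOn_const

/-- The Poisson bracket is invariant under the cotangent lift `(x, p) ↦ (σ x, Dτ(σ x)ᵀ p)` of a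
change of coordinates `σ` with inverse `τ`: the terms with the second derivative of `τ` cancel by
symmetry. -/
theorem coordPoisson_comp_cotangentLift {σ τ : E n → E n} {x p : E n} {S : E n →L[ℝ] E n}
    (hS : HasFDerivAt σ S x) (hτ : ContDiffAt ℝ ∞ τ (σ x))
    (hSB : ∀ v, S (fderiv ℝ τ (σ x) v) = v) {H G : E n × E n → ℝ}
    (hH : DifferentiableAt ℝ H (σ x, (fderiv ℝ τ (σ x)).adjoint p))
    (hG : DifferentiableAt ℝ G (σ x, (fderiv ℝ τ (σ x)).adjoint p)) :
    coordPoisson (fun z => H (σ z.1, (fderiv ℝ τ (σ z.1)).adjoint z.2))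
        (fun z => G (σ z.1, (fderiv ℝ τ (σ z.1)).adjoint z.2)) (x, p)
      = coordPoisson H G (σ x, (fderiv ℝ τ (σ x)).adjoint p) := by
  set B := fderiv ℝ τ (σ x) with hB
  set T := fderiv ℝ (fderiv ℝ τ) (σ x) with hT
  have hsym : ∀ v w, T v w = T w v :=
    (hτ.of_le (m := 2) (WithTop.coe_le_coe.2 le_top)).isSymmSndFDerivAt (by simp)
  have hdB : HasFDerivAt (fun z : E n × E n => fderiv ℝ τ (σ z.1))
      (T.comp (S.comp (ContinuousLinearMap.fst ℝ (E n) (E n)))) (x, p) := by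
    have h1 : HasFDerivAt (fderiv ℝ τ) T (σ x) :=
      ((hτ.fderiv_right (m := ∞) (by simp)).differentiableAt (by simp)).hasFDerivAt
    have h2 : HasFDerivAt (fun z : E n × E n => σ z.1)
        (S.comp (ContinuousLinearMap.fst ℝ (E n) (E n))) (x, p) :=
      HasFDerivAt.comp (x, p) hS hasFDerivAt_fst
    exact HasFDerivAt.comp (x, p) h1 h2
  -- the derivative of the lift
  set C : E n →L[ℝ] E n := ∑ k, (((innerSL ℝ p).comp
    ((ContinuousLinearMap.apply ℝ (E n) (ev k : E n)).comp (T.comp S))).smulRight (ev k : E n))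
    with hC
  have hCapp : ∀ v, C v = ∑ k, ⟪T (S v) (ev k), p⟫_ℝ • ev k := fun v => by
    simp [hC, real_inner_comm]
  set Φ : E n × E n → E n × E n := fun z => (σ z.1, (fderiv ℝ τ (σ z.1)).adjoint z.2) with hΦ
  set Φ' : E n × E n →L[ℝ] E n × E n :=
    (S.comp (ContinuousLinearMap.fst ℝ (E n) (E n))).prod
      (C.comp (ContinuousLinearMap.fst ℝ (E n) (E n))
        + B.adjoint.comp (ContinuousLinearMap.snd ℝ (E n) (E n))) with hΦ'
  have hΦd : HasFDerivAt Φ Φ' (x, p) := by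
    refine HasFDerivAt.prodMk (HasFDerivAt.comp (x, p) hS hasFDerivAt_fst) ?_
    simp only [adjoint_eq_sum]
    have hk : ∀ k ∈ (Finset.univ : Finset (Fin n)), HasFDerivAt
        (fun z : E n × E n => ⟪fderiv ℝ τ (σ z.1) (ev k), z.2⟫_ℝ • (ev k : E n)) _ (x, p) :=
      fun k _ => ((hdB.clm_apply (hasFDerivAt_const (ev k : E n) (x, p))).inner ℝ
        (hasFDerivAt_snd (p := (x, p)))).smul_const (ev k : E n)
    refine (HasFDerivAt.fun_sum hk).congr_fderiv ?_
    refine ContinuousLinearMap.ext fun ⟨v, w⟩ => ?_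
    simp only [add_apply, ContinuousLinearMap.comp_apply,
      ContinuousLinearMap.coe_fst', ContinuousLinearMap.coe_snd', hCapp, adjoint_eq_sum,
      ← Finset.sum_add_distrib, sum_apply]
    refine Finset.sum_congr rfl fun k _ => ?_
    simp [fderivInnerCLM_apply, ← hB, ← add_smul, add_comm]
  -- the second sum is symmetric in `A` and `D`, since second derivatives are
  have key : ∀ {A D : E n × E n → ℝ}, DifferentiableAt ℝ A (Φ (x, p)) →
      DifferentiableAt ℝ D (Φ (x, p)) →
      ∑ l, fderiv ℝ (fun z => A (Φ z)) (x, p) (ev l, 0)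
          * fderiv ℝ (fun z => D (Φ z)) (x, p) (0, ev l)
        = ∑ m, fderiv ℝ A (Φ (x, p)) (ev m, 0) * fderiv ℝ D (Φ (x, p)) (0, ev m)
          + ∑ m, ∑ k, ⟪T (ev m) (ev k), p⟫_ℝ * (fderiv ℝ D (Φ (x, p)) (0, ev m)
            * fderiv ℝ A (Φ (x, p)) (0, ev k)) := by
    intro A D hA hD
    have hA' : fderiv ℝ (fun z => A (Φ z)) (x, p) = (fderiv ℝ A (Φ (x, p))).comp Φ' :=
      (HasFDerivAt.comp (x, p) hA.hasFDerivAt hΦd).fderiv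
    have hD' : fderiv ℝ (fun z => D (Φ z)) (x, p) = (fderiv ℝ D (Φ (x, p))).comp Φ' :=
      (HasFDerivAt.comp (x, p) hD.hasFDerivAt hΦd).fderiv
    set a := fderiv ℝ A (Φ (x, p))
    set d := fderiv ℝ D (Φ (x, p))
    have h := sum_map_mul_adjoint (a.comp (S.prod C))
      (d.comp (ContinuousLinearMap.inr ℝ (E n) (E n))) B
    simp only [ContinuousLinearMap.comp_apply, ContinuousLinearMap.prod_apply,
      ContinuousLinearMap.inr_apply, hSB] at h
    have e1 : ∀ l : Fin n, Φ' (ev l, 0) = (S (ev l), C (ev l)) := fun l => by simp [hΦ']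
    have e2 : ∀ l : Fin n, Φ' (0, ev l) = (0, B.adjoint (ev l)) := fun l => by simp [hΦ']
    rw [hA', hD']
    simp only [ContinuousLinearMap.comp_apply, e1, e2]
    rw [h, ← Finset.sum_add_distrib]
    refine Finset.sum_congr rfl fun m _ => ?_
    have h3 : a (ev m, C (B (ev m)))
        = a (ev m, 0) + ∑ k, ⟪T (ev m) (ev k), p⟫_ℝ * a (0, ev k) := by
      have h4 : ((ev m, C (B (ev m))) : E n × E n)
          = (ev m, 0) + ContinuousLinearMap.inr ℝ (E n) (E n) (C (B (ev m))) := by simp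
      rw [h4, map_add, hCapp, hSB, map_sum, map_sum]
      simp only [map_smul, smul_eq_mul, ContinuousLinearMap.inr_apply]
    rw [h3, mul_add, Finset.mul_sum]
    congr 1
    · ring
    · exact Finset.sum_congr rfl fun k _ => by ring
  have hz : Φ (x, p) = (σ x, B.adjoint p) := rfl
  rw [← hz] at hH hG ⊢
  simp only [coordPoisson, Finset.sum_sub_distrib]
  have k1 := key hH hG
  have k2 := key hG hH
  simp only [hΦ] at k1 k2 ⊢
  rw [k1, k2, Finset.sum_comm (f := fun m k => ⟪T (ev m) (ev k), p⟫_ℝ * (_ * _))]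
  have : ∀ a b c d : ℝ, b = d → a + b - (c + d) = a - c := by intros; linarith
  apply this
  refine Finset.sum_congr rfl fun m _ => Finset.sum_congr rfl fun k _ => ?_
  rw [hsym]
  ring

end CotangentLift

/-! ### Functions on the cotangent bundle in charts -/

section Charts

variable {n : ℕ} {Q : Type*} [TopologicalSpace Q] [ChartedSpace (E n) Q]

/-- The domain, in the chart at `c`, of the change of coordinates to the chart at `d`. -/
def overlap (c d : Q) : Set (E n) :=
  (extChartAt (𝓡 n) c).target ∩ (extChartAt (𝓡 n) c).symm ⁻¹' (extChartAt (𝓡 n) d).source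

theorem isOpen_overlap (c d : Q) : IsOpen (overlap (n := n) c d) :=
  (continuousOn_extChartAt_symm (I := 𝓡 n) c).isOpen_inter_preimage
    (isOpen_extChartAt_target c) (isOpen_extChartAt_source d)

theorem mem_overlap_self (c : Q) {x : E n} (hx : x ∈ (extChartAt (𝓡 n) c).target) :
    x ∈ overlap c ((extChartAt (𝓡 n) c).symm x) :=
  ⟨hx, mem_extChartAt_source (I := 𝓡 n) _⟩

/-- The inverse change of coordinates maps `overlap c d` to `overlap d c`. -/
theorem coordChange_mem_overlap {c d : Q} {x : E n} (hx : x ∈ overlap c d) :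
    extChartAt (𝓡 n) d ((extChartAt (𝓡 n) c).symm x) ∈ overlap d c := by
  refine ⟨(extChartAt (𝓡 n) d).map_source hx.2, ?_⟩
  rw [mem_preimage, (extChartAt (𝓡 n) d).left_inv hx.2]
  exact (extChartAt (𝓡 n) c).map_target hx.1

variable [IsManifold (𝓡 n) ∞ Q]

theorem tangentCoordChange_eq_fderiv (c d q : Q) : tangentCoordChange (𝓡 n) d c q
    = fderiv ℝ (extChartAt (𝓡 n) c ∘ (extChartAt (𝓡 n) d).symm) (extChartAt (𝓡 n) d q) := by
  rw [tangentCoordChange_def]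
  simp only [modelWithCornersSelf_coe, range_id, fderivWithin_univ]

theorem contDiffOn_coordChange (c d : Q) :
    ContDiffOn ℝ ∞ (extChartAt (𝓡 n) d ∘ (extChartAt (𝓡 n) c).symm) (overlap c d) := by
  have := contDiffOn_ext_coord_change (I := 𝓡 n) (n := ∞) d c
  rwa [PartialEquiv.trans_source] at this

theorem contDiffOn_tangentCoordChange (c d : Q) :
    ContDiffOn ℝ ∞ (fun x => tangentCoordChange (𝓡 n) d c ((extChartAt (𝓡 n) c).symm x))
      (overlap c d) := by
  simp only [tangentCoordChange_eq_fderiv]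
  have h := (contDiffOn_coordChange (n := n) d c).fderiv_of_isOpen (isOpen_overlap d c) (m := ∞)
    (by simp)
  exact h.comp (contDiffOn_coordChange c d) fun x hx => coordChange_mem_overlap hx

/-- The components of covectors for the charts at `c` and at `d` are related by the adjoint of the
derivative of the change of coordinates. -/
theorem inChart_eq_inChart {c d : Q} {x : E n} (hx : x ∈ overlap c d) (F : PhaseFn n Q) (p : E n) :
    inChart c F (x, p) = inChart d F (extChartAt (𝓡 n) d ((extChartAt (𝓡 n) c).symm x),
      (tangentCoordChange (𝓡 n) d c ((extChartAt (𝓡 n) c).symm x)).adjoint p) := by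
  set q := (extChartAt (𝓡 n) c).symm x with hq
  have hqc : q ∈ (extChartAt (𝓡 n) c).source := (extChartAt (𝓡 n) c).map_target hx.1
  have hqd : q ∈ (extChartAt (𝓡 n) d).source := hx.2
  simp only [inChart]
  rw [(extChartAt (𝓡 n) d).left_inv hqd, ← hq]
  congr 1
  rw [← ContinuousLinearMap.comp_apply, ← ContinuousLinearMap.adjoint_comp]
  congr 2
  ext1 v
  rw [ContinuousLinearMap.comp_apply]
  exact (tangentCoordChange_comp ⟨⟨mem_extChartAt_source q, hqd⟩, hqc⟩).symm

/-- The expression in the preferred chart at `q` gives back the function over `q` itself. -/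
theorem inChart_self (q : Q) (F : PhaseFn n Q) (p : E n) :
    inChart q F (extChartAt (𝓡 n) q q, p) = F q p := by
  have h : tangentCoordChange (𝓡 n) q q q = ContinuousLinearMap.id ℝ (E n) :=
    ContinuousLinearMap.ext fun v => tangentCoordChange_self (mem_extChartAt_source (I := 𝓡 n) q)
  simp only [inChart, extChartAt_to_inv]
  rw [h, ContinuousLinearMap.adjoint_id]
  rfl

theorem inChart_eq_self (c : Q) (x : E n) (F : PhaseFn n Q) (p : E n) :
    inChart c F (x, p) = F ((extChartAt (𝓡 n) c).symm x)
      ((tangentCoordChange (𝓡 n) ((extChartAt (𝓡 n) c).symm x) c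
        ((extChartAt (𝓡 n) c).symm x)).adjoint p) := rfl

/-- Passing to the components of a covector for another chart and back. -/
theorem adjoint_tangentCoordChange_cancel {c d q : Q} (hc : q ∈ (extChartAt (𝓡 n) c).source)
    (hd : q ∈ (extChartAt (𝓡 n) d).source) (p : E n) :
    (tangentCoordChange (𝓡 n) d c q).adjoint ((tangentCoordChange (𝓡 n) c d q).adjoint p) = p := by
  rw [← ContinuousLinearMap.comp_apply, ← ContinuousLinearMap.adjoint_comp]
  have h : (tangentCoordChange (𝓡 n) c d q).comp (tangentCoordChange (𝓡 n) d c q)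
      = ContinuousLinearMap.id ℝ (E n) := ContinuousLinearMap.ext fun v => by
    rw [ContinuousLinearMap.comp_apply, tangentCoordChange_comp ⟨⟨hd, hc⟩, hd⟩,
      tangentCoordChange_self hd]
    rfl
  rw [h, ContinuousLinearMap.adjoint_id]
  rfl

theorem IsSmooth.contDiffAt {F : PhaseFn n Q} (hF : IsSmooth F) {c : Q} {x : E n}
    (hx : x ∈ (extChartAt (𝓡 n) c).target) (p : E n) : ContDiffAt ℝ ∞ (inChart c F) (x, p) :=
  contDiffAt_of_mem (isOpen_extChartAt_target c) (hF c) hx p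

theorem IsSmooth.differentiableAt {F : PhaseFn n Q} (hF : IsSmooth F) {c : Q} {x : E n}
    (hx : x ∈ (extChartAt (𝓡 n) c).target) (p : E n) : DifferentiableAt ℝ (inChart c F) (x, p) :=
  (hF.contDiffAt hx p).differentiableAt (by simp)

theorem IsSmooth.contDiff_fibre {F : PhaseFn n Q} (hF : IsSmooth F) (q : Q) :
    ContDiff ℝ ∞ (F q) := by
  have h : F q = fun p => inChart q F (extChartAt (𝓡 n) q q, p) := by
    ext p; rw [inChart_self]
  rw [h, contDiff_iff_contDiffAt]
  intro p
  exact (hF.contDiffAt (mem_extChartAt_target q) p).comp p (contDiffAt_const.prodMk contDiffAt_id)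

theorem poisson_eq_coordPoisson (F G : PhaseFn n Q) (q : Q) (p : E n) :
    poisson F G q p = coordPoisson (inChart q F) (inChart q G) (extChartAt (𝓡 n) q q, p) := rfl

/-- The Poisson bracket has the canonical form in every chart. -/
theorem inChart_poisson {F G : PhaseFn n Q} (hF : IsSmooth F) (hG : IsSmooth G) (c : Q) {x : E n}
    (hx : x ∈ (extChartAt (𝓡 n) c).target) (p : E n) :
    inChart c (poisson F G) (x, p) = coordPoisson (inChart c F) (inChart c G) (x, p) := by
  set q := (extChartAt (𝓡 n) c).symm x with hq
  have hqc : q ∈ (extChartAt (𝓡 n) c).source := (extChartAt (𝓡 n) c).map_target hx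
  have hqq := mem_extChartAt_source (I := 𝓡 n) q
  have hxo : x ∈ overlap c q := mem_overlap_self c hx
  have hox := coordChange_mem_overlap hxo
  have hcq : extChartAt (𝓡 n) c q = x := (extChartAt (𝓡 n) c).right_inv hx
  set σ := extChartAt (𝓡 n) q ∘ (extChartAt (𝓡 n) c).symm with hσ
  set τ := extChartAt (𝓡 n) c ∘ (extChartAt (𝓡 n) q).symm with hτ
  have hS : HasFDerivAt σ (tangentCoordChange (𝓡 n) c q q) x := by
    have := hasFDerivWithinAt_tangentCoordChange (I := 𝓡 n) (x := c) (y := q) (z := q) ⟨hqc, hqq⟩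
    rwa [hcq, modelWithCornersSelf_coe, range_id, hasFDerivWithinAt_univ] at this
  have hB : ∀ y, fderiv ℝ τ (σ y)
      = tangentCoordChange (𝓡 n) q c ((extChartAt (𝓡 n) c).symm y) := fun y => by
    rw [tangentCoordChange_eq_fderiv]; rfl
  have hev : ∀ K : PhaseFn n Q, inChart c K =ᶠ[𝓝 (x, p)]
      fun z => inChart q K (σ z.1, (fderiv ℝ τ (σ z.1)).adjoint z.2) := fun K => by
    filter_upwards [((isOpen_overlap c q).prod isOpen_univ).mem_nhds
      (⟨hxo, mem_univ p⟩ : (x, p) ∈ overlap c q ×ˢ univ)] with z hz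
    rw [hB]
    exact inChart_eq_inChart hz.1 K z.2
  have hσx : σ x = extChartAt (𝓡 n) q q := rfl
  have hσt : σ x ∈ (extChartAt (𝓡 n) q).target := mem_extChartAt_target q
  have hinv : coordPoisson (inChart c F) (inChart c G) (x, p)
      = coordPoisson (inChart q F) (inChart q G) (σ x, (fderiv ℝ τ (σ x)).adjoint p) := by
    rw [← coordPoisson_comp_cotangentLift hS
      ((contDiffOn_coordChange q c).contDiffAt ((isOpen_overlap q c).mem_nhds hox)) ?_
      (hF.differentiableAt hσt _) (hG.differentiableAt hσt _)]
    · simp only [coordPoisson, (hev F).fderiv_eq, (hev G).fderiv_eq]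
      rfl
    · intro v
      rw [hB, ← hq, tangentCoordChange_comp ⟨⟨hqq, hqc⟩, hqq⟩, tangentCoordChange_self hqq]
  rw [hinv, hB, ← hq, inChart_eq_self c, poisson_eq_coordPoisson, hσx]

theorem contDiffOn_coordPoisson {U : Set (E n)} (hU : IsOpen U) {F G : E n × E n → ℝ}
    (hF : ContDiffOn ℝ ∞ F (U ×ˢ univ)) (hG : ContDiffOn ℝ ∞ G (U ×ˢ univ)) :
    ContDiffOn ℝ ∞ (coordPoisson F G) (U ×ˢ univ) :=
  ContDiffOn.sum fun _ _ =>
    ((contDiffOn_fderiv_apply hU hF _).mul (contDiffOn_fderiv_apply hU hG _)).sub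
      ((contDiffOn_fderiv_apply hU hG _).mul (contDiffOn_fderiv_apply hU hF _))

theorem IsSmooth.poisson {F G : PhaseFn n Q} (hF : IsSmooth F) (hG : IsSmooth G) :
    IsSmooth (poisson F G) := fun c =>
  (contDiffOn_coordPoisson (isOpen_extChartAt_target c) (hF c) (hG c)).congr
    fun z hz => inChart_poisson hF hG c hz.1 z.2

theorem IsSmooth.add {F G : PhaseFn n Q} (hF : IsSmooth F) (hG : IsSmooth G) :
    IsSmooth (F + G) := fun c => (hF c).add (hG c)

theorem IsSmooth.const_smul {F : PhaseFn n Q} (hF : IsSmooth F) (a : ℝ) :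
    IsSmooth (a • F) := fun c => (hF c).const_smul a

theorem IsSmooth.zero : IsSmooth (0 : PhaseFn n Q) := fun _ => contDiffOn_const

/-! ### Algebra of the Poisson bracket -/

theorem poisson_antisymm (F G : PhaseFn n Q) : poisson F G = -poisson G F := by
  ext q p
  simp only [poisson, Pi.neg_apply, ← Finset.sum_neg_distrib, neg_sub]

theorem fderiv_inChart_zero (q : Q) (z : E n × E n) :
    fderiv ℝ (inChart q (0 : PhaseFn n Q)) z = 0 := by
  have h : inChart q (0 : PhaseFn n Q) = fun _ => (0 : ℝ) := rfl
  rw [h, fderiv_fun_const]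
  rfl

theorem poisson_zero_right (F : PhaseFn n Q) : poisson F 0 = 0 := by
  ext q p
  simp [poisson, dq, dp, fderiv_inChart_zero]

theorem poisson_zero_left (F : PhaseFn n Q) : poisson 0 F = 0 := by
  rw [poisson_antisymm, poisson_zero_right, neg_zero]

theorem poisson_add_right {F G H : PhaseFn n Q} (hG : IsSmooth G) (hH : IsSmooth H) :
    poisson F (G + H) = poisson F G + poisson F H := by
  ext q p
  have hq := mem_extChartAt_target (I := 𝓡 n) q
  have h : fderiv ℝ (inChart q (G + H)) (extChartAt (𝓡 n) q q, p)
      = fderiv ℝ (inChart q G) (extChartAt (𝓡 n) q q, p)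
        + fderiv ℝ (inChart q H) (extChartAt (𝓡 n) q q, p) :=
    fderiv_add (hG.differentiableAt hq p) (hH.differentiableAt hq p)
  simp only [poisson, dq, dp, h, Pi.add_apply, add_apply, ← Finset.sum_add_distrib]
  exact Finset.sum_congr rfl fun l _ => by ring

theorem poisson_add_left {F G H : PhaseFn n Q} (hF : IsSmooth F) (hG : IsSmooth G) :
    poisson (F + G) H = poisson F H + poisson G H := by
  rw [poisson_antisymm, poisson_add_right hF hG, poisson_antisymm F, poisson_antisymm G, neg_add]

/-- The Leibniz rule. -/
theorem poisson_mul_right {F G H : PhaseFn n Q} (hG : IsSmooth G) (hH : IsSmooth H) :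
    poisson F (G * H) = G * poisson F H + H * poisson F G := by
  ext q p
  have hq := mem_extChartAt_target (I := 𝓡 n) q
  have h : fderiv ℝ (inChart q (G * H)) (extChartAt (𝓡 n) q q, p)
      = G q p • fderiv ℝ (inChart q H) (extChartAt (𝓡 n) q q, p)
        + H q p • fderiv ℝ (inChart q G) (extChartAt (𝓡 n) q q, p) := by
    have h1 := fderiv_mul (hG.differentiableAt hq p) (hH.differentiableAt hq p)
    rwa [inChart_self, inChart_self] at h1
  simp only [poisson, dq, dp, h, Pi.add_apply, Pi.mul_apply, add_apply, smul_apply, smul_eq_mul,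
    Finset.mul_sum, ← Finset.sum_add_distrib]
  exact Finset.sum_congr rfl fun l _ => by ring

/-! ### Homogeneous functions -/

/-- For smooth functions, being a homogeneous polynomial on each fibre is a scaling property, which
is easier to verify. -/
theorem isHomogeneous_iff {k : ℕ} {F : PhaseFn n Q} : IsHomogeneous k F ↔
    IsSmooth F ∧ ∀ (q : Q) (t : ℝ) (p : E n), F q (t • p) = t ^ k * F q p := by
  refine and_congr_right fun hF => forall_congr' fun q => ⟨?_, fun h => ?_⟩
  · rintro ⟨X, hX⟩ t p
    rw [hX, hX, sum_prod_homogeneous]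
  · exact exists_coeff_of_homogeneous (hF.contDiff_fibre q) h

theorem IsHomogeneous.inChart_smul {k : ℕ} {F : PhaseFn n Q} (hF : IsHomogeneous k F) (c : Q)
    (x : E n) (t : ℝ) (p : E n) : inChart c F (x, t • p) = t ^ k * inChart c F (x, p) := by
  simp only [inChart, map_smul]
  exact (isHomogeneous_iff.1 hF).2 _ _ _

theorem IsHomogeneous.temperedOn {k : ℕ} {F : PhaseFn n Q} (hF : IsHomogeneous k F) (c : Q) :
    TemperedOn (extChartAt (𝓡 n) c).target (inChart c F) :=
  TemperedOn.of_homogeneous (isOpen_extChartAt_target c) (hF.1 c) k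
    fun x _ t p => hF.inChart_smul c x t p

theorem IsHomogeneous.zero (k : ℕ) : IsHomogeneous k (0 : PhaseFn n Q) :=
  isHomogeneous_iff.2 ⟨IsSmooth.zero, fun q t p => by simp⟩

theorem IsHomogeneous.add {k : ℕ} {F G : PhaseFn n Q} (hF : IsHomogeneous k F)
    (hG : IsHomogeneous k G) : IsHomogeneous k (F + G) := by
  rw [isHomogeneous_iff] at *
  exact ⟨hF.1.add hG.1, fun q t p => by simp [hF.2, hG.2, mul_add]⟩

theorem IsHomogeneous.const_smul {k : ℕ} {F : PhaseFn n Q} (hF : IsHomogeneous k F) (a : ℝ) :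
    IsHomogeneous k (a • F) := by
  rw [isHomogeneous_iff] at *
  exact ⟨hF.1.const_smul a, fun q t p => by simp [hF.2]; ring⟩

theorem IsHomogeneous.neg {k : ℕ} {F : PhaseFn n Q} (hF : IsHomogeneous k F) :
    IsHomogeneous k (-F) := by
  simpa using hF.const_smul (-1)

theorem IsHomogeneous.sum {k : ℕ} {ι : Type*} (s : Finset ι) {F : ι → PhaseFn n Q}
    (hF : ∀ i ∈ s, IsHomogeneous k (F i)) : IsHomogeneous k (∑ i ∈ s, F i) :=
  Finset.sum_induction F (IsHomogeneous k) (fun _ _ ha hb => ha.add hb) (IsHomogeneous.zero k) hF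

theorem IsHomogeneous.fderiv_inChart_smul {k : ℕ} {F : PhaseFn n Q} (hF : IsHomogeneous k F)
    (q : Q) (t : ℝ) (p v w : E n) :
    fderiv ℝ (inChart q F) (extChartAt (𝓡 n) q q, t • p) (v, t • w)
      = t ^ k * fderiv ℝ (inChart q F) (extChartAt (𝓡 n) q q, p) (v, w) := by
  have hq := mem_extChartAt_target (I := 𝓡 n) q
  set x := extChartAt (𝓡 n) q q
  set δ : E n × E n →L[ℝ] E n × E n :=
    (ContinuousLinearMap.fst ℝ (E n) (E n)).prod (t • ContinuousLinearMap.snd ℝ (E n) (E n))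
  have h1 : HasFDerivAt (fun z => inChart q F (δ z))
      ((fderiv ℝ (inChart q F) (x, t • p)).comp δ) (x, p) :=
    HasFDerivAt.comp (x, p) (show HasFDerivAt (inChart q F) _ (δ (x, p)) from
      (hF.1.differentiableAt hq (t • p)).hasFDerivAt) δ.hasFDerivAt
  have h2 : (fun z => inChart q F (δ z)) = fun z => t ^ k * inChart q F z := by
    ext z; exact hF.inChart_smul q z.1 t z.2
  rw [h2] at h1
  have h3 := h1.unique ((hF.1.differentiableAt hq p).hasFDerivAt.const_mul (t ^ k))
  exact congrArg (fun L => L (v, w)) h3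

theorem IsHomogeneous.dq_smul {k : ℕ} {F : PhaseFn n Q} (hF : IsHomogeneous k F) (l : Fin n)
    (q : Q) (t : ℝ) (p : E n) : dq l F q (t • p) = t ^ k * dq l F q p := by
  have h := hF.fderiv_inChart_smul q t p (ev l) 0
  rwa [smul_zero] at h

/-- `∂F/∂p_ℓ` has degree `k - 1`. The factor `t` on the left avoids the subtraction, and makes the
statement true for `t = 0` and `k = 0`. -/
theorem IsHomogeneous.dp_smul {k : ℕ} {F : PhaseFn n Q} (hF : IsHomogeneous k F) (l : Fin n)
    (q : Q) (t : ℝ) (p : E n) : t * dp l F q (t • p) = t ^ k * dp l F q p := by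
  have h := hF.fderiv_inChart_smul q t p 0 (ev l)
  have h' : ((0, t • ev l) : E n × E n) = t • (0, ev l) := by simp
  rwa [h', map_smul, smul_eq_mul] at h

/-- The bracket of homogeneous functions of degrees `i` and `j` is homogeneous of degree
`i + j - 1`. -/
theorem IsHomogeneous.poisson {i j k : ℕ} {F G : PhaseFn n Q} (hF : IsHomogeneous i F)
    (hG : IsHomogeneous j G) (hk : i + j = k + 1) : IsHomogeneous k (poisson F G) := by
  refine isHomogeneous_iff.2 ⟨hF.1.poisson hG.1, fun q t p => ?_⟩
  have hne : ∀ t : ℝ, t ≠ 0 → VlasovMatched.poisson F G q (t • p)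
      = t ^ k * VlasovMatched.poisson F G q p := fun t ht => by
    refine mul_left_cancel₀ ht ?_
    simp only [VlasovMatched.poisson, Finset.mul_sum]
    refine Finset.sum_congr rfl fun l _ => ?_
    rw [hF.dq_smul, hG.dq_smul]
    have e : t * (t ^ k * (dq l F q p * dp l G q p - dq l G q p * dp l F q p))
        = t ^ (k + 1) * (dq l F q p * dp l G q p - dq l G q p * dp l F q p) := by ring
    rw [e, ← hk]
    linear_combination (t ^ i * dq l F q p) * hG.dp_smul l q t p
      - (t ^ j * dq l G q p) * hF.dp_smul l q t p
  -- both sides are continuous in `t`, so the case `t = 0` follows from the others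
  have hc := ((hF.1.poisson hG.1).contDiff_fibre q).continuous
  have := Continuous.ext_on (dense_compl_singleton (0 : ℝ))
    (hc.comp (continuous_id.smul continuous_const : Continuous fun t : ℝ => t • p))
    (by fun_prop : Continuous fun t : ℝ => t ^ k * VlasovMatched.poisson F G q p)
    (fun t ht => hne t ht)
  exact congrFun this t

theorem poisson_eq_zero_of_isHomogeneous_zero {F G : PhaseFn n Q} (hF : IsHomogeneous 0 F)
    (hG : IsHomogeneous 0 G) : poisson F G = 0 := by
  have h : ∀ {H : PhaseFn n Q}, IsHomogeneous 0 H → ∀ l q p, dp l H q p = 0 := by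
    intro H hH l q p
    have h0 : ∀ p, H q p = H q 0 := fun p => by
      simpa using ((isHomogeneous_iff.1 hH).2 q 0 p).symm
    have hq := mem_extChartAt_target (I := 𝓡 n) q
    have h1 : HasFDerivAt (fun p' : E n => inChart q H (extChartAt (𝓡 n) q q, p'))
        ((fderiv ℝ (inChart q H) (extChartAt (𝓡 n) q q, p)).comp
          (ContinuousLinearMap.inr ℝ (E n) (E n))) p :=
      HasFDerivAt.comp p (hH.1.differentiableAt hq p).hasFDerivAt (hasFDerivAt_prodMk_right _ p)
    have h2 : (fun p' : E n => inChart q H (extChartAt (𝓡 n) q q, p')) = fun _ => H q 0 := by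
      ext p'; rw [inChart_self, h0]
    rw [h2] at h1
    have h3 := h1.unique (hasFDerivAt_const _ _)
    simpa [dp] using congrArg (fun L => L (ev l)) h3
  ext q p
  simp [poisson, h hF, h hG]

end Charts

/-! ### The decomposition into moment parts -/

section Moments

variable {n : ℕ} {Q : Type*}

theorem moment_smul (f : PhaseFn n Q) (a : ℝ) {k : ℕ} (i : Fin k → Fin n) (q : Q) :
    moment (a • f) i q = a * moment f i q := by
  simp only [moment, Pi.smul_apply, smul_eq_mul, mul_left_comm _ a, integral_const_mul]

theorem moment_neg (f : PhaseFn n Q) {k : ℕ} (i : Fin k → Fin n) (q : Q) :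
    moment (-f) i q = -moment f i q := by
  simpa using moment_smul f (-1) i q

theorem MomentVanishes.const_smul {f : PhaseFn n Q} {k : ℕ} (hf : MomentVanishes k f) (a : ℝ) :
    MomentVanishes k (a • f) := fun i q => by rw [moment_smul, hf, mul_zero]

theorem MomentVanishes.zero (k : ℕ) : MomentVanishes k (0 : PhaseFn n Q) := fun i q => by
  simp [moment]

/-- The parts add up to `f`: what is left after all orders down to `1` were split off is its own
part of order `0`, because `T₀` is the identity. -/
theorem sum_momentPart (f : PhaseFn n Q) :
    ∑ k ∈ Finset.range (momentOrder f + 1), momentPart f k = f := by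
  set m := momentOrder f with hm
  have h : ∀ j ≤ m, ∑ k ∈ Finset.range j, momentPart f (m - k) = f - residual m f j := by
    intro j hj
    induction j with
    | zero => simp [residual]
    | succ j ih =>
      rw [Finset.sum_range_succ, ih (by omega), residual, momentPart, if_pos (by omega), ← hm,
        Nat.sub_sub_self (by omega)]
      abel
  rw [← Finset.sum_range_reflect]
  simp only [Nat.add_sub_cancel]
  rw [Finset.sum_range_succ, h m le_rfl, momentPart, if_pos (by omega), ← hm, Nat.sub_self,
    Nat.sub_zero]
  simp [topPart, eulerIter]

theorem sComp_add_nComp (f : PhaseFn n Q) : f = sComp f + nComp f := by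
  conv_lhs => rw [← sum_momentPart f]
  rw [sComp, nComp]
  rcases Nat.eq_zero_or_pos (momentOrder f) with h | h
  · have h1 : momentPart f 1 = 0 := by rw [momentPart, if_neg (by omega)]
    simp [h, h1]
  · obtain ⟨m, hm⟩ : ∃ m, momentOrder f = m + 1 := ⟨momentOrder f - 1, by omega⟩
    have : Finset.Icc 2 (m + 1) = Finset.Ico 2 (m + 1 + 1) := by
      ext; simp only [Finset.mem_Icc, Finset.mem_Ico]; omega
    rw [hm, this, Finset.range_eq_Ico, Finset.sum_eq_sum_Ico_succ_bot (by omega),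
      Finset.sum_eq_sum_Ico_succ_bot (by omega), ← add_assoc]

end Moments

/-! ### Admissible functions -/

section Admissible

variable {n : ℕ} {Q : Type*} [TopologicalSpace Q] [ChartedSpace (E n) Q] [IsManifold (𝓡 n) ∞ Q]

theorem isAdmissible_iff {f : PhaseFn n Q} : IsAdmissible f ↔
    (∃ K : Set Q, IsCompact K ∧ ∀ q, q ∉ K → ∀ p, f q p = 0) ∧
    ∀ c : Q, RapidOn (extChartAt (𝓡 n) c).target (inChart c f) :=
  ⟨fun h => ⟨h.2.1, fun c => ⟨h.1 c, fun K hK hKU => h.2.2 c K hK hKU⟩⟩,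
    fun h => ⟨fun c => (h.2 c).1, h.1, fun c K hK hKU => (h.2 c).2 K hK hKU⟩⟩

theorem IsAdmissible.rapidOn {f : PhaseFn n Q} (hf : IsAdmissible f) (c : Q) :
    RapidOn (extChartAt (𝓡 n) c).target (inChart c f) := (isAdmissible_iff.1 hf).2 c

theorem IsAdmissible.add {f g : PhaseFn n Q} (hf : IsAdmissible f) (hg : IsAdmissible g) :
    IsAdmissible (f + g) := by
  obtain ⟨K, hK, hK0⟩ := hf.2.1
  obtain ⟨L, hL, hL0⟩ := hg.2.1
  refine isAdmissible_iff.2 ⟨⟨K ∪ L, hK.union hL, fun q hq p => ?_⟩, fun c =>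
    (hf.rapidOn c).add (isOpen_extChartAt_target c) (hg.rapidOn c)⟩
  rw [mem_union, not_or] at hq
  simp [hK0 q hq.1, hL0 q hq.2]

theorem IsAdmissible.const_smul {f : PhaseFn n Q} (hf : IsAdmissible f) (a : ℝ) :
    IsAdmissible (a • f) := by
  obtain ⟨K, hK, hK0⟩ := hf.2.1
  exact isAdmissible_iff.2 ⟨⟨K, hK, fun q hq p => by simp [hK0 q hq]⟩, fun c =>
    (hf.rapidOn c).const_smul (isOpen_extChartAt_target c) a⟩

theorem IsAdmissible.neg {f : PhaseFn n Q} (hf : IsAdmissible f) : IsAdmissible (-f) := by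
  simpa using hf.const_smul (-1)

theorem IsAdmissible.sub {f g : PhaseFn n Q} (hf : IsAdmissible f) (hg : IsAdmissible g) :
    IsAdmissible (f - g) := by
  simpa [sub_eq_add_neg] using hf.add hg.neg

theorem IsAdmissible.zero : IsAdmissible (0 : PhaseFn n Q) :=
  isAdmissible_iff.2 ⟨⟨∅, isCompact_empty, fun _ _ _ => rfl⟩, fun _ => RapidOn.zero⟩

theorem IsAdmissible.sum {ι : Type*} (s : Finset ι) {f : ι → PhaseFn n Q}
    (hf : ∀ i ∈ s, IsAdmissible (f i)) : IsAdmissible (∑ i ∈ s, f i) :=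
  Finset.sum_induction f IsAdmissible (fun _ _ ha hb => ha.add hb) IsAdmissible.zero hf

theorem IsAdmissible.mul_isHomogeneous {f F : PhaseFn n Q} (hf : IsAdmissible f) {k : ℕ}
    (hF : IsHomogeneous k F) : IsAdmissible (f * F) := by
  obtain ⟨K, hK, hK0⟩ := hf.2.1
  refine isAdmissible_iff.2 ⟨⟨K, hK, fun q hq p => by simp [hK0 q hq]⟩, fun c => ?_⟩
  rw [mul_comm]
  exact (hF.temperedOn c).mul_rapidOn (isOpen_extChartAt_target c) (hf.rapidOn c)

theorem rapidOn_coordPoisson {U : Set (E n)} (hU : IsOpen U) {F G : E n × E n → ℝ}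
    (hF : TemperedOn U F) (hG : RapidOn U G) : RapidOn U (coordPoisson F G) := by
  have h : coordPoisson F G = ∑ l : Fin n,
      ((fun z => fderiv ℝ F z (ev l, 0)) * (fun z => fderiv ℝ G z (0, ev l))
        + -((fun z => fderiv ℝ F z (0, ev l)) * fun z => fderiv ℝ G z (ev l, 0))) := by
    ext z
    simp only [coordPoisson, Finset.sum_apply, Pi.add_apply, Pi.mul_apply, Pi.neg_apply]
    exact Finset.sum_congr rfl fun l _ => by ring
  rw [h]
  exact RapidOn.sum hU _ fun l _ =>
    ((hF.fderiv_apply hU _).mul_rapidOn hU (hG.fderiv_apply hU _)).add hU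
      (((hF.fderiv_apply hU _).mul_rapidOn hU (hG.fderiv_apply hU _)).neg hU)

theorem poisson_apply_eq_zero (F : PhaseFn n Q) {G : PhaseFn n Q} {O : Set Q} (hO : IsOpen O)
    (hG : ∀ q ∈ O, ∀ p, G q p = 0) {q : Q} (hq : q ∈ O) (p : E n) : poisson F G q p = 0 := by
  have h : inChart q G =ᶠ[𝓝 (extChartAt (𝓡 n) q q, p)] 0 := by
    have h1 : Tendsto (fun z : E n × E n => (extChartAt (𝓡 n) q).symm z.1)
        (𝓝 (extChartAt (𝓡 n) q q, p)) (𝓝 ((extChartAt (𝓡 n) q).symm (extChartAt (𝓡 n) q q))) :=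
      (continuousAt_extChartAt_symm (I := 𝓡 n) q).tendsto.comp continuousAt_fst
    rw [extChartAt_to_inv] at h1
    filter_upwards [h1 (hO.mem_nhds hq)] with z hz using hG _ hz _
  have h2 : fderiv ℝ (inChart q G) (extChartAt (𝓡 n) q q, p) = 0 := by
    rw [h.fderiv_eq]; exact fderiv_const_apply (0 : ℝ)
  simp [poisson_eq_coordPoisson, coordPoisson, -extChartAt, h2]

theorem IsHomogeneous.poisson_isAdmissible [T2Space Q] {f F : PhaseFn n Q} {k : ℕ}
    (hF : IsHomogeneous k F) (hf : IsAdmissible f) : IsAdmissible (VlasovMatched.poisson F f) := by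
  obtain ⟨K, hK, hK0⟩ := hf.2.1
  refine isAdmissible_iff.2 ⟨⟨K, hK, fun q hq p =>
    poisson_apply_eq_zero F hK.isClosed.isOpen_compl hK0 hq p⟩, fun c => ?_⟩
  exact (rapidOn_coordPoisson (isOpen_extChartAt_target c) (hF.temperedOn c)
    (hf.rapidOn c)).congr (isOpen_extChartAt_target c)
      fun x hx p => inChart_poisson hF.1 hf.1 c hx p

/-! ### Fibres and moments -/

theorem IsAdmissible.exists_schwartz_fibre {f : PhaseFn n Q} (hf : IsAdmissible f) (q : Q) :
    ∃ S : 𝓢(E n, ℝ), (S : E n → ℝ) = f q := by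
  obtain ⟨S, hS⟩ := (hf.rapidOn q).exists_schwartz_fibre (isOpen_extChartAt_target q)
    (mem_extChartAt_target q)
  exact ⟨S, funext fun p => by rw [hS, inChart_self]⟩

theorem IsAdmissible.integrable_fibre {f : PhaseFn n Q} (hf : IsAdmissible f) (q : Q) :
    Integrable (f q) := by
  obtain ⟨S, hS⟩ := hf.exists_schwartz_fibre q
  rw [← hS]
  exact S.integrable

theorem IsAdmissible.integrable_moment {f : PhaseFn n Q} (hf : IsAdmissible f) {k : ℕ}
    (i : Fin k → Fin n) (q : Q) : Integrable fun p : E n => (∏ a, p (i a)) * f q p := by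
  obtain ⟨S, hS⟩ := hf.exists_schwartz_fibre q
  rw [← hS]
  exact integrable_monomial_mul i S

theorem moment_add {f g : PhaseFn n Q} (hf : IsAdmissible f) (hg : IsAdmissible g) {k : ℕ}
    (i : Fin k → Fin n) (q : Q) : moment (f + g) i q = moment f i q + moment g i q := by
  simp only [moment, Pi.add_apply, mul_add]
  exact integral_add (hf.integrable_moment i q) (hg.integrable_moment i q)

theorem moment_sub {f g : PhaseFn n Q} (hf : IsAdmissible f) (hg : IsAdmissible g) {k : ℕ}
    (i : Fin k → Fin n) (q : Q) : moment (f - g) i q = moment f i q - moment g i q := by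
  rw [sub_eq_add_neg, moment_add hf hg.neg, moment_neg, sub_eq_add_neg]

theorem MomentVanishes.add {f g : PhaseFn n Q} {k : ℕ} (hf : IsAdmissible f) (hg : IsAdmissible g)
    (hf0 : MomentVanishes k f) (hg0 : MomentVanishes k g) : MomentVanishes k (f + g) :=
  fun i q => by rw [moment_add hf hg, hf0, hg0, add_zero]

/-- Fibre integrals against homogeneous functions of degree `k` depend on the moments of order `k`
only. -/
theorem MomentVanishes.integral_mul_eq_zero {f F : PhaseFn n Q} {k : ℕ} (h : MomentVanishes k f)
    (hf : IsAdmissible f) (hF : IsHomogeneous k F) (q : Q) : ∫ p, (f * F) q p = 0 := by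
  obtain ⟨X, hX⟩ := hF.2 q
  have h1 : ∀ p, (f * F) q p = ∑ i, X i * ((∏ a, p (i a)) * f q p) := fun p => by
    simp only [Pi.mul_apply, hX, Finset.mul_sum]
    exact Finset.sum_congr rfl fun i _ => by ring
  simp only [h1]
  rw [integral_finsetSum _ fun i _ => (hf.integrable_moment i q).const_mul _]
  refine Finset.sum_eq_zero fun i _ => ?_
  rw [integral_const_mul]
  exact mul_eq_zero_of_right _ (h i q)

/-! ### The Euler operator -/

/-- The radial derivative along the fibre does not depend on the chart. -/
theorem fderiv_fibre_apply_self {f : PhaseFn n Q} (hf : IsSmooth f) (c : Q) {x : E n}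
    (hx : x ∈ (extChartAt (𝓡 n) c).target) (p : E n) :
    fderiv ℝ (f ((extChartAt (𝓡 n) c).symm x))
        ((tangentCoordChange (𝓡 n) ((extChartAt (𝓡 n) c).symm x) c
          ((extChartAt (𝓡 n) c).symm x)).adjoint p)
        ((tangentCoordChange (𝓡 n) ((extChartAt (𝓡 n) c).symm x) c
          ((extChartAt (𝓡 n) c).symm x)).adjoint p)
      = fderiv ℝ (inChart c f) (x, p) (0, p) := by
  set q := (extChartAt (𝓡 n) c).symm x
  set A := (tangentCoordChange (𝓡 n) q c q).adjoint
  have h1 : HasFDerivAt (fun p' => f q (A p')) ((fderiv ℝ (f q) (A p)).comp A) p :=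
    HasFDerivAt.comp p (((hf.contDiff_fibre q).differentiable (by simp) _).hasFDerivAt)
      A.hasFDerivAt
  have h2 : HasFDerivAt (fun p' => f q (A p')) ((fderiv ℝ (inChart c f) (x, p)).comp
      (ContinuousLinearMap.inr ℝ (E n) (E n))) p :=
    HasFDerivAt.comp p (hf.differentiableAt hx p).hasFDerivAt (hasFDerivAt_prodMk_right x p)
  simpa using congrArg (fun L => L p) (h1.unique h2)

theorem fderiv_apply_eq_sum (L : E n × E n →L[ℝ] ℝ) (p : E n) :
    L (0, p) = ∑ l, p l * L (0, ev l) := by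
  have h : ((0, p) : E n × E n) = ContinuousLinearMap.inr ℝ (E n) (E n) (∑ l, p l • ev l) := by
    rw [sum_smul_ev]; rfl
  rw [h, map_sum, map_sum]
  simp only [map_smul, smul_eq_mul, ContinuousLinearMap.inr_apply]

theorem euler_apply {f : PhaseFn n Q} (hf : IsSmooth f) (q : Q) (p : E n) :
    euler f q p = -(n * f q p + fderiv ℝ (f q) p p) := by
  have hd : DifferentiableAt ℝ (f q) p := (hf.contDiff_fibre q).differentiable (by simp) p
  have h : ∀ l : Fin n, fderiv ℝ (fun p' : E n => p' l * f q p') p (ev l)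
      = f q p + p l * fderiv ℝ (f q) p (ev l) := fun l => by
    have h1 : HasFDerivAt (fun p' : E n => p' l) (EuclideanSpace.proj l : E n →L[ℝ] ℝ) p :=
      (EuclideanSpace.proj l : E n →L[ℝ] ℝ).hasFDerivAt
    have h3 : fderiv ℝ (fun p' : E n => p' l * f q p') p = _ := (h1.mul hd.hasFDerivAt).fderiv
    rw [h3]
    simp [ev_apply, add_comm]
  have h2 : fderiv ℝ (f q) p p = ∑ l, p l * fderiv ℝ (f q) p (ev l) := by
    conv_lhs => rw [← sum_smul_ev p]
    rw [sum_smul_ev, ← sum_smul_ev p, map_sum, sum_smul_ev]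
    simp
  simp only [euler, h, Finset.sum_add_distrib, ← h2]
  simp

theorem inChart_euler {f : PhaseFn n Q} (hf : IsSmooth f) (c : Q) {x : E n}
    (hx : x ∈ (extChartAt (𝓡 n) c).target) (p : E n) : inChart c (euler f) (x, p)
      = -(n * inChart c f (x, p) + ∑ l, p l * fderiv ℝ (inChart c f) (x, p) (0, ev l)) := by
  rw [inChart_eq_self, euler_apply hf, fderiv_fibre_apply_self hf c hx, fderiv_apply_eq_sum,
    inChart_eq_self]

theorem temperedOn_coord {U : Set (E n)} (hU : IsOpen U) (l : Fin n) :
    TemperedOn U (fun z : E n × E n => z.2 l) := by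
  refine TemperedOn.of_homogeneous hU ?_ 1 fun x _ t p => by simp
  exact ((EuclideanSpace.proj l : E n →L[ℝ] ℝ).contDiff.comp contDiff_snd).contDiffOn

theorem IsAdmissible.euler {f : PhaseFn n Q} (hf : IsAdmissible f) : IsAdmissible (euler f) := by
  obtain ⟨K, hK, hK0⟩ := hf.2.1
  refine isAdmissible_iff.2 ⟨⟨K, hK, fun q hq p => ?_⟩, fun c => ?_⟩
  · have : f q = 0 := funext (hK0 q hq)
    rw [euler_apply hf.1, this]
    simp
  · have hU := isOpen_extChartAt_target (I := 𝓡 n) c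
    have h : RapidOn (extChartAt (𝓡 n) c).target (-((n : ℝ) • inChart c f
        + ∑ l, (fun z : E n × E n => z.2 l) * fun z => fderiv ℝ (inChart c f) z (0, ev l))) :=
      (((hf.rapidOn c).const_smul hU n).add hU (RapidOn.sum hU _ fun l _ =>
        (temperedOn_coord hU l).mul_rapidOn hU ((hf.rapidOn c).fderiv_apply hU _))).neg hU
    exact h.congr hU fun x hx p => by rw [inChart_euler hf.1 c hx]; simp

theorem moment_euler {f : PhaseFn n Q} (hf : IsAdmissible f) {k : ℕ} (i : Fin k → Fin n) (q : Q) :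
    moment (euler f) i q = k * moment f i q := by
  obtain ⟨S, hS⟩ := hf.exists_schwartz_fibre q
  simp only [moment, VlasovMatched.euler, ← hS]
  exact integral_monomial_mul_euler i S

theorem IsAdmissible.eulerIter {f : PhaseFn n Q} (hf : IsAdmissible f) (k : ℕ) :
    IsAdmissible (eulerIter f k) := by
  induction k with
  | zero => exact hf
  | succ k ih => exact ih.euler.sub (ih.const_smul _)

/-- Each step `f ↦ euler f - m f` multiplies the moments of order `k` by `k - m`. -/
theorem moment_eulerIter {f : PhaseFn n Q} (hf : IsAdmissible f) (m : ℕ) {k : ℕ}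
    (i : Fin k → Fin n) (q : Q) :
    moment (eulerIter f m) i q = k.descFactorial m * moment f i q := by
  induction m with
  | zero => simp [eulerIter]
  | succ m ih =>
    have ha := hf.eulerIter m
    rw [eulerIter, moment_sub ha.euler (ha.const_smul _), moment_euler ha, moment_smul, ih,
      Nat.descFactorial_succ, Nat.cast_mul]
    rcases le_or_gt m k with h | h
    · rw [Nat.cast_sub h]; ring
    · rw [Nat.descFactorial_of_lt h]; simp

theorem IsAdmissible.topPart {f : PhaseFn n Q} (hf : IsAdmissible f) (m : ℕ) :
    IsAdmissible (topPart m f) := (hf.eulerIter m).const_smul _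

/-- The factor `k.choose m` is `0` for `k < m` and `1` for `k = m`, so that for `f` without moments
of order above `m` only those of order `m` survive, unchanged. -/
theorem moment_topPart {f : PhaseFn n Q} (hf : IsAdmissible f) (m : ℕ) {k : ℕ}
    (i : Fin k → Fin n) (q : Q) : moment (topPart m f) i q = k.choose m * moment f i q := by
  have hm : (m.factorial : ℝ) ≠ 0 := by positivity
  rw [topPart, moment_smul, moment_eulerIter hf, Nat.descFactorial_eq_factorial_mul_choose]
  push_cast
  field_simp

/-! ### Moments of the parts -/

theorem IsAdmissible.residual {f : PhaseFn n Q} (hf : IsAdmissible f) (m j : ℕ) :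
    IsAdmissible (residual m f j) := by
  induction j with
  | zero => exact hf
  | succ j ih => exact ih.sub (ih.topPart _)

/-- If the moments of `f` of order above `m` vanish, then after `j ≤ m + 1` steps the moments of
order at most `m - j` are unchanged and the others are removed. -/
theorem moment_residual {f : PhaseFn n Q} (hf : IsAdmissible f) {m : ℕ}
    (hm : ∀ k, m < k → MomentVanishes k f) {j : ℕ} (hj : j ≤ m + 1) {k : ℕ} (i : Fin k → Fin n)
    (q : Q) : moment (residual m f j) i q = if k + j ≤ m then moment f i q else 0 := by
  induction j with
  | zero =>
    split_ifs with h
    · rfl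
    · exact hm k (by omega) i q
  | succ j ih =>
    have ha := hf.residual m j
    rw [residual, moment_sub ha (ha.topPart _), moment_topPart ha, ih (by omega)]
    rcases lt_trichotomy k (m - j) with h | h | h
    · rw [Nat.choose_eq_zero_of_lt h, if_pos (by omega), if_pos (by omega)]; simp
    · have hc : k.choose (m - j) = 1 := by rw [h, Nat.choose_self]
      rw [hc, if_neg (by omega : ¬ k + (j + 1) ≤ m)]; simp
    · rw [if_neg (by omega), if_neg (by omega)]; simp

theorem momentVanishes_of_momentOrder_lt {f : PhaseFn n Q} (hf : f ∈ F₀Dual n Q) (k : ℕ)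
    (hk : momentOrder f < k) : MomentVanishes k f := by
  obtain ⟨N, hN⟩ := hf.2
  exact Nat.sInf_mem (s := {m : ℕ | ∀ k, m < k → MomentVanishes k f})
    ⟨N, fun k hk => hN k (le_of_lt hk)⟩ k hk

theorem IsAdmissible.momentPart {f : PhaseFn n Q} (hf : IsAdmissible f) (k : ℕ) :
    IsAdmissible (momentPart f k) := by
  rw [VlasovMatched.momentPart]
  split_ifs
  exacts [(hf.residual _ _).topPart _, IsAdmissible.zero]

/-- The part `f_(k)` has the moments of order `k` of `f` and no others. -/
theorem moment_momentPart {f : PhaseFn n Q} (hf : f ∈ F₀Dual n Q) (k : ℕ) {j : ℕ}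
    (i : Fin j → Fin n) (q : Q) :
    moment (momentPart f k) i q = if j = k then moment f i q else 0 := by
  rw [momentPart]
  split_ifs with hk hjk hjk
  · rw [moment_topPart (hf.1.residual _ _), moment_residual hf.1
      (momentVanishes_of_momentOrder_lt hf) (by omega), if_pos (by omega)]
    have hc : j.choose k = 1 := by rw [hjk, Nat.choose_self]
    rw [hc, Nat.cast_one, one_mul]
  · rw [moment_topPart (hf.1.residual _ _), moment_residual hf.1
      (momentVanishes_of_momentOrder_lt hf) (by omega)]
    rcases lt_or_gt_of_ne hjk with h | h
    · rw [Nat.choose_eq_zero_of_lt h]; simp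
    · rw [if_neg (by omega), mul_zero]
  · rw [MomentVanishes.zero, momentVanishes_of_momentOrder_lt hf j (by omega)]
  · exact MomentVanishes.zero j i q

theorem momentPart_mem_degDual {f : PhaseFn n Q} (hf : f ∈ F₀Dual n Q) (k : ℕ) :
    momentPart f k ∈ degDual n Q k :=
  ⟨hf.1.momentPart k, fun j hj i q => by rw [moment_momentPart hf, if_neg hj]⟩

theorem momentVanishes_sub_momentPart {f : PhaseFn n Q} (hf : f ∈ F₀Dual n Q) (k : ℕ) :
    MomentVanishes k (f - momentPart f k) := fun i q => by
  rw [moment_sub hf.1 (hf.1.momentPart k), moment_momentPart hf, if_pos rfl, sub_self]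

theorem sComp_mem_sDual {f : PhaseFn n Q} (hf : f ∈ F₀Dual n Q) : sComp f ∈ sDual n Q := by
  have h0 := momentPart_mem_degDual hf 0
  have h1 := momentPart_mem_degDual hf 1
  exact ⟨h0.1.add h1.1, fun k hk =>
    (h0.2 k (by omega)).add h0.1 h1.1 (h1.2 k (by omega))⟩

theorem mem_F₀Dual_of_degDual {f : PhaseFn n Q} {k : ℕ} (hf : f ∈ degDual n Q k) :
    f ∈ F₀Dual n Q := ⟨hf.1, k + 1, fun j hj => hf.2 j (by omega)⟩

theorem mem_F₀Dual_of_sDual {f : PhaseFn n Q} (hf : f ∈ sDual n Q) : f ∈ F₀Dual n Q :=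
  ⟨hf.1, 2, hf.2⟩

theorem F₀Dual_add {f g : PhaseFn n Q} (hf : f ∈ F₀Dual n Q) (hg : g ∈ F₀Dual n Q) :
    f + g ∈ F₀Dual n Q := by
  obtain ⟨M, hM⟩ := hf.2
  obtain ⟨N, hN⟩ := hg.2
  exact ⟨hf.1.add hg.1, max M N, fun k hk =>
    (hM k (le_of_max_le_left hk)).add hf.1 hg.1 (hN k (le_of_max_le_right hk))⟩

theorem nDual_add {f g : PhaseFn n Q} (hf : f ∈ nDual n Q) (hg : g ∈ nDual n Q) :
    f + g ∈ nDual n Q :=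
  ⟨F₀Dual_add hf.1 hg.1, fun k hk => (hf.2 k hk).add hf.1.1 hg.1.1 (hg.2 k hk)⟩

theorem nComp_mem_nDual {f : PhaseFn n Q} (hf : f ∈ F₀Dual n Q) : nComp f ∈ nDual n Q := by
  refine Finset.sum_induction _ (· ∈ nDual n Q) (fun _ _ ha hb => nDual_add ha hb)
    ⟨⟨IsAdmissible.zero, 0, fun k _ => MomentVanishes.zero k⟩, fun k _ => MomentVanishes.zero k⟩
    fun k hk => ?_
  have h := momentPart_mem_degDual hf k
  have hk := Finset.mem_Icc.1 hk
  exact ⟨mem_F₀Dual_of_degDual h, fun j hj => h.2 j (by omega)⟩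

end Admissible

/-! ### Integrals over the coordinate phase space -/

section FlatIntegrals

variable {n : ℕ}

theorem det_adjoint (B : E n →L[ℝ] E n) : B.adjoint.det = B.det := by
  have h : (B.adjoint : E n →ₗ[ℝ] E n) = LinearMap.adjoint (B : E n →ₗ[ℝ] E n) := by
    rw [LinearMap.eq_adjoint_iff]
    intro x y
    exact ContinuousLinearMap.adjoint_inner_left B y x
  rw [ContinuousLinearMap.det, ContinuousLinearMap.det, h,
    ← LinearMap.det_toMatrix (EuclideanSpace.basisFun (Fin n) ℝ).toBasis,
    LinearMap.toMatrix_adjoint, Matrix.det_conjTranspose, LinearMap.det_toMatrix]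
  simp

theorem integral_eq_abs_det_mul {L L' : E n →L[ℝ] E n} (h₁ : ∀ p, L' (L p) = p)
    (h₂ : ∀ p, L (L' p) = p) (g : E n → ℝ) : ∫ p, g p = |L.det| * ∫ p, g (L p) := by
  have h := integral_image_eq_integral_abs_det_fderiv_smul (volume : Measure (E n))
    MeasurableSet.univ (fun x _ => L.hasFDerivAt.hasFDerivWithinAt)
    (Function.LeftInverse.injective h₁).injOn g
  rw [image_univ, (Function.RightInverse.surjective h₂).range_eq] at h
  simpa [integral_const_mul] using h

instance isAddHaarMeasure_volume_prod : (volume : Measure (E n × E n)).IsAddHaarMeasure :=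
  Measure.prod.instIsAddHaarMeasure (volume : Measure (E n)) (volume : Measure (E n))

/-- The integral of a directional derivative of a Schwartz function vanishes. -/
theorem integral_fderiv_schwartz (S : 𝓢(E n × E n, ℝ)) (v : E n × E n) :
    ∫ z, fderiv ℝ S z v = 0 := by
  open scoped LineDeriv in
  have hd : Integrable fun z => fderiv ℝ S z v := by
    simpa only [SchwartzMap.lineDerivOp_apply_eq_fderiv] using
      (∂_{v} S).integrable (μ := (volume : Measure (E n × E n)))
  have h := integral_mul_fderiv_eq_neg_fderiv_mul_of_integrable (μ := volume)
    (f := fun _ : E n × E n => (1 : ℝ)) (g := S) (v := v) (by simp) (by simpa using hd)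
    (by simpa using S.integrable) (fun _ _ => differentiableAt_const _)
    (fun z _ => S.differentiable z)
  simpa using h

theorem integral_integral_fderiv_schwartz (S : 𝓢(E n × E n, ℝ)) (v : E n × E n) :
    (Integrable fun x : E n => ∫ p : E n, fderiv ℝ S (x, p) v)
      ∧ ∫ x : E n, ∫ p : E n, fderiv ℝ S (x, p) v = 0 := by
  open scoped LineDeriv in
  have hd : Integrable (fun z => fderiv ℝ S z v) ((volume : Measure (E n)).prod volume) := by
    simpa only [SchwartzMap.lineDerivOp_apply_eq_fderiv] using
      (∂_{v} S).integrable (μ := (volume : Measure (E n × E n)))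
  refine ⟨hd.integral_prod_left, ?_⟩
  rw [← integral_fderiv_schwartz S v]
  exact (integral_prod _ hd).symm

theorem integrable_fderiv_schwartz_fibre (S : 𝓢(E n × E n, ℝ)) (v : E n × E n) (x : E n) :
    Integrable fun p : E n => fderiv ℝ S (x, p) v := by
  open scoped LineDeriv in
  have h : RapidOn univ (∂_{v} S : 𝓢(E n × E n, ℝ)) := by
    refine ⟨((∂_{v} S).smooth _).contDiffOn, fun K _ _ j N => ?_⟩
    obtain ⟨C, -, hC⟩ := (∂_{v} S).decay N j
    refine ⟨C, fun x _ p => (mul_le_mul_of_nonneg_right ?_ (norm_nonneg _)).trans (hC (x, p))⟩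
    exact pow_le_pow_left₀ (norm_nonneg _) (norm_snd_le (x, p)) _
  obtain ⟨T, hT⟩ := h.exists_schwartz_fibre isOpen_univ (mem_univ x)
  have := T.integrable (μ := volume)
  have hT' : (T : E n → ℝ) = fun p => fderiv ℝ S (x, p) v := funext fun p => by
    rw [hT, SchwartzMap.lineDerivOp_apply_eq_fderiv]
  rwa [hT'] at this

/-- Liouville's theorem in coordinates: a Poisson bracket is a divergence. -/
theorem integral_coordPoisson {U : Set (E n)} (hU : IsOpen U) {F G : E n × E n → ℝ}
    (hF : TemperedOn U F) (hG : RapidOn U G) {K : Set (E n)} (hK : IsCompact K) (hKU : K ⊆ U)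
    (h0 : ∀ x ∈ U, x ∉ K → ∀ p, G (x, p) = 0) :
    ∫ x in U, ∫ p : E n, coordPoisson F G (x, p) = 0 := by
  have ext : ∀ v : E n × E n, ∃ S : 𝓢(E n × E n, ℝ),
      (∀ x ∈ U, ∀ p, S (x, p) = fderiv ℝ F (x, p) v * G (x, p)) ∧ ∀ x, x ∉ K → ∀ p, S (x, p) = 0 :=
    fun v => ((hF.fderiv_apply hU v).mul_rapidOn hU hG).exists_schwartz_extension hU hK hKU
      fun x hx hxK p => by simp [h0 x hx hxK p]
  choose S hSU hS0 using ext
  have hSd0 : ∀ v w x, x ∉ K → ∀ p, fderiv ℝ (S v) (x, p) w = 0 := by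
    intro v w x hx p
    have : (S v : E n × E n → ℝ) =ᶠ[𝓝 (x, p)] 0 := by
      filter_upwards [(hK.isClosed.isOpen_compl.prod isOpen_univ).mem_nhds
        (⟨hx, mem_univ p⟩ : (x, p) ∈ Kᶜ ×ˢ univ)] with z hz
      exact hS0 v z.1 hz.1 z.2
    rw [this.fderiv_eq]
    simp
  have hSd : ∀ v w x, x ∈ U → ∀ p, fderiv ℝ (S v) (x, p) w
      = fderiv ℝ F (x, p) v * fderiv ℝ G (x, p) w
        + G (x, p) * fderiv ℝ (fderiv ℝ F) (x, p) w v := by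
    intro v w x hx p
    have h1 : (S v : E n × E n → ℝ) =ᶠ[𝓝 (x, p)] fun z => fderiv ℝ F z v * G z := by
      filter_upwards [(hU.prod isOpen_univ).mem_nhds (⟨hx, mem_univ p⟩ : (x, p) ∈ U ×ˢ univ)]
        with z hz using hSU v z.1 hz.1 z.2
    have hF2 : DifferentiableAt ℝ (fderiv ℝ F) (x, p) :=
      ((contDiffAt_of_mem hU hF.1 hx p).fderiv_right (m := ∞) (by simp)).differentiableAt (by simp)
    have hG1 := (contDiffAt_of_mem hU hG.1 hx p).differentiableAt (by simp)
    have h2 : HasFDerivAt (fun z => fderiv ℝ F z v) _ (x, p) :=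
      hF2.hasFDerivAt.clm_apply (hasFDerivAt_const v (x, p))
    have h3 : fderiv ℝ (fun z => fderiv ℝ F z v * G z) (x, p) = _ :=
      (h2.mul hG1.hasFDerivAt).fderiv
    rw [h1.fderiv_eq, h3]
    simp
  -- the integrand is a sum of derivatives of Schwartz functions
  have hdiv : ∀ x, x ∈ U → ∀ p, coordPoisson F G (x, p)
      = ∑ l : Fin n, (fderiv ℝ (S (ev l, 0)) (x, p) (0, ev l)
        - fderiv ℝ (S (0, ev l)) (x, p) (ev l, 0)) := by
    intro x hx p
    have hsym : ∀ v w, fderiv ℝ (fderiv ℝ F) (x, p) v w = fderiv ℝ (fderiv ℝ F) (x, p) w v :=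
      ((contDiffAt_of_mem hU hF.1 hx p).of_le (m := 2)
        (WithTop.coe_le_coe.2 le_top)).isSymmSndFDerivAt (by simp)
    refine Finset.sum_congr rfl fun l _ => ?_
    rw [hSd _ _ x hx, hSd _ _ x hx, hsym (0, ev l)]
    ring
  have hint := fun v w => integral_integral_fderiv_schwartz (S v) w
  have hintp := fun v w x => integrable_fderiv_schwartz_fibre (S v) w x
  calc ∫ x in U, ∫ p : E n, coordPoisson F G (x, p)
      = ∫ x in U, ∑ l : Fin n, ((∫ p : E n, fderiv ℝ (S (ev l, 0)) (x, p) (0, ev l))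
          - ∫ p : E n, fderiv ℝ (S (0, ev l)) (x, p) (ev l, 0)) := by
        refine setIntegral_congr_fun hU.measurableSet fun x hx => ?_
        simp only [hdiv x hx]
        have hi : ∀ l ∈ (Finset.univ : Finset (Fin n)), Integrable fun p : E n =>
            fderiv ℝ (S (ev l, 0)) (x, p) (0, ev l) - fderiv ℝ (S (0, ev l)) (x, p) (ev l, 0) :=
          fun l _ => (hintp _ _ x).sub (hintp _ _ x)
        rw [integral_finsetSum _ hi]
        exact Finset.sum_congr rfl fun l _ => integral_sub (hintp _ _ x) (hintp _ _ x)
    _ = ∫ x, ∑ l : Fin n, ((∫ p : E n, fderiv ℝ (S (ev l, 0)) (x, p) (0, ev l))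
          - ∫ p : E n, fderiv ℝ (S (0, ev l)) (x, p) (ev l, 0)) := by
        refine setIntegral_eq_integral_of_forall_compl_eq_zero fun x hx => ?_
        simp [hSd0 _ _ x fun h => hx (hKU h)]
    _ = 0 := by
        have hi : ∀ l ∈ (Finset.univ : Finset (Fin n)), Integrable fun x : E n =>
            (∫ p : E n, fderiv ℝ (S (ev l, 0)) (x, p) (0, ev l))
              - ∫ p : E n, fderiv ℝ (S (0, ev l)) (x, p) (ev l, 0) :=
          fun l _ => (hint _ _).1.sub (hint _ _).1
        rw [integral_finsetSum _ hi]
        refine Finset.sum_eq_zero fun l _ => ?_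
        rw [integral_sub (hint _ _).1 (hint _ _).1, (hint _ _).2, (hint _ _).2, sub_zero]

theorem RapidOn.continuousOn_integral {U : Set (E n)} (hU : IsOpen U) {G : E n × E n → ℝ}
    (hG : RapidOn U G) : ContinuousOn (fun x => ∫ p : E n, G (x, p)) U := by
  intro x hx
  obtain ⟨K, hKx, hKU, hK⟩ := local_compact_nhds (hU.mem_nhds hx)
  obtain ⟨C, hC0, hC⟩ := hG.one_add_bound hK hKU 0 (n + 1)
  refine (continuousAt_of_dominated (bound := fun p => C * (1 + ‖p‖) ^ (-((n + 1 : ℕ) : ℝ)))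
    ?_ ?_ ((integrable_one_add_norm (by simp)).const_mul C) ?_).continuousWithinAt
  · filter_upwards [hKx] with y hy
    obtain ⟨S, hS⟩ := hG.exists_schwartz_fibre hU (hKU hy)
    simp only [← hS]
    exact S.continuous.aestronglyMeasurable
  · filter_upwards [hKx] with y hy
    refine Eventually.of_forall fun p => ?_
    have h := hC y hy p
    rw [norm_iteratedFDeriv_zero] at h
    have hp : 0 < 1 + ‖p‖ := by positivity
    rw [Real.rpow_neg hp.le, Real.rpow_natCast, ← div_eq_mul_inv, le_div_iff₀ (by positivity),
      mul_comm]
    exact h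
  · refine Eventually.of_forall fun p => ?_
    exact (contDiffAt_of_mem hU hG.1 hx p).continuousAt.comp (f := fun y => (y, p))
      (Continuous.prodMk_left p).continuousAt

end FlatIntegrals

/-! ### The measure of a top form -/

section Measure

variable {n : ℕ} {Q : Type*} [TopologicalSpace Q] [ChartedSpace (E n) Q] [IsManifold (𝓡 n) ∞ Q]

theorem isHomogeneous_zero_of_contMDiff {φ : Q → ℝ}
    (hφ : ContMDiff (𝓡 n) (modelWithCornersSelf ℝ ℝ) ∞ φ) :
    IsHomogeneous (n := n) 0 (fun q _ => φ q) := by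
  refine isHomogeneous_iff.2 ⟨fun c => ?_, fun q t p => by simp⟩
  have h : ContDiffOn ℝ ∞ (φ ∘ (extChartAt (𝓡 n) c).symm) (extChartAt (𝓡 n) c).target :=
    contMDiffOn_iff_contDiffOn.1 (hφ.comp_contMDiffOn (contMDiffOn_extChartAt_symm c))
  exact h.comp contDiffOn_fst fun z hz => hz.1

theorem abs_det_tangentCoordChange_mul {c d q : Q} (hc : q ∈ (extChartAt (𝓡 n) c).source)
    (hd : q ∈ (extChartAt (𝓡 n) d).source) :
    |(tangentCoordChange (𝓡 n) c d q).det| * |(tangentCoordChange (𝓡 n) d c q).det| = 1 := by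
  have h : (tangentCoordChange (𝓡 n) c d q).comp (tangentCoordChange (𝓡 n) d c q)
      = ContinuousLinearMap.id ℝ (E n) := ContinuousLinearMap.ext fun v => by
    rw [ContinuousLinearMap.comp_apply, tangentCoordChange_comp ⟨⟨hd, hc⟩, hd⟩,
      tangentCoordChange_self hd]
    rfl
  have h2 : LinearMap.det ((tangentCoordChange (𝓡 n) c d q : E n →ₗ[ℝ] E n)
      ∘ₗ (tangentCoordChange (𝓡 n) d c q : E n →ₗ[ℝ] E n)) = 1 :=
    (congrArg ContinuousLinearMap.det h).trans LinearMap.det_id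
  rw [LinearMap.det_comp] at h2
  rw [← abs_mul]
  exact (congrArg abs h2).trans abs_one

variable [MeasurableSpace Q]

/-- The density of `dq` in the coordinates of the chart at `c`. -/
noncomputable def TopForm.chartDensity (ν : TopForm n Q) (c : Q) (x : E n) : ℝ :=
  ν.density ((extChartAt (𝓡 n) c).symm x) *
    |(tangentCoordChange (𝓡 n) c ((extChartAt (𝓡 n) c).symm x)
      ((extChartAt (𝓡 n) c).symm x)).det|

theorem TopForm.chartDensity_pos (ν : TopForm n Q) (c : Q) {x : E n}
    (hx : x ∈ (extChartAt (𝓡 n) c).target) : 0 < ν.chartDensity c x := by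
  have h := abs_det_tangentCoordChange_mul ((extChartAt (𝓡 n) c).map_target hx)
    (mem_extChartAt_source (I := 𝓡 n) ((extChartAt (𝓡 n) c).symm x))
  exact mul_pos (ν.density_pos _) (pos_of_mul_pos_left (h ▸ one_pos) (abs_nonneg _))

theorem TopForm.continuousOn_chartDensity (ν : TopForm n Q) (c : Q) :
    ContinuousOn (ν.chartDensity c) (extChartAt (𝓡 n) c).target := (ν.smooth c).continuousOn

variable [BorelSpace Q]

theorem TopForm.measure_source_inter (ν : TopForm n Q) (c : Q) {s : Set Q} (hs : MeasurableSet s) :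
    ν.measure ((extChartAt (𝓡 n) c).source ∩ s)
      = ∫⁻ x in (extChartAt (𝓡 n) c).target ∩ (extChartAt (𝓡 n) c).symm ⁻¹' s,
          ENNReal.ofReal (ν.chartDensity c x) := by
  rw [ν.measure_eq c _ ((isOpen_extChartAt_source c).measurableSet.inter hs) inter_subset_left,
    (extChartAt (𝓡 n) c).image_source_inter_eq']
  rfl

instance TopForm.isLocallyFiniteMeasure (ν : TopForm n Q) : IsLocallyFiniteMeasure ν.measure := by
  refine ⟨fun q => ?_⟩
  set φ := extChartAt (𝓡 n) q with hφ
  obtain ⟨K, hKx, hKU, hK⟩ := local_compact_nhds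
    ((isOpen_extChartAt_target (I := 𝓡 n) q).mem_nhds (mem_extChartAt_target q))
  set s : Set Q := φ.source ∩ φ ⁻¹' interior K with hs
  have hso : IsOpen s := (continuousOn_extChartAt (I := 𝓡 n) q).isOpen_inter_preimage
    (isOpen_extChartAt_source q) isOpen_interior
  refine ⟨s, hso.mem_nhds ⟨mem_extChartAt_source q, mem_interior_iff_mem_nhds.2 hKx⟩, ?_⟩
  have h1 : s = φ.source ∩ s := by rw [hs, ← inter_assoc, inter_self]
  rw [h1, ν.measure_source_inter q hso.measurableSet]
  have h2 : φ.target ∩ φ.symm ⁻¹' s ⊆ K := by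
    rintro x ⟨hx, -, hx'⟩
    rw [mem_preimage, φ.right_inv hx] at hx'
    exact interior_subset hx'
  refine (lintegral_mono_set h2).trans_lt ?_
  exact (((ν.continuousOn_chartDensity q).mono hKU).integrableOn_compact hK).lintegral_lt_top

instance TopForm.isOpenPosMeasure (ν : TopForm n Q) : ν.measure.IsOpenPosMeasure := by
  refine ⟨fun O hO ⟨q, hq⟩ h0 => ?_⟩
  set φ := extChartAt (𝓡 n) q with hφ
  have h1 := ν.measure_source_inter q hO.measurableSet
  rw [measure_mono_null inter_subset_right h0] at h1
  set V := φ.target ∩ φ.symm ⁻¹' O with hV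
  have hVo : IsOpen V := (continuousOn_extChartAt_symm (I := 𝓡 n) q).isOpen_inter_preimage
    (isOpen_extChartAt_target q) hO
  have hmeas : AEMeasurable (fun x => ENNReal.ofReal (ν.chartDensity q x)) (volume.restrict V) :=
    (((ν.continuousOn_chartDensity q).mono inter_subset_left).aemeasurable
      hVo.measurableSet).ennreal_ofReal
  have h2 := (lintegral_eq_zero_iff' hmeas).1 h1.symm
  have h3 : ∀ᵐ x ∂(volume.restrict V), False := by
    filter_upwards [h2, ae_restrict_mem hVo.measurableSet] with x hx hxV
    have := ν.chartDensity_pos q hxV.1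
    simp only [Pi.zero_apply, ENNReal.ofReal_eq_zero] at hx
    linarith
  have h4 : volume V = 0 := by
    rw [ae_iff] at h3
    simpa using h3
  exact hVo.measure_ne_zero volume ⟨φ q, mem_extChartAt_target q, by
    rw [mem_preimage, extChartAt_to_inv]; exact hq⟩ h4

theorem TopForm.integral_eq_chart (ν : TopForm n Q) (c : Q) {g : Q → ℝ}
    (hg : AEStronglyMeasurable g ν.measure) (h0 : ∀ q, q ∉ (extChartAt (𝓡 n) c).source → g q = 0) :
    ∫ q, g q ∂ν.measure = ∫ x in (extChartAt (𝓡 n) c).target,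
      ν.chartDensity c x * g ((extChartAt (𝓡 n) c).symm x) := by
  set φ := extChartAt (𝓡 n) c with hφ
  have hto : IsOpen φ.target := isOpen_extChartAt_target c
  have hso : IsOpen φ.source := isOpen_extChartAt_source c
  set ρ : E n → ENNReal := fun x => ENNReal.ofReal (ν.chartDensity c x)
  have hρ : AEMeasurable ρ (volume.restrict φ.target) :=
    ((ν.continuousOn_chartDensity c).aemeasurable hto.measurableSet).ennreal_ofReal
  have hφm : AEMeasurable φ.symm ((volume.restrict φ.target).withDensity ρ) :=
    ((continuousOn_extChartAt_symm (I := 𝓡 n) c).aemeasurable hto.measurableSet).mono_ac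
      (withDensity_absolutelyContinuous _ _)
  have hmap : ν.measure.restrict φ.source
      = Measure.map φ.symm ((volume.restrict φ.target).withDensity ρ) := by
    ext s hs
    rw [Measure.restrict_apply hs, inter_comm, ν.measure_source_inter c hs,
      Measure.map_apply_of_aemeasurable hφm hs, withDensity_apply',
      Measure.restrict_restrict' hto.measurableSet, inter_comm]
  rw [← setIntegral_eq_integral_of_forall_compl_eq_zero (s := φ.source) fun q hq => h0 q hq, hmap,
    integral_map hφm (by rw [← hmap]; exact hg.restrict),
    integral_withDensity_eq_integral_toReal_smul₀ hρ (by simp [ρ])]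
  refine setIntegral_congr_fun hto.measurableSet fun x hx => ?_
  simp only [ρ, ENNReal.toReal_ofReal (ν.chartDensity_pos c hx).le, smul_eq_mul]

/-! ### The Liouville integral -/

omit [BorelSpace Q] in
/-- The normalised fibre integral does not depend on the chart: the substitution `p ↦ Aᵀ p` changes
the integral and the density of `dq` by the same factor `|det A|`. -/
theorem TopForm.fibreIntegral_eq (ν : TopForm n Q) (c : Q) {x : E n}
    (hx : x ∈ (extChartAt (𝓡 n) c).target) (F : PhaseFn n Q) :
    (ν.density ((extChartAt (𝓡 n) c).symm x))⁻¹ * ∫ p, F ((extChartAt (𝓡 n) c).symm x) p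
      = (ν.chartDensity c x)⁻¹ * ∫ p, inChart c F (x, p) := by
  set q := (extChartAt (𝓡 n) c).symm x with hq
  have hqc : q ∈ (extChartAt (𝓡 n) c).source := (extChartAt (𝓡 n) c).map_target hx
  have hqq := mem_extChartAt_source (I := 𝓡 n) q
  have h := integral_eq_abs_det_mul (L := (tangentCoordChange (𝓡 n) q c q).adjoint)
    (L' := (tangentCoordChange (𝓡 n) c q q).adjoint)
    (adjoint_tangentCoordChange_cancel hqq hqc) (adjoint_tangentCoordChange_cancel hqc hqq) (F q)
  rw [h, det_adjoint, TopForm.chartDensity, ← hq, mul_inv,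
    inv_eq_of_mul_eq_one_right (abs_det_tangentCoordChange_mul hqc hqq)]
  simp only [inChart_eq_self, ← hq]
  ring

omit [BorelSpace Q] in
theorem TopForm.continuous_fibreIntegral (ν : TopForm n Q) {f : PhaseFn n Q}
    (hf : IsAdmissible f) : Continuous fun q => (ν.density q)⁻¹ * ∫ p, f q p := by
  rw [continuous_iff_continuousAt]
  intro c
  set φ := extChartAt (𝓡 n) c with hφ
  have h1 : ContinuousOn (fun x => (ν.chartDensity c x)⁻¹ * ∫ p, inChart c f (x, p)) φ.target :=
    ((ν.continuousOn_chartDensity c).inv₀ fun x hx => (ν.chartDensity_pos c hx).ne').mul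
      ((hf.rapidOn c).continuousOn_integral (isOpen_extChartAt_target c))
  have h2 : ContinuousAt (fun q => (ν.chartDensity c (φ q))⁻¹ * ∫ p, inChart c f (φ q, p)) c :=
    (h1.continuousAt ((isOpen_extChartAt_target c).mem_nhds (mem_extChartAt_target c))).comp
      (f := φ) (continuousAt_extChartAt (I := 𝓡 n) c)
  refine h2.congr ?_
  filter_upwards [(isOpen_extChartAt_source (I := 𝓡 n) c).mem_nhds (mem_extChartAt_source c)]
    with q hq
  rw [← ν.fibreIntegral_eq c (φ.map_source hq), φ.left_inv hq]

variable [T2Space Q]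

omit [BorelSpace Q] in
theorem TopForm.hasCompactSupport_fibreIntegral (ν : TopForm n Q) {f : PhaseFn n Q}
    (hf : IsAdmissible f) : HasCompactSupport fun q => (ν.density q)⁻¹ * ∫ p, f q p := by
  obtain ⟨K, hK, hK0⟩ := hf.2.1
  exact HasCompactSupport.intro hK fun q hq => by simp [hK0 q hq]

theorem TopForm.integrable_fibreIntegral (ν : TopForm n Q) {f : PhaseFn n Q}
    (hf : IsAdmissible f) : Integrable (fun q => (ν.density q)⁻¹ * ∫ p, f q p) ν.measure :=
  (ν.continuous_fibreIntegral hf).integrable_of_hasCompactSupport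
    (ν.hasCompactSupport_fibreIntegral hf)

theorem liouvilleIntegral_add (ν : TopForm n Q) {f g : PhaseFn n Q} (hf : IsAdmissible f)
    (hg : IsAdmissible g) :
    liouvilleIntegral ν (f + g) = liouvilleIntegral ν f + liouvilleIntegral ν g := by
  simp only [liouvilleIntegral]
  rw [← integral_add (ν.integrable_fibreIntegral hf) (ν.integrable_fibreIntegral hg)]
  congr 1
  ext q
  rw [← mul_add, ← integral_add (hf.integrable_fibre q) (hg.integrable_fibre q)]
  rfl

omit [BorelSpace Q] [T2Space Q] in
theorem liouvilleIntegral_smul (ν : TopForm n Q) (a : ℝ) (f : PhaseFn n Q) :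
    liouvilleIntegral ν (a • f) = a * liouvilleIntegral ν f := by
  simp only [liouvilleIntegral, Pi.smul_apply, smul_eq_mul, integral_const_mul, mul_left_comm _ a]

omit [BorelSpace Q] [T2Space Q] in
theorem liouvilleIntegral_neg (ν : TopForm n Q) (f : PhaseFn n Q) :
    liouvilleIntegral ν (-f) = -liouvilleIntegral ν f := by
  simpa using liouvilleIntegral_smul ν (-1) f

omit [BorelSpace Q] [T2Space Q] in
theorem liouvilleIntegral_zero (ν : TopForm n Q) : liouvilleIntegral ν (0 : PhaseFn n Q) = 0 := by
  simp [liouvilleIntegral]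

theorem liouvilleIntegral_sum (ν : TopForm n Q) {ι : Type*} (s : Finset ι) {f : ι → PhaseFn n Q}
    (hf : ∀ i ∈ s, IsAdmissible (f i)) :
    liouvilleIntegral ν (∑ i ∈ s, f i) = ∑ i ∈ s, liouvilleIntegral ν (f i) := by
  classical
  induction s using Finset.induction_on with
  | empty => simp [liouvilleIntegral_zero]
  | insert a s ha ih =>
    rw [Finset.sum_insert ha, Finset.sum_insert ha, liouvilleIntegral_add ν
      (hf a (Finset.mem_insert_self a s))
      (IsAdmissible.sum s fun i hi => hf i (Finset.mem_insert_of_mem hi)),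
      ih fun i hi => hf i (Finset.mem_insert_of_mem hi)]

/-- The Liouville integral of a function supported over a chart is the integral over the
coordinate phase space: the density of `dq` cancels. -/
theorem liouvilleIntegral_eq_chart (ν : TopForm n Q) {f : PhaseFn n Q} (hf : IsAdmissible f)
    (c : Q) (h0 : ∀ q, q ∉ (extChartAt (𝓡 n) c).source → ∀ p, f q p = 0) :
    liouvilleIntegral ν f = ∫ x in (extChartAt (𝓡 n) c).target, ∫ p, inChart c f (x, p) := by
  rw [liouvilleIntegral, ν.integral_eq_chart c (ν.integrable_fibreIntegral hf).1
    fun q hq => by simp [h0 q hq]]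
  refine setIntegral_congr_fun (isOpen_extChartAt_target c).measurableSet fun x hx => ?_
  rw [ν.fibreIntegral_eq c hx, ← mul_assoc, mul_inv_cancel₀ (ν.chartDensity_pos c hx).ne', one_mul]

theorem liouvilleIntegral_poisson_of_chart (ν : TopForm n Q) {k : ℕ} {a b : PhaseFn n Q}
    (ha : IsHomogeneous k a) (hb : IsAdmissible b) (c : Q) {K : Set Q} (hK : IsCompact K)
    (hKc : K ⊆ (extChartAt (𝓡 n) c).source) (h0 : ∀ q, q ∉ K → ∀ p, b q p = 0) :
    liouvilleIntegral ν (poisson a b) = 0 := by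
  have hU := isOpen_extChartAt_target (I := 𝓡 n) c
  rw [liouvilleIntegral_eq_chart ν (ha.poisson_isAdmissible hb) c fun q hq p =>
    poisson_apply_eq_zero a hK.isClosed.isOpen_compl h0 (fun h => hq (hKc h)) p]
  rw [setIntegral_congr_fun (g := fun x => ∫ p, coordPoisson (inChart c a) (inChart c b) (x, p))
    hU.measurableSet fun x hx => by simp only [inChart_poisson ha.1 hb.1 c hx]]
  refine integral_coordPoisson hU (ha.temperedOn c) (hb.rapidOn c)
    (K := extChartAt (𝓡 n) c '' K)
    (hK.image_of_continuousOn ((continuousOn_extChartAt (I := 𝓡 n) c).mono hKc)) ?_ ?_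
  · rintro _ ⟨q, hq, rfl⟩
    exact (extChartAt (𝓡 n) c).map_source (hKc hq)
  · intro x hx hxK p
    refine h0 _ (fun h => hxK ⟨_, h, (extChartAt (𝓡 n) c).right_inv hx⟩) _

variable [SigmaCompactSpace Q]

/-- Liouville's theorem: brackets with admissible functions integrate to zero. A partition of unity
reduces this to functions supported over a chart. -/
theorem liouvilleIntegral_poisson (ν : TopForm n Q) {k : ℕ} {a b : PhaseFn n Q}
    (ha : IsHomogeneous k a) (hb : IsAdmissible b) : liouvilleIntegral ν (poisson a b) = 0 := by
  obtain ⟨K, hK, hK0⟩ := hb.2.1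
  obtain ⟨ρ, hρ⟩ := SmoothPartitionOfUnity.exists_isSubordinate_chartAt_source (𝓡 n) Q
  set R : Q → PhaseFn n Q := fun i q _ => ρ i q with hR
  have hRh : ∀ i, IsHomogeneous 0 (R i) := fun i =>
    isHomogeneous_zero_of_contMDiff (ρ i).contMDiff
  have hfin := ρ.locallyFinite.finite_nonempty_inter_compact hK
  have hsum : b = ∑ i ∈ hfin.toFinset, b * R i := by
    rw [← Finset.mul_sum]
    ext q p
    by_cases hq : q ∈ K
    · have h1 : ∑ i ∈ hfin.toFinset, ρ i q = 1 := by
        rw [← ρ.sum_eq_one (mem_univ q)]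
        refine (finsum_eq_sum_of_support_subset _ fun i hi => ?_).symm
        rw [Finite.coe_toFinset]
        exact ⟨q, hi, hq⟩
      simp [hR, Finset.sum_apply, h1]
    · simp [hK0 q hq]
  have hP : IsAdmissible b ∧ liouvilleIntegral ν (poisson a b) = 0 := by
    rw [hsum]
    refine Finset.sum_induction _
      (fun b : PhaseFn n Q => IsAdmissible b ∧ liouvilleIntegral ν (poisson a b) = 0) ?_ ?_ ?_
    · rintro f g ⟨hf, hf0⟩ ⟨hg, hg0⟩
      refine ⟨hf.add hg, ?_⟩
      rw [poisson_add_right hf.1 hg.1, liouvilleIntegral_add ν (ha.poisson_isAdmissible hf)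
        (ha.poisson_isAdmissible hg), hf0, hg0, add_zero]
    · exact ⟨IsAdmissible.zero, by rw [poisson_zero_right, liouvilleIntegral_zero]⟩
    · intro i _
      have hbi := hb.mul_isHomogeneous (hRh i)
      refine ⟨hbi, liouvilleIntegral_poisson_of_chart ν ha hbi i
        (hK.inter_right (isClosed_tsupport (ρ i))) ?_ fun q hq p => ?_⟩
      · rw [extChartAt_source]
        exact inter_subset_right.trans (hρ i)
      · rw [mem_inter_iff, not_and_or] at hq
        rcases hq with hq | hq
        · simp [hK0 q hq]
        · simp [hR, image_eq_zero_of_notMem_tsupport hq]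
  exact hP.2

/-- The bracket is invariant under the pairing: `⟨{h, f}, g⟩ = ⟨f, {g, h}⟩`. -/
theorem liouvilleIntegral_poisson_mul (ν : TopForm n Q) {i j : ℕ} {f g h : PhaseFn n Q}
    (hf : IsAdmissible f) (hg : IsHomogeneous i g) (hh : IsHomogeneous j h) :
    liouvilleIntegral ν (poisson h f * g) = liouvilleIntegral ν (f * poisson g h) := by
  have h1 := liouvilleIntegral_poisson ν hh (hf.mul_isHomogeneous hg)
  have ha1 : IsAdmissible (poisson h f * g) := (hh.poisson_isAdmissible hf).mul_isHomogeneous hg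
  have ha2 : IsAdmissible (f * poisson h g) := by
    rcases Nat.eq_zero_or_pos (j + i) with h0 | h0
    · obtain ⟨rfl, rfl⟩ : j = 0 ∧ i = 0 := by omega
      rw [poisson_eq_zero_of_isHomogeneous_zero hh hg, mul_zero]
      exact IsAdmissible.zero
    · exact hf.mul_isHomogeneous (hh.poisson hg (k := j + i - 1) (by omega))
  rw [poisson_mul_right hf.1 hg.1, mul_comm g, liouvilleIntegral_add ν ha2 ha1] at h1
  rw [poisson_antisymm g h, mul_neg, liouvilleIntegral_neg]
  linarith

end Measure

/-! ### Schwartz functions with moments of one order -/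

section SchwartzMoments

variable {n : ℕ}

theorem iteratedFDeriv_inner_pow_zero (v : E n) (k j : ℕ) (m : Fin j → E n) :
    iteratedFDeriv ℝ j (fun ξ : E n => (⟪v, ξ⟫_ℝ) ^ k) 0 m
      = if j = k then (k.factorial : ℝ) * ∏ a, ⟪v, m a⟫_ℝ else 0 := by
  have hp : ContDiff ℝ ∞ fun t : ℝ => t ^ k := contDiff_id.pow k
  have h := (innerSL ℝ v).iteratedFDeriv_comp_right hp 0 (i := j) (mod_cast le_top)
  have h1 : (fun ξ : E n => (⟪v, ξ⟫_ℝ) ^ k) = (fun t : ℝ => t ^ k) ∘ innerSL ℝ v := by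
    ext ξ; simp
  rw [h1, h, ContinuousMultilinearMap.compContinuousLinearMap_apply,
    iteratedFDeriv_apply_eq_iteratedDeriv_mul_prod]
  simp only [innerSL_apply_apply, inner_zero_right, smul_eq_mul]
  rw [iteratedDeriv_pow]
  split_ifs with hjk
  · have h2 : k.descFactorial j = k.factorial := by rw [hjk, Nat.descFactorial_self]
    rw [h2, Nat.sub_eq_zero_of_le hjk.ge]; ring
  · rcases lt_or_gt_of_ne hjk with hlt | hgt
    · simp [zero_pow (Nat.sub_ne_zero_of_lt hlt)]
    · simp [Nat.descFactorial_of_lt hgt]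

open scoped FourierTransform in
/-- There is a Schwartz function whose moments of order `k` are those of the point `v`, and whose
other moments vanish: up to a constant it is the real part of the inverse Fourier transform of
`⟪v, ξ⟫ᵏ χ(ξ)`, where `χ` is a bump function that is constant near the origin. -/
theorem exists_schwartz_moments (v : E n) (k : ℕ) : ∃ w : 𝓢(E n, ℝ), ∀ (j : ℕ) (i : Fin j → Fin n),
    ∫ p : E n, (∏ a, p (i a)) * w p = if j = k then ∏ a, v (i a) else 0 := by
  let χ : ContDiffBump (0 : E n) := ⟨1, 2, one_pos, one_lt_two⟩
  set g : E n → ℝ := fun ξ => (⟪v, ξ⟫_ℝ) ^ k * χ ξ with hg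
  have hgs : ContDiff ℝ ∞ g := ((contDiff_const.inner ℝ contDiff_id).pow k).mul χ.contDiff
  have hgc : HasCompactSupport fun ξ => (g ξ : ℂ) :=
    (χ.hasCompactSupport.mul_left (f := fun ξ : E n => (⟪v, ξ⟫_ℝ) ^ k)).comp_left
      Complex.ofReal_zero
  set G : 𝓢(E n, ℂ) := hgc.toSchwartzMap (Complex.ofRealCLM.contDiff.comp hgs) with hG
  have hGapp : (G : E n → ℂ) = fun ξ => (g ξ : ℂ) := rfl
  set W : 𝓢(E n, ℂ) := 𝓕⁻ G with hW
  have hFW : 𝓕 (W : E n → ℂ) = fun ξ => (g ξ : ℂ) := by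
    rw [← SchwartzMap.fourier_coe, hW, FourierTransform.fourier_fourierInv_eq, hGapp]
  have hD : ∀ (j : ℕ) (m : Fin j → E n), iteratedFDeriv ℝ j (𝓕 (W : E n → ℂ)) 0 m
      = ((if j = k then (k.factorial : ℝ) * ∏ a, ⟪v, m a⟫_ℝ else 0 : ℝ) : ℂ) := by
    intro j m
    have h1 : (fun ξ => (g ξ : ℂ)) = Complex.ofRealCLM ∘ g := rfl
    have h2 : g =ᶠ[𝓝 0] fun ξ => (⟪v, ξ⟫_ℝ) ^ k := by
      filter_upwards [χ.eventuallyEq_one] with ξ hξ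
      simp [hg, hξ]
    rw [hFW, h1, Complex.ofRealCLM.iteratedFDeriv_comp_left hgs.contDiffAt (mod_cast le_top),
      ContinuousLinearMap.compContinuousMultilinearMap_coe, Function.comp_apply,
      (h2.iteratedFDeriv ℝ j).eq_of_nhds, iteratedFDeriv_inner_pow_zero]
    rfl
  have hI : ∀ (j : ℕ) (i : Fin j → Fin n), Integrable fun p : E n =>
      ((∏ a, p (i a) : ℝ) : ℂ) * W p := fun j i => by
    have := (SchwartzMap.smulLeftCLM ℂ (fun p : E n => ∏ a, p (i a)) W).integrable (μ := volume)
    rw [SchwartzMap.smulLeftCLM_apply (hasTemperateGrowth_monomial i)] at this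
    simpa only [Complex.real_smul] using this
  -- derivatives of the Fourier transform at the origin are moments
  have hM : ∀ (j : ℕ) (i : Fin j → Fin n),
      (-(2 * Real.pi * Complex.I)) ^ j * ∫ p : E n, ((∏ a, p (i a) : ℝ) : ℂ) * W p
        = ((if j = k then (k.factorial : ℝ) * ∏ a, v (i a) else 0 : ℝ) : ℂ) := by
    intro j i
    have h1 := Real.iteratedFDeriv_fourier (f := (W : E n → ℂ)) (N := ⊤)
      (fun l _ => W.integrable_pow_mul volume l) W.continuous.aestronglyMeasurable (n := j) le_top
    have h2 := hD j fun a => ev (i a)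
    have h3 : Integrable fun p : E n =>
        VectorFourier.fourierPowSMulRight (innerSL ℝ) (W : E n → ℂ) p j :=
      VectorFourier.integrable_fourierPowSMulRight (innerSL ℝ) (W.integrable_pow_mul volume j)
        W.continuous.aestronglyMeasurable
    rw [h1, Real.fourier_eq] at h2
    simp only [inner_zero_right, neg_zero, AddChar.map_zero_eq_one, one_smul] at h2
    rw [ContinuousMultilinearMap.integral_apply h3] at h2
    have hin : ∀ (p : E n) (l : Fin n), innerSL ℝ p (ev l) = p l := fun p l => by
      rw [innerSL_apply_apply, real_inner_comm, inner_ev_left]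
    have hin' : ∀ l : Fin n, ⟪v, ev l⟫_ℝ = v l := fun l => by
      rw [real_inner_comm, inner_ev_left]
    simp only [VectorFourier.fourierPowSMulRight_apply, hin, hin', smul_eq_mul,
      Complex.real_smul] at h2
    rw [← integral_const_mul]
    exact h2
  set c : ℂ := (-(2 * Real.pi * Complex.I)) ^ k / k.factorial with hc
  have hpi : (-(2 * (Real.pi : ℂ) * Complex.I)) ≠ 0 := by
    simp [Real.pi_ne_zero]
  have hk : (k.factorial : ℂ) ≠ 0 := by exact_mod_cast k.factorial_ne_zero
  refine ⟨SchwartzMap.postcompCLM Complex.reCLM (c • W), fun j i => ?_⟩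
  have h4 : ∀ p : E n, (∏ a, p (i a)) * SchwartzMap.postcompCLM Complex.reCLM (c • W) p
      = Complex.reCLM (c * (((∏ a, p (i a) : ℝ) : ℂ) * W p)) := fun p => by
    rw [SchwartzMap.postcompCLM_apply]
    simp only [smul_apply, smul_eq_mul, Complex.reCLM_apply]
    rw [← Complex.re_ofReal_mul]
    congr 1
    ring
  simp only [h4]
  rw [ContinuousLinearMap.integral_comp_comm _ ((hI j i).const_mul c), integral_const_mul]
  have h5 := hM j i
  split_ifs at h5 ⊢ with hjk
  · subst hjk
    have h6 : c * ∫ p : E n, ((∏ a, p (i a) : ℝ) : ℂ) * W p = ((∏ a, v (i a) : ℝ) : ℂ) := by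
      rw [hc, div_mul_eq_mul_div, h5, Complex.ofReal_mul, Complex.ofReal_natCast,
        mul_div_cancel_left₀ _ hk]
    rw [h6]
    rfl
  · rw [Complex.ofReal_zero, mul_eq_zero] at h5
    rw [h5.resolve_left (pow_ne_zero j hpi)]
    simp

/-- If the moments of `w` are those of the point `v` in order `k` and vanish otherwise, then
integration against `w` evaluates homogeneous functions of degree `k` at `v`. -/
theorem integral_homogeneous_mul_of_moments {v : E n} {k : ℕ} {w : 𝓢(E n, ℝ)}
    (hw : ∀ (j : ℕ) (i : Fin j → Fin n),
      ∫ p : E n, (∏ a, p (i a)) * w p = if j = k then ∏ a, v (i a) else 0)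
    {j : ℕ} {f : E n → ℝ} (hf : ContDiff ℝ ∞ f)
    (hh : ∀ (t : ℝ) (p : E n), f (t • p) = t ^ j * f p) :
    ∫ p, f p * w p = if j = k then f v else 0 := by
  obtain ⟨X, hX⟩ := exists_coeff_of_homogeneous hf hh
  have h1 : ∀ p, f p * w p = ∑ i, X i * ((∏ a, p (i a)) * w p) := fun p => by
    rw [hX, Finset.sum_mul]
    exact Finset.sum_congr rfl fun i _ => by ring
  simp only [h1]
  rw [integral_finsetSum _ fun i _ => (integrable_monomial_mul i w).const_mul _]
  simp only [integral_const_mul, hw]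
  split_ifs
  · rw [hX]
  · simp

theorem TemperedOn.mono {U V : Set (E n)} (hVU : V ⊆ U) {G : E n × E n → ℝ}
    (hG : TemperedOn U G) : TemperedOn V G :=
  ⟨hG.1.mono (prod_mono hVU le_rfl), fun K hK hKV => hG.2 K hK (hKV.trans hVU)⟩

/-- A rapidly decreasing function on `V` that vanishes off a relatively closed subset `T` of the
larger set `U` is rapidly decreasing on `U`. -/
theorem RapidOn.extend {U V T : Set (E n)} (hV : IsOpen V) (hUT : IsOpen (U \ T))
    (hTV : U ∩ T ⊆ V) {G : E n × E n → ℝ} (hG : RapidOn V G)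
    (h0 : ∀ x ∈ U, x ∉ T → ∀ p, G (x, p) = 0) : RapidOn U G := by
  have hev : ∀ x ∈ U, x ∉ T → ∀ p, G =ᶠ[𝓝 (x, p)] 0 := fun x hx hxT p => by
    filter_upwards [(hUT.prod isOpen_univ).mem_nhds
      (⟨⟨hx, hxT⟩, mem_univ p⟩ : (x, p) ∈ (U \ T) ×ˢ univ)] with z hz
    exact h0 z.1 hz.1.1 hz.1.2 z.2
  refine ⟨?_, fun K hK hKU j N => ?_⟩
  · rintro ⟨x, p⟩ ⟨hx, -⟩
    by_cases hxT : x ∈ T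
    · exact (contDiffAt_of_mem hV hG.1 (hTV ⟨hx, hxT⟩) p).contDiffWithinAt
    · exact ((contDiffAt_const (c := 0)).congr_of_eventuallyEq (hev x hx hxT p)).contDiffWithinAt
  · have hKT : K ∩ T = K \ (U \ T) := by
      ext x
      simp only [mem_inter_iff, Set.mem_sdiff, not_and, not_not]
      exact ⟨fun h => ⟨h.1, fun _ => h.2⟩, fun h => ⟨h.1, h.2 (hKU h.1)⟩⟩
    obtain ⟨C, hC⟩ := hG.2 (K ∩ T) (hKT ▸ hK.diff hUT)
      (fun x hx => hTV ⟨hKU hx.1, hx.2⟩) j N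
    refine ⟨max C 0, fun x hx p => ?_⟩
    by_cases hxT : x ∈ T
    · exact (hC x ⟨hx, hxT⟩ p).trans (le_max_left _ _)
    · rw [((hev x (hKU hx) hxT p).iteratedFDeriv ℝ j).eq_of_nhds]
      simp

/-- Composition of a Schwartz function with a smooth family of invertible linear maps. A bound for
the inverses makes `‖Bᵀ p‖` large with `‖p‖`; the powers of `‖p‖` that the derivatives of the
family contribute are absorbed by the decay of `w`. -/
theorem rapidOn_schwartz_comp {V : Set (E n)} (hV : IsOpen V) {B B' : E n → E n →L[ℝ] E n}
    (hB : ContDiffOn ℝ ∞ B V) (hB' : ContinuousOn B' V)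
    (hinv : ∀ x ∈ V, ∀ p, (B' x).adjoint ((B x).adjoint p) = p) (w : 𝓢(E n, ℝ)) :
    RapidOn V (fun z : E n × E n => w ((B z.1).adjoint z.2)) := by
  set β : E n × E n → E n := fun z => (B z.1).adjoint z.2 with hβ
  have hβs : ContDiffOn ℝ ∞ β (V ×ˢ univ) := contDiffOn_adjoint_apply hB
  have hβt : TemperedOn V β := TemperedOn.of_homogeneous hV hβs 1 fun x _ t p => by
    simp [hβ]
  refine ⟨w.smooth'.comp_contDiffOn hβs, fun K hK hKV j N => ?_⟩
  choose A L hA using hβt.2 K hK hKV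
  obtain ⟨R, hR⟩ := hK.exists_bound_of_continuousOn (hB'.mono hKV)
  set M : ℝ := 1 + ∑ i ∈ Finset.range (j + 1), |A i| with hM
  set e : ℕ := ∑ i ∈ Finset.range (j + 1), L i with he
  set d : ℕ := N + e * j with hd
  set C : ℝ := 2 ^ d * (Finset.Iic ((d, j) : ℕ × ℕ)).sup
    (fun m => SchwartzMap.seminorm ℝ m.1 m.2) w with hC
  refine ⟨j.factorial * C * M ^ j * (1 + |R|) ^ d, fun x hx p => ?_⟩
  have ho := hV.prod (isOpen_univ (X := E n))
  have hz : (x, p) ∈ V ×ˢ (univ : Set (E n)) := ⟨hKV hx, mem_univ _⟩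
  have hp0 := norm_nonneg p
  have hy0 := norm_nonneg (β (x, p))
  have hM1 : 1 ≤ M := le_add_of_nonneg_right (Finset.sum_nonneg fun i _ => abs_nonneg _)
  have hone : 1 ≤ M * (1 + ‖p‖) ^ e :=
    one_le_mul_of_one_le_of_one_le hM1 (one_le_pow₀ (by linarith))
  have hDβ : ∀ i, 1 ≤ i → i ≤ j →
      ‖iteratedFDerivWithin ℝ i β (V ×ˢ univ) (x, p)‖ ≤ (M * (1 + ‖p‖) ^ e) ^ i := by
    intro i hi hij
    have hmem : i ∈ Finset.range (j + 1) := Finset.mem_range.2 (by omega)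
    rw [iteratedFDerivWithin_of_isOpen i ho hz]
    refine le_trans ?_ (le_self_pow₀ hone (by omega))
    refine (hA i x hx p).trans (mul_le_mul ?_ ?_ (by positivity) (by positivity))
    · have := Finset.single_le_sum (f := fun i => |A i|) (fun i _ => abs_nonneg _) hmem
      have h2 := le_abs_self (A i)
      linarith
    · exact pow_le_pow_right₀ (by linarith)
        (Finset.single_le_sum (f := L) (fun i _ => Nat.zero_le _) hmem)
  have hw : ∀ i ≤ j, ‖iteratedFDerivWithin ℝ i w univ (β (x, p))‖
      ≤ C / (1 + ‖β (x, p)‖) ^ d := by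
    intro i hij
    rw [iteratedFDerivWithin_univ, le_div_iff₀ (by positivity), mul_comm]
    exact SchwartzMap.one_add_le_sup_seminorm_apply (𝕜 := ℝ) (m := (d, j)) le_rfl hij w _
  have hmain := norm_iteratedFDerivWithin_comp_le (w.smooth' : ContDiff ℝ ∞ w).contDiffOn hβs
    (n := j) (mod_cast le_top) uniqueDiffOn_univ ho.uniqueDiffOn (mapsTo_univ _ _) hz hw hDβ
  rw [iteratedFDerivWithin_of_isOpen j ho hz] at hmain
  have hratio : 1 + ‖p‖ ≤ (1 + |R|) * (1 + ‖β (x, p)‖) := by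
    have h1 : ‖p‖ ≤ |R| * ‖β (x, p)‖ := by
      calc ‖p‖ = ‖(B' x).adjoint (β (x, p))‖ := by rw [hβ]; simp only [hinv x (hKV hx) p]
        _ ≤ ‖(B' x).adjoint‖ * ‖β (x, p)‖ := ContinuousLinearMap.le_opNorm _ _
        _ ≤ |R| * ‖β (x, p)‖ := by
          rw [LinearIsometryEquiv.norm_map]
          gcongr
          exact (hR x hx).trans (le_abs_self R)
    have := abs_nonneg R
    nlinarith
  have hC0 : 0 ≤ C := by positivity
  have hy : 0 < (1 + ‖β (x, p)‖) ^ d := by positivity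
  calc ‖p‖ ^ N * ‖iteratedFDeriv ℝ j (w ∘ β) (x, p)‖
      ≤ (1 + ‖p‖) ^ N * (j.factorial * (C / (1 + ‖β (x, p)‖) ^ d)
          * (M * (1 + ‖p‖) ^ e) ^ j) := by
        gcongr
        · linarith
        · exact hmain
    _ = j.factorial * C * M ^ j * ((1 + ‖p‖) ^ d / (1 + ‖β (x, p)‖) ^ d) := by
        rw [mul_pow, ← pow_mul, hd, pow_add]
        ring
    _ ≤ j.factorial * C * M ^ j * (1 + |R|) ^ d := by
        gcongr
        rw [div_le_iff₀ hy, ← mul_pow]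
        gcongr

end SchwartzMoments

/-! ### Test functions on the cotangent bundle -/

section TestFunctions

variable {n : ℕ} {Q : Type*} [TopologicalSpace Q] [ChartedSpace (E n) Q] [IsManifold (𝓡 n) ∞ Q]

/-- The function `ψ(q) w(p)` on `T*Q`, where `p` are the components of the covector for the chart
at `c` and `ψ` is supported in the domain of this chart. -/
noncomputable def testFn (c : Q) (ψ : Q → ℝ) (w : 𝓢(E n, ℝ)) : PhaseFn n Q := fun q p =>
  ψ q * w ((tangentCoordChange (𝓡 n) c q q).adjoint p)

theorem inChart_testFn {c d : Q} {x : E n} (hx : x ∈ overlap d c) (ψ : Q → ℝ) (w : 𝓢(E n, ℝ))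
    (p : E n) : inChart d (testFn c ψ w) (x, p) = ψ ((extChartAt (𝓡 n) d).symm x)
      * w ((tangentCoordChange (𝓡 n) c d ((extChartAt (𝓡 n) d).symm x)).adjoint p) := by
  set q := (extChartAt (𝓡 n) d).symm x with hq
  have hqd : q ∈ (extChartAt (𝓡 n) d).source := (extChartAt (𝓡 n) d).map_target hx.1
  simp only [inChart, testFn, ← hq]
  congr 2
  rw [← ContinuousLinearMap.comp_apply, ← ContinuousLinearMap.adjoint_comp]
  congr 2
  ext1 v
  rw [ContinuousLinearMap.comp_apply]
  exact tangentCoordChange_comp ⟨⟨hx.2, mem_extChartAt_source q⟩, hqd⟩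

theorem isAdmissible_testFn {c : Q} {ψ : Q → ℝ}
    (hψ : ContMDiff (𝓡 n) (modelWithCornersSelf ℝ ℝ) ∞ ψ) (hc : HasCompactSupport ψ)
    (hs : tsupport ψ ⊆ (extChartAt (𝓡 n) c).source) (w : 𝓢(E n, ℝ)) :
    IsAdmissible (testFn c ψ w) := by
  refine isAdmissible_iff.2 ⟨⟨tsupport ψ, hc, fun q hq p => ?_⟩, fun d => ?_⟩
  · rw [testFn, image_eq_zero_of_notMem_tsupport hq, zero_mul]
  have hV := isOpen_overlap (n := n) d c
  have h1 : RapidOn (overlap d c) (fun z : E n × E n =>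
      w ((tangentCoordChange (𝓡 n) c d ((extChartAt (𝓡 n) d).symm z.1)).adjoint z.2)) :=
    rapidOn_schwartz_comp hV (contDiffOn_tangentCoordChange d c)
      (B' := fun x => tangentCoordChange (𝓡 n) d c ((extChartAt (𝓡 n) d).symm x))
      ((continuousOn_tangentCoordChange d c).comp (continuousOn_extChartAt_symm d |>.mono
        inter_subset_left) fun x hx => ⟨(extChartAt (𝓡 n) d).map_target hx.1, hx.2⟩)
      (fun x hx => adjoint_tangentCoordChange_cancel hx.2 ((extChartAt (𝓡 n) d).map_target hx.1)) w
  have h2 := ((isHomogeneous_zero_of_contMDiff hψ).temperedOn d).mono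
    (inter_subset_left : overlap d c ⊆ _)
  refine ((h2.mul_rapidOn hV h1).congr hV fun x hx p => inChart_testFn hx ψ w p).extend
    (T := (extChartAt (𝓡 n) d).symm ⁻¹' tsupport ψ) hV ?_ (fun x hx => ⟨hx.1, hs hx.2⟩)
    fun x _ hxT p => ?_
  · exact (continuousOn_extChartAt_symm (I := 𝓡 n) d).isOpen_inter_preimage
      (isOpen_extChartAt_target d) (isClosed_tsupport ψ).isOpen_compl
  · simp only [inChart, testFn]
    rw [image_eq_zero_of_notMem_tsupport hxT, zero_mul]

theorem integral_testFn_mul {c : Q} {ψ : Q → ℝ} (hs : tsupport ψ ⊆ (extChartAt (𝓡 n) c).source)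
    {v : E n} {k : ℕ} {w : 𝓢(E n, ℝ)} (hw : ∀ (j : ℕ) (i : Fin j → Fin n),
      ∫ p : E n, (∏ a, p (i a)) * w p = if j = k then ∏ a, v (i a) else 0)
    {j : ℕ} {f : E n → ℝ} (hf : ContDiff ℝ ∞ f)
    (hh : ∀ (t : ℝ) (p : E n), f (t • p) = t ^ j * f p) (q : Q) :
    ∫ p, testFn c ψ w q p * f p = if j = k then ψ q * (|(tangentCoordChange (𝓡 n) q c q).det|
      * f ((tangentCoordChange (𝓡 n) q c q).adjoint v)) else 0 := by
  by_cases hq : q ∈ (extChartAt (𝓡 n) c).source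
  · have hqq := mem_extChartAt_source (I := 𝓡 n) q
    set L := (tangentCoordChange (𝓡 n) q c q).adjoint with hL
    have hLL := adjoint_tangentCoordChange_cancel (n := n) hqq hq
    rw [integral_eq_abs_det_mul (L := L) (L' := (tangentCoordChange (𝓡 n) c q q).adjoint)
      hLL (adjoint_tangentCoordChange_cancel hq hqq)]
    have h1 : ∀ p, testFn c ψ w q (L p) * f (L p) = ψ q * (f (L p) * w p) := fun p => by
      rw [testFn, hLL]; ring
    simp only [h1]
    rw [integral_const_mul, integral_homogeneous_mul_of_moments hw (f := fun p => f (L p))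
      (hf.comp L.contDiff) (fun t p => by rw [map_smul, hh]), hL, det_adjoint]
    split_ifs
    · ring
    · ring
  · have h0 : ψ q = 0 := image_eq_zero_of_notMem_tsupport fun h => hq (hs h)
    simp [testFn, h0]

theorem testFn_mem_degDual {c : Q} {ψ : Q → ℝ}
    (hψ : ContMDiff (𝓡 n) (modelWithCornersSelf ℝ ℝ) ∞ ψ) (hc : HasCompactSupport ψ)
    (hs : tsupport ψ ⊆ (extChartAt (𝓡 n) c).source) {v : E n} {k : ℕ} {w : 𝓢(E n, ℝ)}
    (hw : ∀ (j : ℕ) (i : Fin j → Fin n),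
      ∫ p : E n, (∏ a, p (i a)) * w p = if j = k then ∏ a, v (i a) else 0) :
    testFn c ψ w ∈ degDual n Q k := by
  refine ⟨isAdmissible_testFn hψ hc hs w, fun j hj i q => ?_⟩
  have h := integral_testFn_mul hs hw (f := fun p => ∏ a, p (i a)) (j := j)
    (contDiff_prod fun a _ => contDiff_euclidean.1 contDiff_id (i a))
    (fun t p => by simp [Finset.prod_mul_distrib]) q
  rw [if_neg hj] at h
  rw [moment, ← h]
  exact integral_congr_ae (Eventually.of_forall fun p => mul_comm _ _)

variable [T2Space Q] [MeasurableSpace Q] [BorelSpace Q]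

/-- A test function concentrated near `c`, with fibre moments those of the covector `v` in order
`k`, detects a positive value of a homogeneous function of degree `k` at `(c, v)`. -/
theorem exists_degDual_liouvilleIntegral_pos (ν : TopForm n Q) {k : ℕ} {F : PhaseFn n Q}
    (hF : IsHomogeneous k F) {c : Q} {v : E n} (h : 0 < F c v) :
    ∃ u ∈ degDual n Q k, 0 < liouvilleIntegral ν (u * F) := by
  obtain ⟨w, hw⟩ := exists_schwartz_moments v k
  have hO : ∀ᶠ q in 𝓝 c, 0 < inChart c F (extChartAt (𝓡 n) c q, v) := by
    have h1 : ContinuousAt (inChart c F) (extChartAt (𝓡 n) c c, v) :=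
      (hF.1.contDiffAt (mem_extChartAt_target c) v).continuousAt
    have h2 : ContinuousAt (fun q => inChart c F (extChartAt (𝓡 n) c q, v)) c :=
      ContinuousAt.comp (f := fun q => (extChartAt (𝓡 n) c q, v)) h1
        ((continuousAt_extChartAt c).prodMk continuousAt_const)
    refine h2.eventually (lt_mem_nhds ?_)
    simpa only [inChart_self] using h
  obtain ⟨ψ, -, hψ⟩ := (SmoothBumpFunction.nhds_basis_tsupport (I := 𝓡 n) c).mem_iff.1 hO
  have hs := ψ.tsupport_subset_extChartAt_source
  have hu := testFn_mem_degDual ψ.contMDiff ψ.hasCompactSupport hs hw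
  refine ⟨testFn c ψ w, hu, ?_⟩
  have hadm := hu.1.mul_isHomogeneous hF
  have hval : ∀ q, ∫ p, (testFn c ψ w * F) q p
      = ψ q * (|(tangentCoordChange (𝓡 n) q c q).det|
        * F q ((tangentCoordChange (𝓡 n) q c q).adjoint v)) := fun q => by
    have := integral_testFn_mul hs hw (hF.1.contDiff_fibre q) ((isHomogeneous_iff.1 hF).2 q) q
    rwa [if_pos rfl] at this
  have hpos : ∀ q ∈ tsupport ψ, 0 < F q ((tangentCoordChange (𝓡 n) q c q).adjoint v) := by
    intro q hq
    have h3 : 0 < inChart c F (extChartAt (𝓡 n) c q, v) := hψ hq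
    rwa [inChart_eq_self, (extChartAt (𝓡 n) c).left_inv (hs hq)] at h3
  refine (ν.continuous_fibreIntegral hadm).integral_pos_of_hasCompactSupport_nonneg_nonzero (x := c)
    (ν.hasCompactSupport_fibreIntegral hadm) (fun q => ?_) ?_
  · simp only [hval, Pi.zero_apply]
    by_cases hq : q ∈ tsupport ψ
    · exact mul_nonneg (inv_nonneg.2 (ν.density_pos q).le)
        (mul_nonneg ψ.nonneg (mul_nonneg (abs_nonneg _) (hpos q hq).le))
    · rw [image_eq_zero_of_notMem_tsupport hq, zero_mul, mul_zero]
  · have hc := mem_extChartAt_source (I := 𝓡 n) c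
    have hdet : |(tangentCoordChange (𝓡 n) c c c).det| ≠ 0 := fun h0 => by
      have := abs_det_tangentCoordChange_mul hc hc
      rw [h0, zero_mul] at this
      exact zero_ne_one this
    simp only [hval]
    rw [ψ.eq_one, one_mul]
    exact mul_ne_zero (inv_ne_zero (ν.density_pos c).ne')
      (mul_ne_zero hdet (hpos c (subset_tsupport _ ψ.c_mem_support)).ne')

/-- The functions with moments of order `k` only separate the homogeneous functions of
degree `k`. -/
theorem IsHomogeneous.eq_zero_of_liouvilleIntegral_eq_zero (ν : TopForm n Q) {k : ℕ}
    {F : PhaseFn n Q} (hF : IsHomogeneous k F)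
    (h : ∀ u ∈ degDual n Q k, liouvilleIntegral ν (u * F) = 0) : F = 0 := by
  ext c v
  rcases lt_trichotomy (F c v) 0 with hlt | heq | hgt
  · obtain ⟨u, hu, hpos⟩ := exists_degDual_liouvilleIntegral_pos ν hF.neg (c := c) (v := v)
      (by simpa using hlt)
    rw [mul_neg, liouvilleIntegral_neg, h u hu] at hpos
    simp at hpos
  · exact heq
  · obtain ⟨u, hu, hpos⟩ := exists_degDual_liouvilleIntegral_pos ν hF hgt
    rw [h u hu] at hpos
    exact absurd hpos (lt_irrefl 0)

end TestFunctions

/-! ### Formal series and their Lie bracket -/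

section Series

variable {n : ℕ} {Q : Type*}

theorem sPart_add_nPart (h : FormalFn n Q) : sPart h + nPart h = h := by
  ext k q p
  by_cases hk : k < 2 <;> simp [sPart, nPart, hk]

variable [TopologicalSpace Q] [ChartedSpace (E n) Q] [IsManifold (𝓡 n) ∞ Q]

theorem F₀_add {g h : FormalFn n Q} (hg : g ∈ F₀ n Q) (hh : h ∈ F₀ n Q) : g + h ∈ F₀ n Q :=
  fun k => (hg k).add (hh k)

theorem ofDegree_mem_degHat {k : ℕ} {F : PhaseFn n Q} (hF : IsHomogeneous k F) :
    ofDegree k F ∈ degHat n Q k := by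
  refine ⟨fun j => ?_, fun j hj => if_neg hj⟩
  by_cases hj : j = k
  · subst hj
    simpa [ofDegree] using hF
  · simpa [ofDegree, hj] using IsHomogeneous.zero j

theorem degPart_mem_degHat {h : FormalFn n Q} (hh : h ∈ F₀ n Q) (k : ℕ) :
    degPart k h ∈ degHat n Q k := ofDegree_mem_degHat (hh k)

theorem sPart_mem_sHat {h : FormalFn n Q} (hh : h ∈ F₀ n Q) : sPart h ∈ sHat n Q := by
  refine ⟨fun k => ?_, fun k hk => if_neg (by omega)⟩
  by_cases hk : k < 2
  · simpa [sPart, hk] using hh k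
  · simpa [sPart, hk] using IsHomogeneous.zero k

theorem nPart_mem_nHat {h : FormalFn n Q} (hh : h ∈ F₀ n Q) : nPart h ∈ nHat n Q := by
  refine ⟨fun k => ?_, fun k hk => if_pos hk⟩
  by_cases hk : k < 2
  · simpa [nPart, hk] using IsHomogeneous.zero k
  · simpa [nPart, hk] using hh k

theorem lie_mem_F₀ {g h : FormalFn n Q} (hg : g ∈ F₀ n Q) (hh : h ∈ F₀ n Q) :
    lie g h ∈ F₀ n Q := fun k =>
  (IsHomogeneous.sum _ fun i hi => (hg i).poisson (hh (k + 1 - i))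
    (by have := Finset.mem_range.1 hi; omega)).neg

theorem lie_add_right {g h h' : FormalFn n Q} (hh : h ∈ F₀ n Q) (hh' : h' ∈ F₀ n Q) :
    lie g (h + h') = lie g h + lie g h' := by
  funext k
  simp only [lie, Pi.add_apply, poisson_add_right (hh _).1 (hh' _).1, Finset.sum_add_distrib,
    neg_add]

theorem lie_antisymm (g h : FormalFn n Q) : lie g h = -lie h g := by
  funext k
  simp only [lie, Pi.neg_apply, neg_neg]
  rw [← Finset.sum_range_reflect, ← Finset.sum_neg_distrib]
  refine Finset.sum_congr rfl fun i hi => ?_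
  have := Finset.mem_range.1 hi
  rw [poisson_antisymm, neg_neg, show k + 1 - (k + 2 - 1 - i) = i by omega,
    show k + 2 - 1 - i = k + 1 - i by omega]

theorem lie_add_left {g g' h : FormalFn n Q} (hg : g ∈ F₀ n Q) (hg' : g' ∈ F₀ n Q) :
    lie (g + g') h = lie g h + lie g' h := by
  rw [lie_antisymm, lie_add_right hg hg', neg_add, ← lie_antisymm, ← lie_antisymm]

theorem lie_degPart_right (g h : FormalFn n Q) {m k : ℕ} (hm : m ≤ k + 1) :
    lie g (degPart m h) k = -poisson (g (k + 1 - m)) (h m) := by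
  rw [lie, Finset.sum_eq_single (k + 1 - m)]
  · simp [degPart, ofDegree, Nat.sub_sub_self hm]
  · intro i hi him
    have := Finset.mem_range.1 hi
    rw [degPart, ofDegree, if_neg (by omega), poisson_zero_right]
  · intro h
    exact absurd (Finset.mem_range.2 (by omega)) h

/-- Only the last two terms of the sum meet a non-zero term of `sPart g`. -/
theorem lie_sPart_right (X g : FormalFn n Q) (k : ℕ) :
    lie X (sPart g) k = -(poisson (X k) (g 1) + poisson (X (k + 1)) (g 0)) := by
  rw [lie, Finset.sum_range_succ, Finset.sum_range_succ, Finset.sum_eq_zero, zero_add]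
  · simp [sPart]
  · intro i hi
    have := Finset.mem_range.1 hi
    rw [sPart, if_neg (by omega), poisson_zero_right]

theorem degDual_subset_sDual {k : ℕ} (hk : k < 2) : degDual n Q k ⊆ sDual n Q := fun _ hu =>
  ⟨hu.1, fun j hj => hu.2 j (by omega)⟩

theorem degDual_subset_nDual {k : ℕ} (hk : 2 ≤ k) : degDual n Q k ⊆ nDual n Q := fun _ hu =>
  ⟨mem_F₀Dual_of_degDual hu, fun j hj => hu.2 j (by omega)⟩

end Series

/-! ### The pairing -/

section Pairing

variable {n : ℕ} {Q : Type*} [TopologicalSpace Q] [ChartedSpace (E n) Q] [IsManifold (𝓡 n) ∞ Q]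
  [MeasurableSpace Q]

theorem pair_smul_left (ν : TopForm n Q) (a : ℝ) (f : PhaseFn n Q) (h : FormalFn n Q) :
    pair ν (a • f) h = a * pair ν f h := by
  rw [pair, pair, ← smul_eq_mul, smul_finsum]
  refine finsum_congr fun k => ?_
  rw [smul_mul_assoc, liouvilleIntegral_smul, smul_eq_mul]

theorem pair_neg_right (ν : TopForm n Q) (f : PhaseFn n Q) (h : FormalFn n Q) :
    pair ν f (-h) = -pair ν f h := by
  rw [pair, pair, ← finsum_neg_distrib]
  refine finsum_congr fun k => ?_
  rw [Pi.neg_apply, mul_neg, liouvilleIntegral_neg]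

theorem pair_zero_right (ν : TopForm n Q) (f : PhaseFn n Q) :
    pair ν f (0 : FormalFn n Q) = 0 := by
  rw [pair]
  simp only [Pi.zero_apply, mul_zero, liouvilleIntegral_zero, finsum_zero]

theorem MomentVanishes.liouvilleIntegral_mul_eq_zero {f F : PhaseFn n Q} {k : ℕ}
    (h : MomentVanishes k f) (hf : IsAdmissible f) (hF : IsHomogeneous k F) (ν : TopForm n Q) :
    liouvilleIntegral ν (f * F) = 0 := by
  simp only [liouvilleIntegral, h.integral_mul_eq_zero hf hF, mul_zero, integral_zero]

theorem pair_eq_sum (ν : TopForm n Q) {f : PhaseFn n Q} (hf : IsAdmissible f) {N : ℕ}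
    (hN : ∀ k, N ≤ k → MomentVanishes k f) {h : FormalFn n Q} (hh : h ∈ F₀ n Q) :
    pair ν f h = ∑ k ∈ Finset.range N, liouvilleIntegral ν (f * h k) := by
  refine finsum_eq_sum_of_support_subset _ fun k hk => ?_
  by_contra hkN
  rw [Finset.coe_range, mem_Iio, not_lt] at hkN
  exact hk ((hN k hkN).liouvilleIntegral_mul_eq_zero hf (hh k) ν)

theorem finite_support_pair (ν : TopForm n Q) {f : PhaseFn n Q} (hf : f ∈ F₀Dual n Q)
    {h : FormalFn n Q} (hh : h ∈ F₀ n Q) :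
    (Function.support fun k => liouvilleIntegral ν (f * h k)).Finite := by
  obtain ⟨N, hN⟩ := hf.2
  refine (finite_Iio N).subset fun k hk => ?_
  by_contra hkN
  exact hk ((hN k (not_lt.1 hkN)).liouvilleIntegral_mul_eq_zero hf.1 (hh k) ν)

theorem pair_eq_of_degDual (ν : TopForm n Q) {k : ℕ} {u : PhaseFn n Q} (hu : u ∈ degDual n Q k)
    {h : FormalFn n Q} (hh : h ∈ F₀ n Q) : pair ν u h = liouvilleIntegral ν (u * h k) :=
  finsum_eq_single _ k fun j hj => (hu.2 j hj).liouvilleIntegral_mul_eq_zero hu.1 (hh j) ν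

theorem pair_congr_of_nDual (ν : TopForm n Q) {fn : PhaseFn n Q} (hfn : fn ∈ nDual n Q)
    {g h : FormalFn n Q} (hg : g ∈ F₀ n Q) (hh : h ∈ F₀ n Q) (hgh : ∀ k, 2 ≤ k → g k = h k) :
    pair ν fn g = pair ν fn h := by
  refine finsum_congr fun k => ?_
  by_cases hk : k < 2
  · rw [(hfn.2 k hk).liouvilleIntegral_mul_eq_zero hfn.1.1 (hg k),
      (hfn.2 k hk).liouvilleIntegral_mul_eq_zero hfn.1.1 (hh k)]
  · rw [hgh k (not_lt.1 hk)]

theorem pair_eq_of_sDual (ν : TopForm n Q) {fs : PhaseFn n Q} (hfs : fs ∈ sDual n Q)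
    {h : FormalFn n Q} (hh : h ∈ F₀ n Q) :
    pair ν fs h = liouvilleIntegral ν (fs * h 0) + liouvilleIntegral ν (fs * h 1) := by
  rw [pair_eq_sum ν hfs.1 hfs.2 hh, Finset.sum_range_succ, Finset.sum_range_one]

theorem pair_congr_of_sDual (ν : TopForm n Q) {fs : PhaseFn n Q} (hfs : fs ∈ sDual n Q)
    {g h : FormalFn n Q} (hg : g ∈ F₀ n Q) (hh : h ∈ F₀ n Q) (h0 : g 0 = h 0) (h1 : g 1 = h 1) :
    pair ν fs g = pair ν fs h := by
  rw [pair_eq_of_sDual ν hfs hg, pair_eq_of_sDual ν hfs hh, h0, h1]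

theorem pair_sPart_of_sDual (ν : TopForm n Q) {fs : PhaseFn n Q} (hfs : fs ∈ sDual n Q)
    {g : FormalFn n Q} (hg : g ∈ F₀ n Q) : pair ν fs (sPart g) = pair ν fs g :=
  pair_congr_of_sDual ν hfs (sPart_mem_sHat hg).1 hg rfl rfl

theorem pair_nPart_of_nDual (ν : TopForm n Q) {fn : PhaseFn n Q} (hfn : fn ∈ nDual n Q)
    {g : FormalFn n Q} (hg : g ∈ F₀ n Q) : pair ν fn (nPart g) = pair ν fn g :=
  pair_congr_of_nDual ν hfn (nPart_mem_nHat hg).1 hg fun _ hk => if_neg (by omega)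

theorem pair_eq_zero_of_sDual (ν : TopForm n Q) {fs : PhaseFn n Q} (hfs : fs ∈ sDual n Q)
    {g : FormalFn n Q} (hg : g ∈ F₀ n Q) (h0 : g 0 = 0) (h1 : g 1 = 0) : pair ν fs g = 0 := by
  rw [pair_eq_of_sDual ν hfs hg, h0, h1, mul_zero, liouvilleIntegral_zero, add_zero]

theorem pair_eq_zero_of_nDual (ν : TopForm n Q) {fn : PhaseFn n Q} (hfn : fn ∈ nDual n Q)
    {g : FormalFn n Q} (hg : g ∈ F₀ n Q) (h0 : ∀ k, 2 ≤ k → g k = 0) : pair ν fn g = 0 := by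
  rw [pair_congr_of_nDual ν hfn hg (fun k => IsHomogeneous.zero k) h0]
  exact pair_zero_right ν fn

/-- A projection of the full functional derivative is the only partial derivative, if it has the
same pairings with the directions that are allowed and these separate the candidates. -/
theorem hasVariation_iff_eq {ν : TopForm n Q} {S : Set (PhaseFn n Q)} {V : Set (FormalFn n Q)}
    {H : PhaseFn n Q → ℝ} {f : PhaseFn n Q} {h D₀ : FormalFn n Q}
    (hH : HasVariation ν (F₀Dual n Q) (F₀ n Q) H f h) (hS : S ⊆ F₀Dual n Q) (hD₀ : D₀ ∈ V)
    (hpair : ∀ u ∈ S, pair ν u D₀ = pair ν u h)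
    (hsep : ∀ D ∈ V, (∀ u ∈ S, pair ν u D = pair ν u D₀) → D = D₀) (D : FormalFn n Q) :
    HasVariation ν S V H f D ↔ D = D₀ := by
  constructor
  · intro hD
    refine hsep D hD.1 fun u hu => ?_
    rw [hpair u hu]
    exact (hD.2 u hu).unique (hH.2 u (hS hu))
  · rintro rfl
    exact ⟨hD₀, fun u hu => by rw [hpair u hu]; exact hH.2 u (hS hu)⟩

variable [T2Space Q] [BorelSpace Q]

theorem pair_add_left (ν : TopForm n Q) {f f' : PhaseFn n Q} (hf : f ∈ F₀Dual n Q)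
    (hf' : f' ∈ F₀Dual n Q) {h : FormalFn n Q} (hh : h ∈ F₀ n Q) :
    pair ν (f + f') h = pair ν f h + pair ν f' h := by
  rw [pair, pair, pair, ← finsum_add_distrib (finite_support_pair ν hf hh)
    (finite_support_pair ν hf' hh)]
  refine finsum_congr fun k => ?_
  rw [add_mul, liouvilleIntegral_add ν (hf.1.mul_isHomogeneous (hh k))
    (hf'.1.mul_isHomogeneous (hh k))]

theorem pair_add_right (ν : TopForm n Q) {f : PhaseFn n Q} (hf : f ∈ F₀Dual n Q)
    {g h : FormalFn n Q} (hg : g ∈ F₀ n Q) (hh : h ∈ F₀ n Q) :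
    pair ν f (g + h) = pair ν f g + pair ν f h := by
  rw [pair, pair, pair, ← finsum_add_distrib (finite_support_pair ν hf hg)
    (finite_support_pair ν hf hh)]
  refine finsum_congr fun k => ?_
  rw [Pi.add_apply, mul_add, liouvilleIntegral_add ν (hf.1.mul_isHomogeneous (hg k))
    (hf.1.mul_isHomogeneous (hh k))]

/-- Testing `f_𝔰 + f_𝔫` with the `ŝ`-part of a series sees `f_𝔰` only. -/
theorem pair_add_sPart (ν : TopForm n Q) {fs fn : PhaseFn n Q} (hfs : fs ∈ sDual n Q)
    (hfn : fn ∈ nDual n Q) {g : FormalFn n Q} (hg : g ∈ F₀ n Q) :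
    pair ν (fs + fn) (sPart g) = pair ν fs g := by
  have hsg := sPart_mem_sHat hg
  rw [pair_add_left ν (mem_F₀Dual_of_sDual hfs) hfn.1 hsg.1, pair_sPart_of_sDual ν hfs hg,
    pair_eq_zero_of_nDual ν hfn hsg.1 hsg.2, add_zero]

/-- Testing `f_𝔰 + f_𝔫` with the `n̂`-part of a series sees `f_𝔫` only. -/
theorem pair_add_nPart (ν : TopForm n Q) {fs fn : PhaseFn n Q} (hfs : fs ∈ sDual n Q)
    (hfn : fn ∈ nDual n Q) {g : FormalFn n Q} (hg : g ∈ F₀ n Q) :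
    pair ν (fs + fn) (nPart g) = pair ν fn g := by
  rw [pair_add_left ν (mem_F₀Dual_of_sDual hfs) hfn.1 (nPart_mem_nHat hg).1,
    pair_nPart_of_nDual ν hfn hg, pair_eq_zero_of_sDual ν hfs (nPart_mem_nHat hg).1 rfl rfl,
    zero_add]

theorem liouvilleIntegral_momentPart_mul (ν : TopForm n Q) {f : PhaseFn n Q}
    (hf : f ∈ F₀Dual n Q) {k : ℕ} {F : PhaseFn n Q} (hF : IsHomogeneous k F) :
    liouvilleIntegral ν (momentPart f k * F) = liouvilleIntegral ν (f * F) := by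
  have h := (momentVanishes_sub_momentPart hf k).liouvilleIntegral_mul_eq_zero
    (hf.1.sub (hf.1.momentPart k)) hF ν
  rw [← sub_add_cancel f (momentPart f k), add_mul,
    liouvilleIntegral_add ν ((hf.1.sub (hf.1.momentPart k)).mul_isHomogeneous hF)
      ((hf.1.momentPart k).mul_isHomogeneous hF), h, zero_add, sub_add_cancel]

theorem liouvilleIntegral_add_mul_of_lt (ν : TopForm n Q) {fs fn : PhaseFn n Q}
    (hfs : fs ∈ sDual n Q) (hfn : fn ∈ nDual n Q) {k : ℕ} (hk : k < 2) {F : PhaseFn n Q}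
    (hF : IsHomogeneous k F) :
    liouvilleIntegral ν ((fs + fn) * F) = liouvilleIntegral ν (fs * F) := by
  rw [add_mul, liouvilleIntegral_add ν (hfs.1.mul_isHomogeneous hF)
    (hfn.1.1.mul_isHomogeneous hF), (hfn.2 k hk).liouvilleIntegral_mul_eq_zero hfn.1.1 hF, add_zero]

theorem liouvilleIntegral_add_mul_of_le (ν : TopForm n Q) {fs fn : PhaseFn n Q}
    (hfs : fs ∈ sDual n Q) (hfn : fn ∈ nDual n Q) {k : ℕ} (hk : 2 ≤ k) {F : PhaseFn n Q}
    (hF : IsHomogeneous k F) :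
    liouvilleIntegral ν ((fs + fn) * F) = liouvilleIntegral ν (fn * F) := by
  rw [add_mul, liouvilleIntegral_add ν (hfs.1.mul_isHomogeneous hF)
    (hfn.1.1.mul_isHomogeneous hF), (hfs.2 k hk).liouvilleIntegral_mul_eq_zero hfs.1 hF, zero_add]

/-- The terms of a series are determined by its pairing with functions that have moments of one
order only. -/
theorem apply_eq_of_pair_eq (ν : TopForm n Q) {g h : FormalFn n Q} (hg : g ∈ F₀ n Q)
    (hh : h ∈ F₀ n Q) {k : ℕ} (hgh : ∀ u ∈ degDual n Q k, pair ν u g = pair ν u h) :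
    g k = h k := by
  have hd : IsHomogeneous k (g k + -h k) := (hg k).add (hh k).neg
  have h0 := hd.eq_zero_of_liouvilleIntegral_eq_zero ν fun u hu => by
    have h1 := hgh u hu
    rw [pair_eq_of_degDual ν hu hg, pair_eq_of_degDual ν hu hh] at h1
    rw [mul_add, liouvilleIntegral_add ν (hu.1.mul_isHomogeneous (hg k))
      (hu.1.mul_isHomogeneous (hh k).neg), mul_neg, liouvilleIntegral_neg, h1, add_neg_cancel]
  exact add_neg_eq_zero.1 h0

/-! ### Functional derivatives -/

section Variation

variable {ν : TopForm n Q} {H : PhaseFn n Q → ℝ} {f : PhaseFn n Q} {h : FormalFn n Q}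

theorem HasVariation.iff_eq (hH : HasVariation ν (F₀Dual n Q) (F₀ n Q) H f h) (D : FormalFn n Q) :
    HasVariation ν (F₀Dual n Q) (F₀ n Q) H f D ↔ D = h :=
  hasVariation_iff_eq hH subset_rfl hH.1 (fun _ _ => rfl) (fun _ hD hp => funext fun _ =>
    apply_eq_of_pair_eq ν hD hH.1 fun u hu => hp u (mem_F₀Dual_of_degDual hu)) D

theorem HasVariation.sPart_iff (hH : HasVariation ν (F₀Dual n Q) (F₀ n Q) H f h)
    (D : FormalFn n Q) : HasVariation ν (sDual n Q) (sHat n Q) H f D ↔ D = sPart h := by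
  have hs := sPart_mem_sHat hH.1
  refine hasVariation_iff_eq hH (fun _ => mem_F₀Dual_of_sDual) hs
    (fun u hu => pair_sPart_of_sDual ν hu hH.1) (fun D hD hp => funext fun k => ?_) D
  by_cases hk : k < 2
  · exact apply_eq_of_pair_eq ν hD.1 hs.1 fun u hu => hp u (degDual_subset_sDual hk hu)
  · rw [hD.2 k (not_lt.1 hk), hs.2 k (not_lt.1 hk)]

theorem HasVariation.nPart_iff (hH : HasVariation ν (F₀Dual n Q) (F₀ n Q) H f h)
    (D : FormalFn n Q) : HasVariation ν (nDual n Q) (nHat n Q) H f D ↔ D = nPart h := by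
  have hs := nPart_mem_nHat hH.1
  refine hasVariation_iff_eq hH (fun _ hu => hu.1) hs
    (fun u hu => pair_nPart_of_nDual ν hu hH.1) (fun D hD hp => funext fun k => ?_) D
  by_cases hk : k < 2
  · rw [hD.2 k hk, hs.2 k hk]
  · exact apply_eq_of_pair_eq ν hD.1 hs.1 fun u hu => hp u (degDual_subset_nDual (not_lt.1 hk) hu)

theorem HasVariation.degPart_iff (hH : HasVariation ν (F₀Dual n Q) (F₀ n Q) H f h) (k : ℕ)
    (D : FormalFn n Q) : HasVariation ν (degDual n Q k) (degHat n Q k) H f D ↔ D = degPart k h := by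
  have hs := degPart_mem_degHat hH.1 k
  refine hasVariation_iff_eq hH (fun _ => mem_F₀Dual_of_degDual) hs (fun u hu => ?_)
    (fun D hD hp => funext fun j => ?_) D
  · rw [pair_eq_of_degDual ν hu hs.1, pair_eq_of_degDual ν hu hH.1]
    simp [degPart, ofDegree]
  · by_cases hj : j = k
    · subst hj
      exact apply_eq_of_pair_eq ν hD.1 hs.1 hp
    · rw [hD.2 j hj, hs.2 j hj]

end Variation

end Pairing

/-! ### The bracket functionals and the operators of the matched pair -/

section Brackets

variable {n : ℕ} {Q : Type*} [TopologicalSpace Q] [ChartedSpace (E n) Q]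
  [IsManifold (𝓡 n) ∞ Q] [MeasurableSpace Q]

theorem liouvilleIntegral_mul_poisson_eq_zero (ν : TopForm n Q) {f F G : PhaseFn n Q}
    (hf : IsAdmissible f) {N i j : ℕ} (hN : ∀ k, N ≤ k → MomentVanishes k f)
    (hF : IsHomogeneous i F) (hG : IsHomogeneous j G) (hij : N + 1 ≤ i + j) :
    liouvilleIntegral ν (f * poisson F G) = 0 :=
  (hN (i + j - 1) (by omega)).liouvilleIntegral_mul_eq_zero hf (hF.poisson hG (by omega)) ν

variable [T2Space Q] [BorelSpace Q]

theorem liouvilleIntegral_mul_lie (ν : TopForm n Q) {f : PhaseFn n Q} (hf : IsAdmissible f)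
    {g h : FormalFn n Q} (hg : g ∈ F₀ n Q) (hh : h ∈ F₀ n Q) (k : ℕ) :
    liouvilleIntegral ν (f * lie g h k) = -∑ i ∈ Finset.range (k + 2),
      liouvilleIntegral ν (f * poisson (g i) (h (k + 1 - i))) := by
  rw [lie, mul_neg, liouvilleIntegral_neg, Finset.mul_sum,
    liouvilleIntegral_sum ν _ fun i hi => hf.mul_isHomogeneous ((hg i).poisson (hh (k + 1 - i))
      (k := k) (by have := Finset.mem_range.1 hi; omega))]

variable [SigmaCompactSpace Q]

theorem pair_poisson (ν : TopForm n Q) {f F : PhaseFn n Q} (hf : IsAdmissible f) {j : ℕ}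
    (hF : IsHomogeneous j F) {g : FormalFn n Q} (hg : g ∈ F₀ n Q) :
    pair ν (poisson F f) g = ∑ᶠ i, liouvilleIntegral ν (f * poisson (g i) F) :=
  finsum_congr fun i => liouvilleIntegral_poisson_mul ν hf (hg i) hF

/-- The bracket with `h` is the negative of the coadjoint action. Both sides are sums of the numbers
`a i j = ∫ f {g_i, h_j}`, arranged by `j` on the left and by the degree `i + j - 1` on the right.
The term `a 0 0`, which has no place on the right, vanishes. -/
theorem br_eq_neg_coad (ν : TopForm n Q) {f : PhaseFn n Q} (hf : f ∈ F₀Dual n Q)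
    {g h : FormalFn n Q} (hg : g ∈ F₀ n Q) (hh : h ∈ F₀ n Q) :
    br ν h f g = -coad ν h f g := by
  obtain ⟨N, hN⟩ := hf.2
  set a : ℕ → ℕ → ℝ := fun i j => liouvilleIntegral ν (f * poisson (g i) (h j)) with ha
  have ha0 : ∀ i j, N + 1 ≤ i + j → a i j = 0 := fun i j hij =>
    liouvilleIntegral_mul_poisson_eq_zero ν hf.1 hN (hg i) (hh j) hij
  have h00 : a 0 0 = 0 := by
    simp only [ha]
    rw [poisson_eq_zero_of_isHomogeneous_zero (hg 0) (hh 0), mul_zero, liouvilleIntegral_zero]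
  have hin : ∀ j, ∑ᶠ i, a i j = ∑ i ∈ Finset.range (N + 1 - j), a i j := fun j =>
    finsum_eq_sum_of_support_subset _ fun i hi => by
      by_contra hiN
      rw [Finset.coe_range, mem_Iio, not_lt] at hiN
      exact hi (ha0 i j (by omega))
  have hl : br ν h f g = ∑ j ∈ Finset.range (N + 1), ∑ i ∈ Finset.range (N + 1 - j), a i j := by
    have h1 : br ν h f g = ∑ᶠ j, ∑ i ∈ Finset.range (N + 1 - j), a i j :=
      finsum_congr fun j => by rw [pair_poisson ν hf.1 (hh j) hg, ← hin j]
    rw [h1]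
    refine finsum_eq_sum_of_support_subset _ fun j hj => ?_
    by_contra hjN
    rw [Finset.coe_range, mem_Iio, not_lt] at hjN
    exact hj (by simp [Nat.sub_eq_zero_of_le hjN])
  rw [hl, coad, pair_eq_sum ν hf.1 hN (lie_mem_F₀ hg hh), ← Finset.sum_neg_distrib,
    ← Finset.sum_range_diag_flip (N + 1) fun j i => a i j, Finset.sum_range_succ']
  simp only [Finset.sum_range_one, zero_add, Nat.sub_self, h00, add_zero]
  refine Finset.sum_congr rfl fun k _ => ?_
  rw [liouvilleIntegral_mul_lie ν hf.1 hg hh, neg_neg, ← Finset.sum_range_reflect]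
  refine Finset.sum_congr rfl fun i hi => ?_
  have := Finset.mem_range.1 hi
  rw [show k + 1 - (k + 1 + 1 - 1 - i) = i by omega, show k + 1 + 1 - 1 - i = k + 1 - i by omega]

/-- A moment part of order `k` pairs with the terms of degree `k` only, for which it may be replaced
by `f`. -/
theorem br_momentPart (ν : TopForm n Q) {f : PhaseFn n Q} (hf : f ∈ F₀Dual n Q)
    {g h : FormalFn n Q} (hg : g ∈ F₀ n Q) (hh : h ∈ F₀ n Q) (k : ℕ) :
    br ν h (momentPart f k) g = -liouvilleIntegral ν (f * lie g h k) := by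
  have hk := momentPart_mem_degDual hf k
  rw [br_eq_neg_coad ν (mem_F₀Dual_of_degDual hk) hg hh, coad,
    pair_eq_of_degDual ν hk (lie_mem_F₀ hg hh),
    liouvilleIntegral_momentPart_mul ν hf (lie_mem_F₀ hg hh k)]

theorem br_degPart_momentPart (ν : TopForm n Q) {f : PhaseFn n Q} (hf : f ∈ F₀Dual n Q)
    {g h : FormalFn n Q} (hg : g ∈ F₀ n Q) (hh : h ∈ F₀ n Q) {m k : ℕ} (hm : m ≤ k + 1) :
    br ν (degPart m h) (momentPart f k) g
      = liouvilleIntegral ν (f * poisson (g (k + 1 - m)) (h m)) := by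
  rw [br_momentPart ν hf hg (degPart_mem_degHat hh m).1, lie_degPart_right g h hm, mul_neg,
    liouvilleIntegral_neg, neg_neg]

section MatchedPair

variable (ν : TopForm n Q) {fs fn : PhaseFn n Q} {σ X g : FormalFn n Q}

theorem neg_coadS_eq (hfs : fs ∈ sDual n Q) (hfn : fn ∈ nDual n Q) (hσ : σ ∈ sHat n Q)
    (hg : g ∈ F₀ n Q) : -coadS ν σ fs g = br ν σ (momentPart (fs + fn) 0) g
        + br ν (degPart 1 σ) (momentPart (fs + fn) 1) g := by
  have hf := F₀Dual_add (mem_F₀Dual_of_sDual hfs) hfn.1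
  have hsg := (sPart_mem_sHat hg).1
  have hP : IsHomogeneous 1 (poisson (g 1) (σ 1)) := (hg 1).poisson (hσ.1 1) rfl
  have h0 : lie (sPart g) σ 0 = lie g σ 0 := by
    simp [lie, sPart, Finset.sum_range_succ]
  have h1 : lie (sPart g) σ 1 = -poisson (g 1) (σ 1) := by
    simp [lie, sPart, Finset.sum_range_succ, hσ.2 2 le_rfl, poisson_zero_left, poisson_zero_right]
  rw [br_momentPart ν hf hg hσ.1, br_degPart_momentPart ν hf hg hσ.1 (by omega), coadS,
    pair_eq_of_sDual ν hfs (lie_mem_F₀ hsg hσ.1), h0, h1, mul_neg, liouvilleIntegral_neg,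
    liouvilleIntegral_add_mul_of_lt ν hfs hfn (by omega) (lie_mem_F₀ hg hσ.1 0),
    liouvilleIntegral_add_mul_of_lt ν hfs hfn (by omega) hP]
  ring

theorem dualActR_eq (hfs : fs ∈ sDual n Q) (hX : X ∈ nHat n Q) (hg : g ∈ F₀ n Q) :
    dualActR ν fs X g = br ν X fs g := by
  have hsg := (sPart_mem_sHat hg).1
  have hXsg := lie_mem_F₀ hX.1 hsg
  rw [br_eq_neg_coad ν (mem_F₀Dual_of_sDual hfs) hg hX.1, dualActR, actL,
    pair_sPart_of_sDual ν hfs hXsg, coad, ← pair_neg_right, ← lie_antisymm]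
  refine pair_congr_of_sDual ν hfs hXsg (lie_mem_F₀ hX.1 hg) ?_ ?_
  · simp [lie, sPart, Finset.sum_range_succ]
  · simp [lie, sPart, Finset.sum_range_succ, hX.2 0, poisson_zero_left]

theorem crossA_eq (hfs : fs ∈ sDual n Q) (hfn : fn ∈ nDual n Q) (hX : X ∈ nHat n Q)
    (hg : g ∈ F₀ n Q) : crossA ν X fn g = ∑ᶠ (k : ℕ) (_ : 2 ≤ k),
        (br ν (degPart k X) (momentPart (fs + fn) k) g
          + br ν (degPart (k + 1) X) (momentPart (fs + fn) k) g) := by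
  have hf := F₀Dual_add (mem_F₀Dual_of_sDual hfs) hfn.1
  have hXg := lie_mem_F₀ hX.1 (sPart_mem_sHat hg).1
  rw [crossA, actR, pair_nPart_of_nDual ν hfn hXg]
  refine finsum_congr fun k => ?_
  by_cases hk : 2 ≤ k
  · have h1 : IsHomogeneous k (poisson (g 1) (X k)) := (hg 1).poisson (hX.1 k) (by omega)
    have h2 : IsHomogeneous k (poisson (g 0) (X (k + 1))) :=
      (hg 0).poisson (hX.1 (k + 1)) (by omega)
    rw [finsum_eq_if, if_pos hk, br_degPart_momentPart ν hf hg hX.1 (by omega),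
      br_degPart_momentPart ν hf hg hX.1 (by omega), show k + 1 - k = 1 by omega, Nat.sub_self,
      ← liouvilleIntegral_add_mul_of_le ν hfs hfn hk (hXg k), lie_sPart_right, poisson_antisymm,
      poisson_antisymm (X (k + 1)), neg_add, neg_neg, neg_neg, mul_add,
      liouvilleIntegral_add ν (hf.1.mul_isHomogeneous h1) (hf.1.mul_isHomogeneous h2)]
  · rw [finsum_eq_if, if_neg hk,
      (hfn.2 k (not_le.1 hk)).liouvilleIntegral_mul_eq_zero hfn.1.1 (hXg k)]

theorem neg_coadN_eq (hfs : fs ∈ sDual n Q) (hfn : fn ∈ nDual n Q) (hX : X ∈ nHat n Q)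
    (hg : g ∈ F₀ n Q) : -coadN ν X fn g = ∑ᶠ (k : ℕ) (_ : 2 ≤ k) (l : ℕ) (_ : 1 ≤ l),
        br ν (degPart k X) (momentPart (fs + fn) (l + k)) g := by
  have hf := F₀Dual_add (mem_F₀Dual_of_sDual hfs) hfn.1
  have hng := nPart_mem_nHat hg
  have h1 : -coadN ν X fn g = br ν X fn (nPart g) := by
    rw [br_eq_neg_coad ν hfn.1 hng.1 hX.1]
    rfl
  rw [h1]
  refine finsum_congr fun k => ?_
  rw [finsum_eq_if]
  split_ifs with hk
  · rw [pair_poisson ν hfn.1.1 (hX.1 k) hng.1]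
    have h2 : ∀ i, i < 2 → liouvilleIntegral ν (fn * poisson (nPart g i) (X k)) = 0 := fun i hi => by
      rw [hng.2 i hi, poisson_zero_left, mul_zero, liouvilleIntegral_zero]
    -- the terms with `i ≤ 1` vanish, so the sum over `i` is one over `l = i - 1 ≥ 1`
    have h3 : Function.support (fun i => liouvilleIntegral ν (fn * poisson (nPart g i) (X k)))
        ⊆ range Nat.succ := fun i hi => by
      rcases i with _ | i
      · exact absurd (h2 0 two_pos) hi
      · exact ⟨i, rfl⟩
    rw [← finsum_mem_univ, finsum_mem_inter_support_eq _ univ (range Nat.succ)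
        (by rw [univ_inter, inter_eq_right.2 h3]), finsum_mem_range Nat.succ_injective]
    refine finsum_congr fun l => ?_
    rw [finsum_eq_if]
    split_ifs with hl
    · have hP : IsHomogeneous (l + k) (poisson (g (l + 1)) (X k)) :=
        (hg (l + 1)).poisson (hX.1 k) (by omega)
      rw [br_degPart_momentPart ν hf hg hX.1 (by omega), show l + k + 1 - k = l + 1 by omega,
        liouvilleIntegral_add_mul_of_le ν hfs hfn (by omega) hP, nPart, if_neg (by omega)]
    · exact h2 _ (by omega)
  · rw [hX.2 k (not_le.1 hk), poisson_zero_left, pair]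
    simp [liouvilleIntegral_zero]

theorem neg_dualActL_eq (hfn : fn ∈ nDual n Q) (hσ : σ ∈ sHat n Q) (hg : g ∈ F₀ n Q) :
    -dualActL ν σ fn g = br ν σ fn g := by
  have hng := nPart_mem_nHat hg
  have hl := lie_mem_F₀ hng.1 hσ.1
  rw [br_eq_neg_coad ν hfn.1 hg hσ.1, dualActL, actR, pair_nPart_of_nDual ν hfn hl, coad]
  congr 1
  refine pair_congr_of_nDual ν hfn hl (lie_mem_F₀ hg hσ.1) fun k hk => ?_
  rw [lie, lie]
  congr 1
  refine Finset.sum_congr rfl fun i hi => ?_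
  by_cases h2 : i < 2
  · rw [hσ.2 (k + 1 - i) (by omega), poisson_zero_right, poisson_zero_right]
  · rw [nPart, if_neg h2]

theorem neg_crossB_eq (hfs : fs ∈ sDual n Q) (hfn : fn ∈ nDual n Q) (hσ : σ ∈ sHat n Q)
    (hg : g ∈ F₀ n Q) :
    -crossB ν σ fs g = br ν (degPart 0 σ) (momentPart (fs + fn) 1) g := by
  have hf := F₀Dual_add (mem_F₀Dual_of_sDual hfs) hfn.1
  have hng := nPart_mem_nHat hg
  have hl := lie_mem_F₀ hng.1 hσ.1
  have hP : IsHomogeneous 1 (poisson (g 2) (σ 0)) := (hg 2).poisson (hσ.1 0) rfl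
  have h0 : lie (nPart g) σ 0 = 0 := by
    simp [lie, nPart, Finset.sum_range_succ, poisson_zero_left]
  have h1 : lie (nPart g) σ 1 = -poisson (g 2) (σ 0) := by
    simp [lie, nPart, Finset.sum_range_succ, poisson_zero_left]
  rw [br_degPart_momentPart ν hf hg hσ.1 (by omega), crossB, actL, pair_sPart_of_sDual ν hfs hl,
    pair_eq_of_sDual ν hfs hl, h0, h1, mul_zero, liouvilleIntegral_zero, mul_neg,
    liouvilleIntegral_neg, zero_add, neg_neg,
    liouvilleIntegral_add_mul_of_lt ν hfs hfn one_lt_two hP]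

end MatchedPair

end Brackets

/-! ### The matched equations -/

section Parts

variable {n : ℕ} {Q : Type*}

theorem degPart_sPart {k : ℕ} (hk : k < 2) (h : FormalFn n Q) :
    degPart k (sPart h) = degPart k h := by
  rw [degPart, degPart, sPart, if_pos hk]

theorem degPart_nPart {k : ℕ} (hk : 2 ≤ k) (h : FormalFn n Q) :
    degPart k (nPart h) = degPart k h := by
  rw [degPart, degPart, nPart, if_neg (by omega)]

theorem energy_apply (m e : ℝ) (P : PhaseFn n Q) (φ : Q → ℝ) (k : ℕ) : energy m e P φ k
    = (if k = 2 then kinetic m P else 0) + if k = 0 then potential e φ else 0 := rfl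

theorem sPart_energy (m e : ℝ) (P : PhaseFn n Q) (φ : Q → ℝ) :
    sPart (energy m e P φ) = ofDegree 0 (potential e φ) := by
  funext k
  rw [sPart, energy_apply, ofDegree]
  split_ifs with h1 h2 h3 <;> first | omega | simp

theorem nPart_energy (m e : ℝ) (P : PhaseFn n Q) (φ : Q → ℝ) :
    nPart (energy m e P φ) = ofDegree 2 (kinetic m P) := by
  funext k
  rw [nPart, energy_apply, ofDegree]
  split_ifs with h1 h2 h3 <;> first | omega | simp

theorem degPart_energy_zero (m e : ℝ) (P : PhaseFn n Q) (φ : Q → ℝ) :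
    degPart 0 (energy m e P φ) = ofDegree 0 (potential e φ) := by
  simp [degPart, energy_apply]

theorem degPart_energy_two (m e : ℝ) (P : PhaseFn n Q) (φ : Q → ℝ) :
    degPart 2 (energy m e P φ) = ofDegree 2 (kinetic m P) := by
  simp [degPart, energy_apply]

theorem degPart_energy_of_ne (m e : ℝ) (P : PhaseFn n Q) (φ : Q → ℝ) {k : ℕ} (h0 : k ≠ 0)
    (h2 : k ≠ 2) : degPart k (energy m e P φ) = 0 := by
  funext j
  simp [degPart, energy_apply, ofDegree, h0, h2]

end Parts

section Equations

variable {n : ℕ} {Q : Type*} [TopologicalSpace Q] [T2Space Q]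
  [ChartedSpace (E n) Q] [IsManifold (𝓡 n) ∞ Q] [MeasurableSpace Q] [BorelSpace Q]

/-- The decomposition `f = f_𝔰 + f_𝔫` is unique as an identity of functionals: the parts of a
series recover the summands. -/
theorem pair_eq_of_parts (ν : TopForm n Q) {f fs fn : PhaseFn n Q} (hf : f ∈ F₀Dual n Q)
    (hfs : fs ∈ sDual n Q) (hfn : fn ∈ nDual n Q)
    (h : ∀ g ∈ F₀ n Q, pair ν f g = pair ν (fs + fn) g) {g : FormalFn n Q} (hg : g ∈ F₀ n Q) :
    pair ν fs g = pair ν (sComp f) g ∧ pair ν fn g = pair ν (nComp f) g := by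
  have hs := sComp_mem_sDual hf
  have hn := nComp_mem_nDual hf
  constructor
  · rw [← pair_add_sPart ν hfs hfn hg, ← h _ (sPart_mem_sHat hg).1, ← pair_add_sPart ν hs hn hg,
      ← sComp_add_nComp]
  · rw [← pair_add_nPart ν hfs hfn hg, ← h _ (nPart_mem_nHat hg).1, ← pair_add_nPart ν hs hn hg,
      ← sComp_add_nComp]

variable [SigmaCompactSpace Q]

section

variable (ν : TopForm n Q) {fs fn : PhaseFn n Q} {g h : FormalFn n Q}

/-- The equation for `f_𝔰` is the Lie-Poisson equation, tested with the `ŝ`-part. -/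
theorem matchedS_eq (hfs : fs ∈ sDual n Q) (hfn : fn ∈ nDual n Q) (hg : g ∈ F₀ n Q)
    (hh : h ∈ F₀ n Q) : matchedS ν (sPart h) (nPart h) (fun k => degPart k h) fs fn g
      = -coad ν h (fs + fn) (sPart g) := by
  have hσ := sPart_mem_sHat hh
  have hX := nPart_mem_nHat hh
  have hsg := sPart_mem_sHat hg
  have h1 : matchedS ν (sPart h) (nPart h) (fun k => degPart k h) fs fn g
      = -coadS ν (sPart h) fs g + dualActR ν fs (nPart h) g + crossA ν (nPart h) fn g := by
    rw [neg_coadS_eq ν hfs hfn hσ hg, dualActR_eq ν hfs hX hg, crossA_eq ν hfs hfn hX hg, matchedS,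
      degPart_sPart one_lt_two]
    congr 1
    refine finsum_congr fun k => finsum_congr fun hk => ?_
    rw [degPart_nPart hk, degPart_nPart (by omega)]
  have hXg := lie_mem_F₀ hX.1 hsg.1
  have hgσ := lie_mem_F₀ hsg.1 hσ.1
  have hgX := lie_mem_F₀ hsg.1 hX.1
  have h2 : pair ν fn (lie (sPart g) (sPart h)) = 0 :=
    pair_eq_zero_of_nDual ν hfn hgσ fun k hk => by
      rw [lie, Finset.sum_eq_zero, neg_zero]
      intro i _
      by_cases hi : i < 2
      · rw [hσ.2 (k + 1 - i) (by omega), poisson_zero_right]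
      · rw [hsg.2 i (not_lt.1 hi), poisson_zero_left]
  rw [h1, coadS, dualActR, actL, crossA, actR, pair_sPart_of_sDual ν hfs hXg,
    pair_nPart_of_nDual ν hfn hXg, lie_antisymm (nPart h), pair_neg_right, pair_neg_right, coad]
  nth_rw 4 [← sPart_add_nPart h]
  rw [lie_add_right hσ.1 hX.1, pair_add_left ν (mem_F₀Dual_of_sDual hfs) hfn.1 (F₀_add hgσ hgX),
    pair_add_right ν (mem_F₀Dual_of_sDual hfs) hgσ hgX, pair_add_right ν hfn.1 hgσ hgX, h2]
  ring

/-- The equation for `f_𝔫` is the Lie-Poisson equation, tested with the `n̂`-part. -/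
theorem matchedN_eq (hfs : fs ∈ sDual n Q) (hfn : fn ∈ nDual n Q) (hg : g ∈ F₀ n Q)
    (hh : h ∈ F₀ n Q) : matchedN ν (sPart h) (fun k => degPart k h) fs fn g
      = -coad ν h (fs + fn) (nPart g) := by
  have hσ := sPart_mem_sHat hh
  have hX := nPart_mem_nHat hh
  have hng := nPart_mem_nHat hg
  have h1 : matchedN ν (sPart h) (fun k => degPart k h) fs fn g
      = -coadN ν (nPart h) fn g + -dualActL ν (sPart h) fn g + -crossB ν (sPart h) fs g := by
    rw [neg_coadN_eq ν hfs hfn hX hg, neg_dualActL_eq ν hfn hσ hg, neg_crossB_eq ν hfs hfn hσ hg,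
      matchedN, degPart_sPart two_pos]
    congr 2
    refine finsum_congr fun k => finsum_congr fun hk => ?_
    rw [degPart_nPart hk]
  have hgσ := lie_mem_F₀ hng.1 hσ.1
  have hgX := lie_mem_F₀ hng.1 hX.1
  have h2 : pair ν fs (lie (nPart g) (nPart h)) = 0 := by
    have h3 : ∀ k, k < 2 → lie (nPart g) (nPart h) k = 0 := fun k hk => by
      rw [lie, Finset.sum_eq_zero, neg_zero]
      intro i _
      by_cases hi : i < 2
      · rw [hng.2 i hi, poisson_zero_left]
      · rw [hX.2 (k + 1 - i) (by omega), poisson_zero_right]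
    exact pair_eq_zero_of_sDual ν hfs hgX (h3 0 two_pos) (h3 1 one_lt_two)
  rw [h1, coadN, dualActL, actR, crossB, actL, pair_sPart_of_sDual ν hfs hgσ,
    pair_nPart_of_nDual ν hfn hgσ, coad]
  nth_rw 4 [← sPart_add_nPart h]
  rw [lie_add_right hσ.1 hX.1, pair_add_left ν (mem_F₀Dual_of_sDual hfs) hfn.1 (F₀_add hgσ hgX),
    pair_add_right ν (mem_F₀Dual_of_sDual hfs) hgσ hgX, pair_add_right ν hfn.1 hgσ hgX, h2]
  ring

theorem matchedS_add_matchedN (hfs : fs ∈ sDual n Q) (hfn : fn ∈ nDual n Q) (hg : g ∈ F₀ n Q)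
    (hh : h ∈ F₀ n Q) : matchedS ν (sPart h) (nPart h) (fun k => degPart k h) fs fn g
      + matchedN ν (sPart h) (fun k => degPart k h) fs fn g = -coad ν h (fs + fn) g := by
  have hsg := (sPart_mem_sHat hg).1
  have hng := (nPart_mem_nHat hg).1
  rw [matchedS_eq ν hfs hfn hg hh, matchedN_eq ν hfs hfn hg hh, coad, coad, coad, ← neg_add,
    ← pair_add_right ν (F₀Dual_add (mem_F₀Dual_of_sDual hfs) hfn.1) (lie_mem_F₀ hsg hh)
      (lie_mem_F₀ hng hh), ← lie_add_left hsg hng, sPart_add_nPart]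

end

/-- The Lie-Poisson equation at one time, for curves in the two summands. -/
theorem hasDualDeriv_iff_matched (ν : TopForm n Q) {J : Set ℝ} (hJ : IsOpen J)
    {fs fn : ℝ → PhaseFn n Q} (hf : ∀ t ∈ J, fs t ∈ sDual n Q ∧ fn t ∈ nDual n Q)
    {h : FormalFn n Q} (hh : h ∈ F₀ n Q) {t : ℝ} (ht : t ∈ J) :
    HasDualDeriv ν (fun τ => fs τ + fn τ) (fun g => -coad ν h (fs t + fn t) g) t ↔
      HasDualDeriv ν fs (matchedS ν (sPart h) (nPart h) (fun k => degPart k h) (fs t) (fn t)) t ∧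
      HasDualDeriv ν fn (matchedN ν (sPart h) (fun k => degPart k h) (fs t) (fn t)) t := by
  have hJt : ∀ᶠ τ in 𝓝 t, τ ∈ J := hJ.mem_nhds ht
  constructor
  · refine fun hd => ⟨fun g hg => ?_, fun g hg => ?_⟩
    · rw [matchedS_eq ν (hf t ht).1 (hf t ht).2 hg hh]
      refine (hd _ (sPart_mem_sHat hg).1).congr_of_eventuallyEq ?_
      filter_upwards [hJt] with τ hτ
      exact (pair_add_sPart ν (hf τ hτ).1 (hf τ hτ).2 hg).symm
    · rw [matchedN_eq ν (hf t ht).1 (hf t ht).2 hg hh]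
      refine (hd _ (nPart_mem_nHat hg).1).congr_of_eventuallyEq ?_
      filter_upwards [hJt] with τ hτ
      exact (pair_add_nPart ν (hf τ hτ).1 (hf τ hτ).2 hg).symm
  · rintro ⟨hs, hn⟩ g hg
    have h1 := (hs g hg).add (hn g hg)
    rw [matchedS_add_matchedN ν (hf t ht).1 (hf t ht).2 hg hh] at h1
    refine h1.congr_of_eventuallyEq ?_
    filter_upwards [hJt] with τ hτ
    exact pair_add_left ν (mem_F₀Dual_of_sDual (hf τ hτ).1) (hf τ hτ).2.1 hg

theorem isLiePoisson_iff_isMatchedLiePoisson (ν : TopForm n Q) (H : PhaseFn n Q → ℝ) {J : Set ℝ}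
    (hJ : IsOpen J) {fs fn : ℝ → PhaseFn n Q}
    (hf : ∀ t ∈ J, fs t ∈ sDual n Q ∧ fn t ∈ nDual n Q)
    (hH : ∀ t ∈ J, ∃ h, HasVariation ν (F₀Dual n Q) (F₀ n Q) H (fs t + fn t) h) :
    IsLiePoisson ν J H (fun t => fs t + fn t) ↔ IsMatchedLiePoisson ν J H fs fn := by
  refine forall₂_congr fun t ht => ?_
  obtain ⟨h, hh⟩ := hH t ht
  have hiff := hasDualDeriv_iff_matched ν hJ hf hh.1 ht
  constructor
  · rintro ⟨h', hh', hd⟩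
    obtain rfl := (hh.iff_eq h').1 hh'
    exact ⟨sPart h', nPart h', fun k => degPart k h', (hh.sPart_iff _).2 rfl,
      (hh.nPart_iff _).2 rfl, fun k => (hh.degPart_iff k _).2 rfl, hiff.1 hd⟩
  · rintro ⟨Ds, Dn, D, hDs, hDn, hD, hd⟩
    obtain rfl := (hh.sPart_iff _).1 hDs
    obtain rfl := (hh.nPart_iff _).1 hDn
    obtain rfl : D = fun k => degPart k h := funext fun k => (hh.degPart_iff k _).1 (hD k)
    exact ⟨h, hh, hiff.2 hd⟩

end Equations

/-! ### The Vlasov equation -/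

section Vlasov

variable {n : ℕ} {Q : Type*} [TopologicalSpace Q] [ChartedSpace (E n) Q] [IsManifold (𝓡 n) ∞ Q]

theorem IsMomentumSquare.isHomogeneous {P : PhaseFn n Q} (hP : IsMomentumSquare P) :
    IsHomogeneous 2 P := by
  refine isHomogeneous_iff.2 ⟨hP.1, fun q t p => ?_⟩
  obtain ⟨G, -, hG⟩ := hP.2 q
  rw [hG, hG, Finset.mul_sum]
  refine Finset.sum_congr rfl fun i _ => ?_
  rw [Finset.mul_sum]
  refine Finset.sum_congr rfl fun j _ => ?_
  simp only [PiLp.smul_apply, smul_eq_mul]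
  ring

theorem isHomogeneous_kinetic (m : ℝ) {P : PhaseFn n Q} (hP : IsMomentumSquare P) :
    IsHomogeneous 2 (kinetic m P) := by
  have h : kinetic m P = (2 * m)⁻¹ • P := by
    ext q p
    simp only [kinetic, Pi.smul_apply, smul_eq_mul]
    ring
  rw [h]
  exact hP.isHomogeneous.const_smul _

theorem isHomogeneous_potential (e : ℝ) {φ : Q → ℝ}
    (hφ : ContMDiff (𝓡 n) (modelWithCornersSelf ℝ ℝ) ∞ φ) :
    IsHomogeneous 0 (potential e φ : PhaseFn n Q) :=
  (isHomogeneous_zero_of_contMDiff hφ).const_smul e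

theorem energy_mem_F₀ (m e : ℝ) {P : PhaseFn n Q} {φ : Q → ℝ} (hP : IsMomentumSquare P)
    (hφ : ContMDiff (𝓡 n) (modelWithCornersSelf ℝ ℝ) ∞ φ) : energy m e P φ ∈ F₀ n Q :=
  F₀_add (ofDegree_mem_degHat (isHomogeneous_kinetic m hP)).1
    (ofDegree_mem_degHat (isHomogeneous_potential e hφ)).1

/-- The Vlasov bracket in coordinates in which the metric is `δ^{ij}`. -/
theorem inChart_poisson_energy (m e : ℝ) {P : PhaseFn n Q} {φ : Q → ℝ} (hP : IsMomentumSquare P)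
    (hφ : ContMDiff (𝓡 n) (modelWithCornersSelf ℝ ℝ) ∞ φ) (c : Q) {U : Set (E n)}
    (hU : IsOpen U) (hUc : U ⊆ (extChartAt (𝓡 n) c).target)
    (hPU : ∀ x ∈ U, ∀ p : E n, inChart c P (x, p) = ∑ l : Fin n, p l ^ 2)
    {f : PhaseFn n Q} (hf : IsSmooth f) {x : E n} (hx : x ∈ U) (p : E n) :
    inChart c (poisson (kinetic m P + potential e φ) f) (x, p) =
      e * ∑ l : Fin n, fderiv ℝ (φ ∘ (extChartAt (𝓡 n) c).symm) x (ev l)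
          * fderiv ℝ (inChart c f) (x, p) (0, ev l)
        - 1 / m * ∑ l : Fin n, p l * fderiv ℝ (inChart c f) (x, p) (ev l, 0) := by
  have hφx : DifferentiableAt ℝ (φ ∘ (extChartAt (𝓡 n) c).symm) x := by
    have h1 := (isHomogeneous_zero_of_contMDiff (n := n) hφ).1.differentiableAt (c := c) (hUc hx) 0
    exact h1.comp (f := fun y : E n => (y, (0 : E n))) x
      (differentiableAt_id.prodMk (differentiableAt_const _))
  have hev : inChart c (kinetic m P + potential e φ) =ᶠ[𝓝 (x, p)] fun z : E n × E n =>
      (∑ l : Fin n, z.2 l ^ 2) / (2 * m) + e * (φ ∘ (extChartAt (𝓡 n) c).symm) z.1 := by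
    filter_upwards [(hU.prod isOpen_univ).mem_nhds
      (⟨hx, mem_univ p⟩ : (x, p) ∈ U ×ˢ (univ : Set (E n)))] with z hz
    have h2 := hPU z.1 hz.1 z.2
    simp only [inChart, kinetic, potential, Pi.add_apply, Function.comp_apply] at h2 ⊢
    rw [h2]
  have hl : ∀ l : Fin n, HasFDerivAt (fun z : E n × E n => z.2 l ^ 2)
      ((2 * p l) • (EuclideanSpace.proj l).comp (ContinuousLinearMap.snd ℝ (E n) (E n)))
      (x, p) := fun l => by
    have h3 : HasFDerivAt (fun z : E n × E n => z.2 l)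
        ((EuclideanSpace.proj l).comp (ContinuousLinearMap.snd ℝ (E n) (E n))) (x, p) :=
      ((EuclideanSpace.proj l).comp (ContinuousLinearMap.snd ℝ (E n) (E n))).hasFDerivAt
    simpa using h3.pow 2
  have hd := ((HasFDerivAt.fun_sum fun l (_ : l ∈ Finset.univ) => hl l).mul_const (2 * m)⁻¹).add
    ((hφx.hasFDerivAt.comp (x, p) (hasFDerivAt_fst (𝕜 := ℝ))).const_mul e)
  have hd' : fderiv ℝ (inChart c (kinetic m P + potential e φ)) (x, p) = _ :=
    hev.fderiv_eq.trans hd.fderiv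
  have hdq : ∀ l, fderiv ℝ (inChart c (kinetic m P + potential e φ)) (x, p) (ev l, 0)
      = e * fderiv ℝ (φ ∘ (extChartAt (𝓡 n) c).symm) x (ev l) := fun l => by
    rw [hd']
    simp
  have hdp : ∀ l, fderiv ℝ (inChart c (kinetic m P + potential e φ)) (x, p) (0, ev l)
      = p l / m := fun l => by
    rw [hd']
    simp [ev_apply]
    ring
  rw [inChart_poisson ((isHomogeneous_kinetic m hP).1.add (isHomogeneous_potential e hφ).1) hf c
    (hUc hx), coordPoisson, Finset.mul_sum, Finset.mul_sum, ← Finset.sum_sub_distrib]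
  refine Finset.sum_congr rfl fun l _ => ?_
  rw [hdq, hdp]
  ring

variable [MeasurableSpace Q]

theorem br_ofDegree (ν : TopForm n Q) (k : ℕ) (F f : PhaseFn n Q) (g : FormalFn n Q) :
    br ν (ofDegree k F) f g = pair ν (poisson F f) g := by
  rw [br, finsum_eq_single _ k fun j hj => ?_]
  · rw [ofDegree, if_pos rfl]
  · rw [ofDegree, if_neg hj, poisson_zero_left, pair]
    simp only [zero_mul, liouvilleIntegral_zero, finsum_zero]

theorem br_zero (ν : TopForm n Q) (f : PhaseFn n Q) (g : FormalFn n Q) :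
    br ν (0 : FormalFn n Q) f g = 0 := by
  have h : (0 : FormalFn n Q) = ofDegree 0 0 := by
    funext j
    simp [ofDegree]
  rw [h, br_ofDegree, poisson_zero_left, pair]
  simp only [zero_mul, liouvilleIntegral_zero, finsum_zero]

theorem HasDualDeriv.congr_iff {ν : TopForm n Q} {f : ℝ → PhaseFn n Q} {A B : FormalFn n Q → ℝ}
    {t : ℝ} (h : ∀ g ∈ F₀ n Q, A g = B g) : HasDualDeriv ν f A t ↔ HasDualDeriv ν f B t :=
  forall₂_congr fun g hg => by rw [h g hg]

theorem matchedS_energy (ν : TopForm n Q) (m e : ℝ) (P : PhaseFn n Q) (φ : Q → ℝ)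
    (fs fn : PhaseFn n Q) (g : FormalFn n Q) :
    matchedS ν (sPart (energy m e P φ)) (nPart (energy m e P φ))
        (fun k => degPart k (energy m e P φ)) fs fn g
      = pair ν (poisson (potential e φ) (momentPart (fs + fn) 0)) g
        + pair ν (poisson (kinetic m P) fs) g
        + pair ν (poisson (kinetic m P) (momentPart (fs + fn) 2)) g := by
  rw [matchedS, finsum_eq_single _ 2 fun k hk => ?_]
  · simp only [finsum_eq_if, le_refl, if_true]
    rw [sPart_energy, nPart_energy, degPart_energy_two, degPart_energy_of_ne _ _ _ _ one_ne_zero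
      (by omega), degPart_energy_of_ne _ _ _ _ (k := 2 + 1) (by omega) (by omega), br_zero, br_zero,
      br_ofDegree, br_ofDegree, br_ofDegree, add_zero, add_zero]
  · rw [finsum_eq_if]
    split_ifs with h2
    · rw [degPart_energy_of_ne _ _ _ _ (by omega) hk,
        degPart_energy_of_ne _ _ _ _ (by omega) (by omega), br_zero, add_zero]
    · rfl

theorem matchedN_energy (ν : TopForm n Q) (m e : ℝ) (P : PhaseFn n Q) (φ : Q → ℝ)
    (fs fn : PhaseFn n Q) (g : FormalFn n Q) :
    matchedN ν (sPart (energy m e P φ)) (fun k => degPart k (energy m e P φ)) fs fn g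
      = (∑ᶠ (l : ℕ) (_ : 1 ≤ l), pair ν (poisson (kinetic m P) (momentPart (fs + fn) (l + 2))) g)
        + pair ν (poisson (potential e φ) fn) g
        + pair ν (poisson (potential e φ) (momentPart (fs + fn) 1)) g := by
  rw [matchedN, finsum_eq_single _ 2 fun k hk => ?_]
  · rw [finsum_eq_if, if_pos le_rfl, sPart_energy, degPart_energy_two, degPart_energy_zero]
    simp only [br_ofDegree]
  · rw [finsum_eq_if]
    split_ifs with h2
    · rw [degPart_energy_of_ne _ _ _ _ (by omega) hk]
      simp only [br_zero, finsum_zero]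
    · rfl

variable [T2Space Q] [BorelSpace Q]

/-- A linear functional is its own derivative. -/
theorem hasVariation_pair (ν : TopForm n Q) {h : FormalFn n Q} (hh : h ∈ F₀ n Q) {f : PhaseFn n Q}
    (hf : f ∈ F₀Dual n Q) :
    HasVariation ν (F₀Dual n Q) (F₀ n Q) (fun f => pair ν f h) f h := by
  refine ⟨hh, fun u hu => ?_⟩
  have h1 : (fun ε : ℝ => pair ν (f + ε • u) h) = fun ε => pair ν f h + ε * pair ν u h := by
    funext ε
    have hεu : ε • u ∈ F₀Dual n Q := by
      obtain ⟨N, hN⟩ := hu.2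
      exact ⟨hu.1.const_smul ε, N, fun k hk => (hN k hk).const_smul ε⟩
    rw [pair_add_left ν hf hεu hh, pair_smul_left]
  rw [h1]
  simpa using ((hasDerivAt_id (0 : ℝ)).mul_const (pair ν u h)).const_add (pair ν f h)

variable [SigmaCompactSpace Q]

theorem finite_support_pair_poisson (ν : TopForm n Q) {f F : PhaseFn n Q} (hf : f ∈ F₀Dual n Q)
    {j : ℕ} (hF : IsHomogeneous j F) {g : FormalFn n Q} (hg : g ∈ F₀ n Q) :
    (Function.support fun k => liouvilleIntegral ν (poisson F f * g k)).Finite := by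
  obtain ⟨N, hN⟩ := hf.2
  refine (finite_Iio (N + 1)).subset fun k hk => ?_
  by_contra hkN
  rw [mem_Iio, not_lt] at hkN
  rw [Function.mem_support, liouvilleIntegral_poisson_mul ν hf.1 (hg k) hF,
    liouvilleIntegral_mul_poisson_eq_zero ν hf.1 hN (hg k) hF (by omega)] at hk
  exact hk rfl

/-- The right-hand side of the Vlasov equation is that of the Lie-Poisson equation. -/
theorem pair_poisson_energy (ν : TopForm n Q) (m e : ℝ) {P : PhaseFn n Q} {φ : Q → ℝ}
    (hP : IsMomentumSquare P) (hφ : ContMDiff (𝓡 n) (modelWithCornersSelf ℝ ℝ) ∞ φ)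
    {f : PhaseFn n Q} (hf : f ∈ F₀Dual n Q) {g : FormalFn n Q} (hg : g ∈ F₀ n Q) :
    pair ν (poisson (kinetic m P + potential e φ) f) g = -coad ν (energy m e P φ) f g := by
  have hk := isHomogeneous_kinetic m hP
  have hp := isHomogeneous_potential (n := n) e hφ
  have hk' := (ofDegree_mem_degHat hk).1
  have hp' := (ofDegree_mem_degHat hp).1
  rw [coad, energy, lie_add_right hk' hp', pair_add_right ν hf (lie_mem_F₀ hg hk')
    (lie_mem_F₀ hg hp'), neg_add, ← coad, ← coad, ← br_eq_neg_coad ν hf hg hk',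
    ← br_eq_neg_coad ν hf hg hp', br_ofDegree, br_ofDegree, poisson_add_left hk.1 hp.1, pair, pair,
    pair, ← finsum_add_distrib (finite_support_pair_poisson ν hf hk hg)
      (finite_support_pair_poisson ν hf hp hg)]
  refine finsum_congr fun k => ?_
  rw [add_mul,
    liouvilleIntegral_add ν ((hk.poisson_isAdmissible hf.1).mul_isHomogeneous (hg k))
      ((hp.poisson_isAdmissible hf.1).mul_isHomogeneous (hg k))]

theorem isLiePoisson_pair_iff (ν : TopForm n Q) {h : FormalFn n Q} (hh : h ∈ F₀ n Q)
    {J : Set ℝ} {f : ℝ → PhaseFn n Q} (hf : ∀ t ∈ J, f t ∈ F₀Dual n Q) :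
    IsLiePoisson ν J (fun f => pair ν f h) f ↔
      ∀ t ∈ J, HasDualDeriv ν f (fun g => -coad ν h (f t) g) t := by
  refine forall₂_congr fun t ht => ?_
  have hv := hasVariation_pair ν hh (hf t ht)
  constructor
  · rintro ⟨h', hh', hd⟩
    obtain rfl := (hv.iff_eq h').1 hh'
    exact hd
  · exact fun hd => ⟨h, hv, hd⟩

theorem isLiePoisson_energy_iff (ν : TopForm n Q) (m e : ℝ) {P : PhaseFn n Q} {φ : Q → ℝ}
    (hP : IsMomentumSquare P) (hφ : ContMDiff (𝓡 n) (modelWithCornersSelf ℝ ℝ) ∞ φ)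
    {J : Set ℝ} {f : ℝ → PhaseFn n Q} (hf : ∀ t ∈ J, f t ∈ F₀Dual n Q) :
    IsLiePoisson ν J (fun f => pair ν f (energy m e P φ)) f ↔ IsVlasov ν J m e P φ f := by
  rw [isLiePoisson_pair_iff ν (energy_mem_F₀ m e hP hφ) hf]
  exact forall₂_congr fun t ht => HasDualDeriv.congr_iff fun g hg =>
    (pair_poisson_energy ν m e hP hφ (hf t ht) hg).symm

/-- The Vlasov equation is the Lie-Poisson equation of a linear Hamiltonian, and for its derivative
the matched equations have few terms. -/
theorem isVlasov_iff_matched (ν : TopForm n Q) (m e : ℝ) {P : PhaseFn n Q} {φ : Q → ℝ}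
    (hP : IsMomentumSquare P) (hφ : ContMDiff (𝓡 n) (modelWithCornersSelf ℝ ℝ) ∞ φ)
    {J : Set ℝ} (hJ : IsOpen J) {fs fn : ℝ → PhaseFn n Q}
    (hf : ∀ t ∈ J, fs t ∈ sDual n Q ∧ fn t ∈ nDual n Q) :
    IsVlasov ν J m e P φ (fun t => fs t + fn t) ↔
      ∀ t ∈ J,
        HasDualDeriv ν fs (fun g =>
          pair ν (poisson (potential e φ) (momentPart (fs t + fn t) 0)) g
            + pair ν (poisson (kinetic m P) (fs t)) g
            + pair ν (poisson (kinetic m P) (momentPart (fs t + fn t) 2)) g) t ∧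
        HasDualDeriv ν fn (fun g =>
          (∑ᶠ (l : ℕ) (_ : 1 ≤ l),
            pair ν (poisson (kinetic m P) (momentPart (fs t + fn t) (l + 2))) g)
            + pair ν (poisson (potential e φ) (fn t)) g
            + pair ν (poisson (potential e φ) (momentPart (fs t + fn t) 1)) g) t := by
  have hE := energy_mem_F₀ m e hP hφ
  have hf' : ∀ t ∈ J, fs t + fn t ∈ F₀Dual n Q := fun t ht =>
    F₀Dual_add (mem_F₀Dual_of_sDual (hf t ht).1) (hf t ht).2.1
  rw [← isLiePoisson_energy_iff ν m e hP hφ hf', isLiePoisson_pair_iff ν hE hf']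
  refine forall₂_congr fun t ht => (hasDualDeriv_iff_matched ν hJ hf hE ht).trans ?_
  exact and_congr (HasDualDeriv.congr_iff fun g _ => matchedS_energy ν m e P φ _ _ g)
    (HasDualDeriv.congr_iff fun g _ => matchedN_energy ν m e P φ _ _ g)

end Vlasov

end VlasovMatched

theorem corollary4p7 {n : ℕ} {Q : Type*} [TopologicalSpace Q] [T2Space Q] [SigmaCompactSpace Q]
    [ChartedSpace (E n) Q] [IsManifold (𝓡 n) ∞ Q] [MeasurableSpace Q] [BorelSpace Q]
    (ν : TopForm n Q) :
    -- the decomposition of the dual space into the duals of the two subalgebras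
    (∀ f ∈ F₀Dual n Q,
      (∀ k, momentPart f k ∈ degDual n Q k ∧ MomentVanishes k (f - momentPart f k)) ∧
      sComp f ∈ sDual n Q ∧ nComp f ∈ nDual n Q ∧ f = sComp f + nComp f ∧
      ∀ fs ∈ sDual n Q, ∀ fn ∈ nDual n Q,
        (∀ g ∈ F₀ n Q, pair ν f g = pair ν (fs + fn) g) →
        ∀ g ∈ F₀ n Q, pair ν fs g = pair ν (sComp f) g ∧ pair ν fn g = pair ν (nComp f) g) ∧
    -- the partial functional derivatives exist, are unique, and are the parts of `∂H/∂f`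
    (∀ (H : PhaseFn n Q → ℝ), ∀ f ∈ F₀Dual n Q, ∀ h : FormalFn n Q,
      HasVariation ν (F₀Dual n Q) (F₀ n Q) H f h →
      (∀ D, HasVariation ν (F₀Dual n Q) (F₀ n Q) H f D ↔ D = h) ∧
      (∀ D, HasVariation ν (sDual n Q) (sHat n Q) H f D ↔ D = sPart h) ∧
      (∀ D, HasVariation ν (nDual n Q) (nHat n Q) H f D ↔ D = nPart h) ∧
      (∀ k D, HasVariation ν (degDual n Q k) (degHat n Q k) H f D ↔ D = degPart k h)) ∧
    -- the terms of the matched equations, as the terms of the matched pair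
    (∀ fs ∈ sDual n Q, ∀ fn ∈ nDual n Q, ∀ σ ∈ sHat n Q, ∀ X ∈ nHat n Q, ∀ g ∈ F₀ n Q,
      -coadS ν σ fs g = br ν σ (momentPart (fs + fn) 0) g
        + br ν (degPart 1 σ) (momentPart (fs + fn) 1) g ∧
      dualActR ν fs X g = br ν X fs g ∧
      crossA ν X fn g = ∑ᶠ (k : ℕ) (_ : 2 ≤ k),
        (br ν (degPart k X) (momentPart (fs + fn) k) g
          + br ν (degPart (k + 1) X) (momentPart (fs + fn) k) g) ∧
      -coadN ν X fn g = ∑ᶠ (k : ℕ) (_ : 2 ≤ k) (l : ℕ) (_ : 1 ≤ l),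
        br ν (degPart k X) (momentPart (fs + fn) (l + k)) g ∧
      -dualActL ν σ fn g = br ν σ fn g ∧
      -crossB ν σ fs g = br ν (degPart 0 σ) (momentPart (fs + fn) 1) g) ∧
    -- the Lie-Poisson equation is equivalent to the matched Lie-Poisson equations
    (∀ (H : PhaseFn n Q → ℝ) (J : Set ℝ) (fs fn : ℝ → PhaseFn n Q), IsOpen J →
      (∀ t ∈ J, fs t ∈ sDual n Q ∧ fn t ∈ nDual n Q) →
      (∀ t ∈ J, ∃ h, HasVariation ν (F₀Dual n Q) (F₀ n Q) H (fs t + fn t) h) →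
      (IsLiePoisson ν J H (fun t => fs t + fn t) ↔ IsMatchedLiePoisson ν J H fs fn)) ∧
    -- the Vlasov equation
    (∀ (m e : ℝ) (P : PhaseFn n Q) (φ : Q → ℝ), 0 < m → IsMomentumSquare P →
      ContMDiff (𝓡 n) (modelWithCornersSelf ℝ ℝ) ∞ φ →
      -- the functional derivatives of `H(f) = ∫ f h dq dp`
      (∀ f ∈ F₀Dual n Q,
        HasVariation ν (F₀Dual n Q) (F₀ n Q) (fun f => pair ν f (energy m e P φ)) f
          (energy m e P φ) ∧
        HasVariation ν (sDual n Q) (sHat n Q) (fun f => pair ν f (energy m e P φ)) f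
          (ofDegree 0 (potential e φ)) ∧
        HasVariation ν (nDual n Q) (nHat n Q) (fun f => pair ν f (energy m e P φ)) f
          (ofDegree 2 (kinetic m P)) ∧
        HasVariation ν (degDual n Q 0) (degHat n Q 0) (fun f => pair ν f (energy m e P φ)) f
          (ofDegree 0 (potential e φ)) ∧
        HasVariation ν (degDual n Q 2) (degHat n Q 2) (fun f => pair ν f (energy m e P φ)) f
          (ofDegree 2 (kinetic m P)) ∧
        ∀ k, k ≠ 0 → k ≠ 2 →
          HasVariation ν (degDual n Q k) (degHat n Q k) (fun f => pair ν f (energy m e P φ)) f 0) ∧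
      -- the Lie-Poisson equation is the Vlasov equation
      (∀ (J : Set ℝ) (f : ℝ → PhaseFn n Q), IsOpen J → (∀ t ∈ J, f t ∈ F₀Dual n Q) →
        (IsLiePoisson ν J (fun f => pair ν f (energy m e P φ)) f ↔ IsVlasov ν J m e P φ f)) ∧
      -- the Vlasov equation is equivalent to the matched equations with these derivatives
      (∀ (J : Set ℝ) (fs fn : ℝ → PhaseFn n Q), IsOpen J →
        (∀ t ∈ J, fs t ∈ sDual n Q ∧ fn t ∈ nDual n Q) →
        (IsVlasov ν J m e P φ (fun t => fs t + fn t) ↔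
          ∀ t ∈ J,
            HasDualDeriv ν fs (fun g =>
              pair ν (poisson (potential e φ) (momentPart (fs t + fn t) 0)) g
                + pair ν (poisson (kinetic m P) (fs t)) g
                + pair ν (poisson (kinetic m P) (momentPart (fs t + fn t) 2)) g) t ∧
            HasDualDeriv ν fn (fun g =>
              (∑ᶠ (l : ℕ) (_ : 1 ≤ l),
                pair ν (poisson (kinetic m P) (momentPart (fs t + fn t) (l + 2))) g)
                + pair ν (poisson (potential e φ) (fn t)) g
                + pair ν (poisson (potential e φ) (momentPart (fs t + fn t) 1)) g) t)) ∧
      -- its right-hand side in coordinates with `p² = δ^{ij} p_i p_j`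
      (∀ (c : Q) (U : Set (E n)), IsOpen U → U ⊆ (extChartAt (𝓡 n) c).target →
        (∀ x ∈ U, ∀ p : E n, inChart c P (x, p) = ∑ l : Fin n, p l ^ 2) →
        ∀ f : PhaseFn n Q, IsSmooth f → ∀ x ∈ U, ∀ p : E n,
          inChart c (poisson (kinetic m P + potential e φ) f) (x, p) =
            e * ∑ l : Fin n, fderiv ℝ (φ ∘ (extChartAt (𝓡 n) c).symm) x (ev l)
                * fderiv ℝ (inChart c f) (x, p) (0, ev l)
              - 1 / m * ∑ l : Fin n, p l * fderiv ℝ (inChart c f) (x, p) (ev l, 0))) := by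
  refine ⟨fun f hf => ⟨fun k => ⟨momentPart_mem_degDual hf k, momentVanishes_sub_momentPart hf k⟩,
      sComp_mem_sDual hf, nComp_mem_nDual hf, sComp_add_nComp f, fun fs hfs fn hfn h g hg =>
        pair_eq_of_parts ν hf hfs hfn h hg⟩,
    fun H f _ h hH => ⟨hH.iff_eq, hH.sPart_iff, hH.nPart_iff, hH.degPart_iff⟩,
    fun fs hfs fn hfn σ hσ X hX g hg => ⟨neg_coadS_eq ν hfs hfn hσ hg, dualActR_eq ν hfs hX hg,
      crossA_eq ν hfs hfn hX hg, neg_coadN_eq ν hfs hfn hX hg, neg_dualActL_eq ν hfn hσ hg,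
      neg_crossB_eq ν hfs hfn hσ hg⟩,
    fun H J fs fn hJ hf hH => isLiePoisson_iff_isMatchedLiePoisson ν H hJ hf hH,
    fun m e P φ _ hP hφ => ⟨fun f hf => ?_,
      fun J f _ hf => isLiePoisson_energy_iff ν m e hP hφ hf,
      fun J fs fn hJ hf => isVlasov_iff_matched ν m e hP hφ hJ hf,
      fun c U hU hUc hPU f hf x hx p => inChart_poisson_energy m e hP hφ c hU hUc hPU hf hx p⟩⟩
  have hv := hasVariation_pair ν (energy_mem_F₀ m e hP hφ) hf
  refine ⟨hv, (hv.sPart_iff _).2 (sPart_energy m e P φ).symm,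
    (hv.nPart_iff _).2 (nPart_energy m e P φ).symm,
    (hv.degPart_iff 0 _).2 (degPart_energy_zero m e P φ).symm,
    (hv.degPart_iff 2 _).2 (degPart_energy_two m e P φ).symm, fun k h0 h2 =>
    (hv.degPart_iff k _).2 (degPart_energy_of_ne m e P φ h0 h2).symm⟩
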